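/- **Setting.** Write $p=|\mathbf p|$, let $\hat g(\mathbf p)=(2\pi)^{-3/2}\int_{\mathbb R^3}e^{-i\mathbf p\cdot\mathbf x}g(\mathbf x)\,d\mathbf x$, extended to tempered distributions $\mathcal S'$ by duality, let $m>0$, and let $H(\lambda)=T-\lambda V$ in one of the following cases. * Schrödinger: $T=-\Delta$ in $L_2(\mathbb R^3)$, with symbol $T(\mathbf p)=p^2$. * Pseudorelativistic: $T=\sqrt{-\Delta+m^2}-m$ in $L_2(\mathbb R^3)$, with symbol $T(\mathbf p)=\sqrt{p^2+m^2}-m$. * Dirac: $T=\alpha\cdot(-i\nabla)+m\beta-m$ in $L_2(\mathbb R^3;\mathbb C^4)$, with symbol $T(\mathbf p)=\alpha\cdot\mathbf p+m\beta-m$, where $\alpha,\beta$ are the Dirac matrices in the standard representation. In each case $T$ has the domain $\{\varphi\in L_2: T(\mathbf p)\hat\varphi\in L_2\}$. The potential satisfies $0\le V\in L_1\cap L_\infty$; it is real-valued in the first two cases and $V=\mathrm{diag}(V_1,\dots,V_4)$ with all $V_i\ge 0$ in the Dirac case, and $V^{1/2}$ is its pointwise square root. The gap is $(-\infty,0)$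 in the first two cases and $(-2m,0)$ in the Dirac case. A number $\lambda_c\in\mathbb R$ is a coupling constant threshold if there are a number $\delta>0$ and eigenvalues $E(\lambda)$ of $H(\lambda)$, $\lambda\in(\lambda_c,\lambda_c+\delta)$, in the gap with $E(\lambda)\to0$ as $\lambda\downarrow\lambda_c$. For $E<0$ near $0$ the resolvent kernels are $(T-E)^{-1}(\mathbf x,\mathbf y)=G_E(\mathbf x-\mathbf y)$ where, with $r=|\mathbf x|$, $Y_\nu(\mathbf x)=\frac{e^{-\nu r}}{4\pi r}$, $B(\mathbf x)=\frac{m}{2\pi^2}\frac{K_1(mr)}{r}$ ($K_1$ the modified Bessel function) and $\nu_E=\sqrt{m^2-(E+m)^2}$, $$G_E=Y_{\sqrt{|E|}}\ \text{(Schrödinger)},\qquad G_E=(E+m)Y_{\nu_E}+B+(m^2-\nu_E^2)\,B*Y_{\nu_E}\ \text{(pseudorelativistic)},$$ $$G_E(\mathbf x)=\frac{e^{-\nu_E r}}{4\pi}\Big(\frac{m\beta+m+E}{r}+\frac{i\nu_E\,\alpha\cdot\mathbf x}{r^2}+\frac{i\,\alpha\cdot\mathbf x}{r^3}\Big)\ \text{(Dirac)};$$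 the Dirac formula holds for all $E\in(-2m,0)$. A weight $w$ ($\mathbb C$-valued in the first two cases, $M_{4\times4}(\mathbb C)$-valued with any matrix norm in the Dirac case) is admissible if $$\frac{w(\mathbf p)}{p^2}\mathbf 1_{\{p<1\}}\in L_2\quad\text{and}\quad \frac{w(\mathbf p)}{p^k}\mathbf 1_{\{p\ge1\}}\in L_\infty,$$ with $k=2$ in the Schrödinger case and $k=1$ in the other two cases. **Theorem.** Let $\lambda_c$ be a coupling constant threshold with eigenvalue branch $E(\lambda)$, let $\lambda_n\downarrow\lambda_c$, and let $\varphi_n\in L_2$ satisfy $H(\lambda_n)\varphi_n=E(\lambda_n)\varphi_n$ with $E(\lambda_n)$ in the gap. Assume that $\mu_n:=V^{1/2}\varphi_n\to\mu_0$ in $L_2$. Then the limit $T^{-1}(\mathbf x,\mathbf y):=\lim_{E\uparrow0}(T-E)^{-1}(\mathbf x,\mathbf y)$ exists for $\mathbf x\ne\mathbf y$, the integral $$\varphi_0(\mathbf x):=\lambda_c\int_{\mathbb R^3}T^{-1}(\mathbf x,\mathbf y)V^{1/2}(\mathbf y)\mu_0(\mathbf y)\,d\mathbf y$$ converges absolutely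 for almost every $\mathbf x$, the functions $\varphi_0$ and $V\varphi_0$ belong to $\mathcal S'$, the distribution $\hat\varphi_0$ is a function, and for every admissible weight $w$ all $w\hat\varphi_n$ and $w\hat\varphi_0$ are in $L_2$ and $$w\hat\varphi_n\to w\hat\varphi_0\quad\text{in }L_2\text{ as }n\to\infty .$$ Furthermore, $H(\lambda_c)\varphi_0=0$ in $\mathcal S'$. In the Dirac case the analogous statement holds at the other threshold: if instead $E(\lambda)\in(-2m,0)$ are eigenvalues of $H(\lambda)$ for $\lambda\in(\lambda_c-\delta,\lambda_c)$ with $E(\lambda)\to-2m$ as $\lambda\uparrow\lambda_c$, if $\lambda_n\uparrow\lambda_c$, $\varphi_n\in L_2$, $H(\lambda_n)\varphi_n=E(\lambda_n)\varphi_n$ with $E(\lambda_n)\in(-2m,0)$, and $V^{1/2}\varphi_n\to\mu_{-2m}$ in $L_2$, then all the conclusions hold with $T^{-1}(\mathbf x,\mathbf y)$ replaced by $(T+2m)^{-1}(\mathbf x,\mathbf y):=\lim_{E\downarrow-2m}(T-E)^{-1}(\mathbf x,\mathbf y)$, with $\varphi_0$ replaced by $\varphi_{-2m}(\mathbf x):=\lambda_c\int_{\mathbb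 R^3}(T+2m)^{-1}(\mathbf x,\mathbf y)V^{1/2}(\mathbf y)\mu_{-2m}(\mathbf y)\,d\mathbf y$, and with the final equation replaced by $H(\lambda_c)\varphi_{-2m}=-2m\,\varphi_{-2m}$ in $\mathcal S'$. -/

import Mathlib

open MeasureTheory Filter Topology
open scoped SchwartzMap

noncomputable section

namespace Threshold

/-- Physical and momentum space. -/
abbrev R3 : Type := EuclideanSpace ℝ (Fin 3)

/-- Four-component spinors with the Euclidean norm. -/
abbrev C4 : Type := EuclideanSpace ℂ (Fin 4)

section General

variable {F : Type*} [NormedAddCommGroup F] [NormedSpace ℂ F]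

/-! ### Fourier transform, tempered distributions

Test functions for `F`-valued distributions are Schwartz functions with values in the dual
`F →L[ℂ] ℂ`; a function `u` acts on a test function `ψ` by `∫ ψ(x) (u(x)) dx`. -/

/-- The unitary Fourier transform `(2π)^(-3/2) ∫ exp(-i p·x) g(x) dx`. -/
def unitaryFourier (g : R3 → F) (p : R3) : F :=
  (((2 * Real.pi) ^ (-(3 / 2) : ℝ) : ℝ) : ℂ) •
    ∫ x : R3, Complex.exp (-(Complex.I * ((inner ℝ p x : ℝ) : ℂ))) • g x

/-- The inverse transform `(2π)^(-3/2) ∫ exp(i p·x) g(p) dp`. -/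
def unitaryFourierInv (g : R3 → F) (x : R3) : F :=
  (((2 * Real.pi) ^ (-(3 / 2) : ℝ) : ℝ) : ℂ) •
    ∫ p : R3, Complex.exp (Complex.I * ((inner ℝ p x : ℝ) : ℂ)) • g p

/-- The function `v` is the Fourier transform of the function `u` in the sense of tempered
distributions: `⟨v, ψ⟩ = ⟨u, ψ^⟩` for all test functions `ψ`, both pairings being absolutely
convergent integrals. It determines `v` almost everywhere. -/
def IsFourierTransform (u v : R3 → F) : Prop :=
  ∀ ψ : 𝓢(R3, F →L[ℂ] ℂ),
    Integrable (fun x => unitaryFourier ψ x (u x)) ∧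
    Integrable (fun p => ψ p (v p)) ∧
    ∫ p, ψ p (v p) = ∫ x, unitaryFourier ψ x (u x)

/-! ### The operators `T - λ V`

A kinetic energy is given by its symbol `T : R3 → F →L[ℂ] F`, a potential is the
operator of multiplication by `V : R3 → F →L[ℂ] F`. -/

/-- `u` is in the operator domain of the multiplier `T(-i∇)` in `L²`, namely
`{u ∈ L² : T(p) û(p) ∈ L²}`, and `v = T(-i∇) u`. -/
def IsKinetic (T : R3 → F →L[ℂ] F) (u v : R3 → F) : Prop :=
  MemLp u 2 volume ∧ MemLp v 2 volume ∧
    ∃ uhat : R3 → F, IsFourierTransform u uhat ∧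
      IsFourierTransform v (fun p => T p (uhat p))

/-- `u ∈ L²` is in the domain of `H(lam) = T - lam V` and `H(lam) u = E u`. -/
def SolvesInL2 (T V : R3 → F →L[ℂ] F) (lam E : ℝ) (u : R3 → F) : Prop :=
  ∃ v : R3 → F, IsKinetic T u v ∧
    ∀ᵐ x, v x - (lam : ℂ) • V x (u x) = (E : ℂ) • u x

/-- The transpose of `T(-i∇)` on test functions, which defines `T(-i∇)` on tempered
distributions: `⟨T(-i∇) u, ψ⟩ = ⟨u, transposeKinetic T ψ⟩`. -/
def transposeKinetic (T : R3 → F →L[ℂ] F) (ψ : R3 → F →L[ℂ] ℂ) : R3 → F →L[ℂ] ℂ :=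
  unitaryFourier fun p => (unitaryFourierInv ψ p).comp (T p)

/-- The function `u` and `V u` are tempered distributions, and
`T(-i∇) u - lam V u = E u` in the sense of tempered distributions. -/
def SolvesInTempered (T V : R3 → F →L[ℂ] F) (lam E : ℝ) (u : R3 → F) : Prop :=
  ∀ ψ : 𝓢(R3, F →L[ℂ] ℂ),
    Integrable (fun x => transposeKinetic T ψ x (u x)) ∧
    Integrable (fun x => ψ x (V x (u x))) ∧
    Integrable (fun x => ψ x (u x)) ∧
    (∫ x, transposeKinetic T ψ x (u x)) - (lam : ℂ) * ∫ x, ψ x (V x (u x))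
      = (E : ℂ) * ∫ x, ψ x (u x)

/-! ### Coupling constant thresholds -/

/-- `E` is a branch of eigenvalues of `T - lam V`, in the spectral gap `gap` of `T`, that
reaches the threshold energy `E₀` along the filter `l`. Here `l = 𝓝[>] lamc` says that this
happens as `lam ↓ lamc`, and `l = 𝓝[<] lamc` that it happens as `lam ↑ lamc`; then `lamc` is
a coupling constant threshold. -/
def IsCouplingThreshold (T V : R3 → F →L[ℂ] F) (gap : Set ℝ) (E₀ : ℝ) (l : Filter ℝ)
    (E : ℝ → ℝ) : Prop :=
  (∀ᶠ lam in l, E lam ∈ gap ∧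
    ∃ u : R3 → F, ¬ u =ᵐ[volume] 0 ∧ SolvesInL2 T V lam (E lam) u) ∧
  Tendsto E l (𝓝 E₀)

/-- A coupling constant threshold, couplings `lam n` tending to it, solutions
`φ n ∈ L²` of `H(lam n) (φ n) = E(lam n) (φ n)`, and convergence in `L²` of the
Birman-Schwinger functions `μ n = V^(1/2) (φ n)` to `μ₀`. Here `W` is `V^(1/2)`. -/
structure IsThresholdSequence (T V W : R3 → F →L[ℂ] F) (gap : Set ℝ) (E₀ : ℝ)
    (l : Filter ℝ) (E : ℝ → ℝ) (lam : ℕ → ℝ) (φ : ℕ → R3 → F) (μ₀ : R3 → F) : Prop where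
  threshold : IsCouplingThreshold T V gap E₀ l E
  coupling : Tendsto lam atTop l
  energy : ∀ n, E (lam n) ∈ gap
  solves : ∀ n, SolvesInL2 T V (lam n) (E (lam n)) (φ n)
  limit_memLp : MemLp μ₀ 2 volume
  limit : Tendsto (fun n => eLpNorm (fun x => W x (φ n x) - μ₀ x) 2 volume) atTop (𝓝 0)

/-- The limit along `l` of the translation invariant resolvent kernels
`(T - E)⁻¹(x, y) = G E (x - y)`, as a function of `x - y`. -/
def limitKernel (G : ℝ → R3 → F →L[ℂ] F) (l : Filter ℝ) (x : R3) : F →L[ℂ] F :=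
  limUnder l fun E => G E x

/-- The threshold energy state `lamc ∫ K(x - y) V^(1/2)(y) μ₀(y) dy`. -/
def thresholdState (K W : R3 → F →L[ℂ] F) (lamc : ℝ) (μ₀ : R3 → F) (x : R3) : F :=
  (lamc : ℂ) • ∫ y, K (x - y) (W y (μ₀ y))

/-- The condition on weights: `w(p) χ_{|p| < 1} / |p|^2 ∈ L²` and
`w(p) χ_{|p| ≥ 1} / |p|^k ∈ L^∞`, with the operator norm on values. -/
def IsWeight (k : ℕ) (w : R3 → F →L[ℂ] F) : Prop :=
  MemLp ({p : R3 | ‖p‖ < 1}.indicator fun p => (((‖p‖ ^ 2)⁻¹ : ℝ) : ℂ) • w p) 2 volume ∧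
  MemLp ({p : R3 | 1 ≤ ‖p‖}.indicator fun p => (((‖p‖ ^ k)⁻¹ : ℝ) : ℂ) • w p) ⊤ volume

/-- `w vₙ → w v₀` in `L²`, all these functions being in `L²`. -/
def WeightedTendsto (w : R3 → F →L[ℂ] F) (v : ℕ → R3 → F) (v₀ : R3 → F) : Prop :=
  (∀ n, MemLp (fun p => w p (v n p)) 2 volume) ∧
  MemLp (fun p => w p (v₀ p)) 2 volume ∧
  Tendsto (fun n => eLpNorm (fun p => w p (v n p) - w p (v₀ p)) 2 volume) atTop (𝓝 0)

/-- What is claimed for a threshold sequence, with `lK` the filter along which the energy in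
the resolvent kernel `G` goes to the threshold `E₀`, and `weights` the admissible weights:
the limit kernel exists off the diagonal, the integral defining `φ₀` converges almost everywhere,
the Fourier transforms of `φ n` and of `φ₀` are functions, these converge in the weighted
sense, and `H(lamc) φ₀ = E₀ φ₀` as tempered distributions. -/
structure ThresholdConclusion (T V W : R3 → F →L[ℂ] F) (G : ℝ → R3 → F →L[ℂ] F)
    (lK : Filter ℝ) (E₀ lamc : ℝ) (φ : ℕ → R3 → F) (μ₀ : R3 → F)
    (weights : Set (R3 → F →L[ℂ] F)) : Prop where
  kernel_limit : ∀ x : R3, x ≠ 0 → Tendsto (fun E => G E x) lK (𝓝 (limitKernel G lK x))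
  state_integrable : ∀ᵐ x : R3, Integrable fun y => limitKernel G lK (x - y) (W y (μ₀ y))
  convergence : ∃ (φhat : ℕ → R3 → F) (φhat₀ : R3 → F),
    (∀ n, IsFourierTransform (φ n) (φhat n)) ∧
    IsFourierTransform (thresholdState (limitKernel G lK) W lamc μ₀) φhat₀ ∧
    ∀ w ∈ weights, WeightedTendsto w φhat φhat₀
  equation : SolvesInTempered T V lamc E₀ (thresholdState (limitKernel G lK) W lamc μ₀)

end General

/-! ### Scalar cases -/

/-- Multiplication by a scalar, on `ℂ`. -/
def mulOp (c : ℂ) : ℂ →L[ℂ] ℂ := c • ContinuousLinearMap.id ℂ ℂ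

/-- The symbol `p^2` of `-Δ`. -/
def symbolS (p : R3) : ℂ →L[ℂ] ℂ := mulOp ((‖p‖ ^ 2 : ℝ) : ℂ)

/-- The symbol of `√(-Δ + m^2) - m`. -/
def symbolRel (m : ℝ) (p : R3) : ℂ →L[ℂ] ℂ :=
  mulOp ((Real.sqrt (‖p‖ ^ 2 + m ^ 2) - m : ℝ) : ℂ)

/-- The kernel `exp(-ν r) / (4 π r)` of `(-Δ + ν^2)⁻¹`. -/
def yukawa (ν : ℝ) (x : R3) : ℝ := Real.exp (-(ν * ‖x‖)) / (4 * Real.pi * ‖x‖)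

/-- The kernel of `(-Δ - E)⁻¹`, for `E < 0`. -/
def kernelS (E : ℝ) (x : R3) : ℂ →L[ℂ] ℂ := mulOp (yukawa (Real.sqrt |E|) x : ℂ)

/-- The modified Bessel function `K₁` (`z > 0`), by the standard integral
`K₁(z) = (1/2) (z/2) ∫₀^∞ exp(-t - z^2/(4t)) t^(-2) dt`. -/
def besselK1 (z : ℝ) : ℝ :=
  1 / 2 * (z / 2) * ∫ t in Set.Ioi (0 : ℝ), Real.exp (-t - z ^ 2 / (4 * t)) / t ^ 2

/-- The kernel `(m / (2 π^2)) K₁(m r) / r` of `(-Δ + m^2)^(-1/2)`. -/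
def besselKernel (m : ℝ) (x : R3) : ℝ :=
  m / (2 * Real.pi ^ 2) * (besselK1 (m * ‖x‖) / ‖x‖)

/-- `ν_E = √(m^2 - (E + m)^2)`, for `-2m < E < 0`. -/
def nu (m E : ℝ) : ℝ := Real.sqrt (m ^ 2 - (E + m) ^ 2)

/-- The kernel of `(√(-Δ + m^2) - m - E)⁻¹`, for `-2m < E < 0`. -/
def kernelRel (m E : ℝ) (x : R3) : ℂ →L[ℂ] ℂ :=
  mulOp (((E + m) * yukawa (nu m E) x + besselKernel m x
    + (m ^ 2 - nu m E ^ 2) * ∫ z : R3, besselKernel m z * yukawa (nu m E) (x - z) : ℝ) : ℂ)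

/-! ### Dirac case -/

/-- The Dirac matrices `α₁, α₂, α₃` in the standard representation. -/
def diracAlpha : Fin 3 → Matrix (Fin 4) (Fin 4) ℂ :=
  ![!![0, 0, 0, 1; 0, 0, 1, 0; 0, 1, 0, 0; 1, 0, 0, 0],
    !![0, 0, 0, -Complex.I; 0, 0, Complex.I, 0; 0, -Complex.I, 0, 0; Complex.I, 0, 0, 0],
    !![0, 0, 1, 0; 0, 0, 0, -1; 1, 0, 0, 0; 0, -1, 0, 0]]

/-- The Dirac matrix `β`. -/
def diracBeta : Matrix (Fin 4) (Fin 4) ℂ := Matrix.diagonal ![1, 1, -1, -1]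

/-- `α · p`. -/
def alphaDot (p : R3) : Matrix (Fin 4) (Fin 4) ℂ := ∑ j, ((p j : ℝ) : ℂ) • diracAlpha j

/-- The operator on `ℂ⁴` of a matrix. -/
def matOp (A : Matrix (Fin 4) (Fin 4) ℂ) : C4 →L[ℂ] C4 := Matrix.toEuclideanCLM (𝕜 := ℂ) A

/-- The operator on `ℂ⁴` of a real diagonal matrix. -/
def diagOp (d : Fin 4 → ℝ) : C4 →L[ℂ] C4 := matOp (Matrix.diagonal fun i => ((d i : ℝ) : ℂ))

/-- The symbol `α · p + m β - m`. -/
def symbolD (m : ℝ) (p : R3) : C4 →L[ℂ] C4 :=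
  matOp (alphaDot p + (m : ℂ) • diracBeta - (m : ℂ) • (1 : Matrix (Fin 4) (Fin 4) ℂ))

/-- The kernel of `(α·(-i∇) + m β - m - E)⁻¹`, for `-2m < E < 0`, namely
`(exp(-ν r) / (4 π)) ((m β + m + E) / r + i ν α·x / r^2 + i α·x / r^3)`. -/
def kernelD (m E : ℝ) (x : R3) : C4 →L[ℂ] C4 :=
  matOp (((Real.exp (-(nu m E * ‖x‖)) / (4 * Real.pi) : ℝ) : ℂ) •
    (((‖x‖⁻¹ : ℝ) : ℂ) • ((m : ℂ) • diracBeta + ((m + E : ℝ) : ℂ) • (1 : Matrix (Fin 4) (Fin 4) ℂ))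
      + (Complex.I * ((nu m E / ‖x‖ ^ 2 : ℝ) : ℂ)) • alphaDot x
      + (Complex.I * ((1 / ‖x‖ ^ 3 : ℝ) : ℂ)) • alphaDot x))

end Threshold

end

/-!
# Convergence of bound states to threshold states

Write `f n = lam n • V (φ n)` and `f₀ = lamc • V^(1/2) μ₀`. The eigenvalue equation in momentum
space says that `φ n` has the Fourier transform `R (E n) p (f n)^(p)`, where
`R E p = (T(p) - E)⁻¹`. Since `V^(1/2)` is in `L² ∩ L^∞`, the convergence of `V^(1/2) (φ n)` in
`L²` gives `f n → f₀` in `L¹ ∩ L²`, hence `(f n)^ → f₀^` in `L^∞ ∩ L²`. On the other hand `R E p`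
is bounded, uniformly in the gap, by `C |p|⁻²` for small and by `C |p|⁻ᵏ` for large `p`, and it is
continuous in `E` at the threshold. The admissible weights are those that these bounds admit: the
part `|p| < 1` is estimated by `w |p|⁻² ∈ L²` and `(f n)^ ∈ L^∞`, the part `|p| ≥ 1` by
`w |p|⁻ᵏ ∈ L^∞` and `(f n)^ ∈ L²`, and dominated convergence deals with the dependence on `E`
(`IsResolventSymbol.weightedTendsto`).

The limit `R E₀ p f₀^(p)` is the Fourier transform of the threshold state, because the limit of
the resolvent kernels has the symbol `R E₀` (`HasSymbol`, `HasSymbol.isFourierPair_convolution`).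
That the state solves the equation needs in addition `V^(1/2) φ₀ = μ₀`. The weight `min |p| 1` is
admissible, and convergence with this weight puts `φ n - φ₀` into `L^∞ + L²` with a norm that
tends to `0`; so a subsequence of `φ n` converges to `φ₀` almost everywhere
(`exists_subseq_tendsto_ae`), which identifies the `L²` limit of `V^(1/2) (φ n)`. This argument is
carried out for a general symbol in `thresholdConclusion_of_symbol`.

What remains is to verify the symbol of each limit kernel. At a threshold the kernels are built
from the Coulomb kernel `1 / (4π|x|)`, its gradient, the kernel of `(p² + m²)^(-1/2)` and the
convolution of the latter with the Coulomb kernel. The first three are superpositions of heat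
kernels or of their gradients, whose Fourier transforms are explicit, so that their symbols follow
from Fubini's theorem (`hasSymbol_coulomb`, `hasSymbol_gradCoulomb`,
`unitaryFourier_besselKernel`); the symbol of the convolution is the product
(`HasSymbol.convolution`). In the pseudorelativistic case the three terms of the kernel add up to
`1 / (√(p² + m²) - m)` (`hasSymbol_kernelRel_zero`); in the Dirac case the resolvent is explicit
because `(α·p + mβ)² = p² + m²` (`alphaDot_add_beta_sq`), and `ν_E = 0` at both thresholds.
-/

noncomputable section

namespace Threshold

/-! ### The unitary Fourier transform -/

variable {A : Type*} [NormedAddCommGroup A] [NormedSpace ℂ A]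

open FourierTransform in
lemma unitaryFourier_eq_fourier (g : R3 → A) (p : R3) :
    unitaryFourier g p =
      (((2 * Real.pi) ^ (-(3 / 2) : ℝ) : ℝ) : ℂ) • 𝓕 g ((2 * Real.pi)⁻¹ • p) := by
  rw [unitaryFourier, Real.fourier_eq']
  congr 2
  funext x
  congr 2
  rw [inner_smul_right, real_inner_comm]
  have : (Real.pi : ℂ) ≠ 0 := by exact_mod_cast Real.pi_ne_zero
  push_cast
  field_simp

open FourierTransform in
lemma unitaryFourierInv_eq_fourierInv (g : R3 → A) (p : R3) :
    unitaryFourierInv g p =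
      (((2 * Real.pi) ^ (-(3 / 2) : ℝ) : ℝ) : ℂ) • 𝓕⁻ g ((2 * Real.pi)⁻¹ • p) := by
  rw [unitaryFourierInv, Real.fourierInv_eq']
  congr 2
  funext x
  congr 2
  rw [inner_smul_right]
  have : (Real.pi : ℂ) ≠ 0 := by exact_mod_cast Real.pi_ne_zero
  push_cast
  field_simp

lemma normalization_sq_mul :
    (2 * Real.pi) ^ (-(3 / 2) : ℝ) * (2 * Real.pi) ^ (-(3 / 2) : ℝ) * (2 * Real.pi) ^ 3 = 1 := by
  rw [← Real.rpow_add (by positivity), ← Real.rpow_natCast, ← Real.rpow_add (by positivity)]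
  norm_num

lemma normalization_pos : 0 < (2 * Real.pi) ^ (-(3 / 2) : ℝ) := by positivity

/-- The dilation `p ↦ (2π)⁻¹ p`, which relates the two normalizations of the Fourier transform. -/
def dilation : R3 ≃L[ℝ] R3 :=
  ContinuousLinearEquiv.smulLeft
    (Units.mk0 ((2 * Real.pi)⁻¹) (by positivity : (2 * Real.pi)⁻¹ ≠ 0))

open FourierTransform in
/-- The unitary Fourier transform as an operation on Schwartz functions. -/
def schwartzFourier (ψ : 𝓢(R3, A)) : 𝓢(R3, A) :=
  (((2 * Real.pi) ^ (-(3 / 2) : ℝ) : ℝ) : ℂ) •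
    SchwartzMap.compCLMOfContinuousLinearEquiv ℂ dilation (𝓕 ψ)

lemma schwartzFourier_apply (ψ : 𝓢(R3, A)) (p : R3) :
    schwartzFourier ψ p = unitaryFourier ψ p := by
  rw [unitaryFourier_eq_fourier]
  rfl

open FourierTransform in
/-- The inverse unitary Fourier transform as an operation on Schwartz functions. -/
def schwartzFourierInv [CompleteSpace A] (ψ : 𝓢(R3, A)) : 𝓢(R3, A) :=
  (((2 * Real.pi) ^ (-(3 / 2) : ℝ) : ℝ) : ℂ) •
    SchwartzMap.compCLMOfContinuousLinearEquiv ℂ dilation (𝓕⁻ ψ)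

lemma schwartzFourierInv_apply [CompleteSpace A] (ψ : 𝓢(R3, A)) (p : R3) :
    schwartzFourierInv ψ p = unitaryFourierInv ψ p := by
  rw [unitaryFourierInv_eq_fourierInv, schwartzFourierInv, smul_apply,
    SchwartzMap.compCLMOfContinuousLinearEquiv_apply, SchwartzMap.fourierInv_coe]
  rfl

lemma integral_comp_dilation (g : R3 → A) :
    ∫ x, g ((2 * Real.pi)⁻¹ • x) = (((2 * Real.pi) ^ 3 : ℝ) : ℂ) • ∫ x, g x := by
  rw [Measure.integral_comp_inv_smul_of_nonneg _ _ (by positivity)]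
  simp [← Complex.coe_smul]

open FourierTransform in
/-- The unitary transform undoes the dilation in `unitaryFourierInv_eq_fourierInv`. -/
lemma unitaryFourier_comp_dilation (g : R3 → A) (p : R3) :
    unitaryFourier (fun x => (((2 * Real.pi) ^ (-(3 / 2) : ℝ) : ℝ) : ℂ) • g ((2 * Real.pi)⁻¹ • x)) p
      = 𝓕 g p := by
  have h := integral_comp_dilation
    (fun x => Complex.exp (-(Complex.I * ((inner ℝ p ((2 * Real.pi) • x) : ℝ) : ℂ))) • g x)
  have h1 : ∀ x : R3, (2 * Real.pi) • ((2 * Real.pi)⁻¹ • x) = x := fun x => by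
    rw [smul_smul, mul_inv_cancel₀ (by positivity), one_smul]
  simp only [h1] at h
  simp only [unitaryFourier, smul_comm (Complex.exp _)]
  rw [integral_smul, h, smul_smul, smul_smul, ← Complex.ofReal_mul, ← Complex.ofReal_mul,
    normalization_sq_mul, Complex.ofReal_one, one_smul, Real.fourier_eq']
  congr 1
  funext x
  congr 2
  rw [inner_smul_right, real_inner_comm]
  push_cast
  ring

open FourierTransform in
lemma schwartzFourier_schwartzFourierInv [CompleteSpace A] (ψ : 𝓢(R3, A)) :
    schwartzFourier (schwartzFourierInv ψ) = ψ := by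
  ext p
  rw [schwartzFourier_apply]
  have : (schwartzFourierInv ψ : R3 → A) = fun x =>
      (((2 * Real.pi) ^ (-(3 / 2) : ℝ) : ℝ) : ℂ) • (𝓕⁻ ψ) ((2 * Real.pi)⁻¹ • x) := rfl
  rw [this, unitaryFourier_comp_dilation, ← SchwartzMap.fourier_coe, fourier_fourierInv_eq]

/-- `v` is the Fourier transform of `u`, tested with scalar Schwartz functions and with vector
valued integrals. For finite dimensional values this is equivalent to `IsFourierTransform`, whose
test functions take values in the dual space. -/
def IsFourierPair (u v : R3 → A) : Prop :=
  ∀ χ : 𝓢(R3, ℂ),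
    Integrable (fun x => unitaryFourier χ x • u x) ∧
    Integrable (fun p => χ p • v p) ∧
    ∫ p, χ p • v p = ∫ x, unitaryFourier χ x • u x

lemma unitaryFourier_eq_vectorFourier (g : R3 → A) (p : R3) :
    unitaryFourier g p = (((2 * Real.pi) ^ (-(3 / 2) : ℝ) : ℝ) : ℂ) •
      VectorFourier.fourierIntegral Real.fourierChar volume ((2 * Real.pi)⁻¹ • innerₗ R3) g p := by
  rw [unitaryFourier_eq_fourier, Real.fourier_eq, VectorFourier.fourierIntegral]
  congr 2
  funext x
  simp [inner_smul_right]

lemma continuous_unitaryFourier {g : R3 → A} (hg : Integrable g) :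
    Continuous (unitaryFourier g) := by
  have : unitaryFourier g = fun p => (((2 * Real.pi) ^ (-(3 / 2) : ℝ) : ℝ) : ℂ) •
      VectorFourier.fourierIntegral Real.fourierChar volume ((2 * Real.pi)⁻¹ • innerₗ R3) g p :=
    funext (unitaryFourier_eq_vectorFourier g)
  rw [this]
  refine continuous_const.smul
    (VectorFourier.fourierIntegral_continuous Real.continuous_fourierChar ?_ hg)
  simp only [LinearMap.smul_apply, innerₗ_apply_apply]
  fun_prop

lemma norm_exp_I_inner (p x : R3) :
    ‖Complex.exp (-(Complex.I * ((inner ℝ p x : ℝ) : ℂ)))‖ = 1 := by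
  rw [← mul_neg, mul_comm, ← Complex.ofReal_neg, Complex.norm_exp_ofReal_mul_I]

lemma norm_unitaryFourier_le (g : R3 → A) (p : R3) :
    ‖unitaryFourier g p‖ ≤ (2 * Real.pi) ^ (-(3 / 2) : ℝ) * ∫ x, ‖g x‖ := by
  rw [unitaryFourier, norm_smul, Complex.norm_real, Real.norm_of_nonneg normalization_pos.le]
  gcongr
  refine (norm_integral_le_integral_norm _).trans_eq ?_
  simp only [norm_smul, norm_exp_I_inner, one_mul]

lemma integrable_exp_smul {g : R3 → A} (hg : Integrable g) (p : R3) :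
    Integrable fun x => Complex.exp (-(Complex.I * ((inner ℝ p x : ℝ) : ℂ))) • g x := by
  refine hg.bdd_smul 1 (Continuous.aestronglyMeasurable (by fun_prop)) (.of_forall fun x => ?_)
  rw [norm_exp_I_inner]

lemma integrable_exp_smul_right {g : R3 → A} (hg : Integrable g) (y : R3) :
    Integrable fun p => Complex.exp (-(Complex.I * ((inner ℝ p y : ℝ) : ℂ))) • g p := by
  simpa only [real_inner_comm] using integrable_exp_smul hg y

lemma unitaryFourier_sub {f g : R3 → A} (hf : Integrable f) (hg : Integrable g) (p : R3) :
    unitaryFourier (fun x => f x - g x) p = unitaryFourier f p - unitaryFourier g p := by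
  simp only [unitaryFourier, smul_sub]
  rw [integral_sub (integrable_exp_smul hf p) (integrable_exp_smul hg p), smul_sub]

/-- Fubini's theorem: the integral transform is its own transpose. -/
lemma integral_unitaryFourier_smul [CompleteSpace A] {χ : R3 → ℂ} {f : R3 → A} (hχ : Integrable χ)
    (hf : Integrable f) :
    ∫ p, χ p • unitaryFourier f p = ∫ x, unitaryFourier χ x • f x := by
  have h := VectorFourier.integral_fourierIntegral_smul_eq_flip (μ := volume) (ν := volume)
    (L := (2 * Real.pi)⁻¹ • innerₗ R3) (f := χ) (g := f) Real.continuous_fourierChar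
    (by simp only [LinearMap.smul_apply, innerₗ_apply_apply]; fun_prop) hχ hf
  have hflip : ((2 * Real.pi)⁻¹ • innerₗ R3).flip = (2 * Real.pi)⁻¹ • innerₗ R3 := by
    ext x y
    simp [real_inner_comm]
  rw [hflip] at h
  simp only [unitaryFourier_eq_vectorFourier, smul_comm (χ _), smul_assoc]
  rw [integral_smul, integral_smul, h]

lemma integrable_schwartz_unitaryFourier (χ : 𝓢(R3, A)) : Integrable (unitaryFourier χ) := by
  have : unitaryFourier χ = schwartzFourier χ := (funext (schwartzFourier_apply χ)).symm
  rw [this]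
  exact (schwartzFourier χ).integrable

lemma exists_bound_schwartz (χ : 𝓢(R3, A)) : ∃ C, ∀ x, ‖χ x‖ ≤ C :=
  ⟨_, SchwartzMap.norm_le_seminorm ℂ χ⟩

lemma exists_bound_unitaryFourier (χ : 𝓢(R3, A)) : ∃ C, ∀ x, ‖unitaryFourier χ x‖ ≤ C :=
  ⟨_, norm_unitaryFourier_le χ⟩

lemma isFourierPair_unitaryFourier [CompleteSpace A] {f : R3 → A} (hf : Integrable f) :
    IsFourierPair f (unitaryFourier f) := by
  intro χ
  obtain ⟨C, hC⟩ := exists_bound_unitaryFourier χ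
  refine ⟨hf.bdd_smul C (integrable_schwartz_unitaryFourier χ).1 (.of_forall hC), ?_,
    integral_unitaryFourier_smul χ.integrable hf⟩
  exact χ.integrable.smul_bdd _ (continuous_unitaryFourier hf).aestronglyMeasurable
    (.of_forall (norm_unitaryFourier_le f))

/-- A function whose products with all test functions are integrable with integral `0`
vanishes. -/
lemma ae_eq_zero_of_schwartz [CompleteSpace A] {v : R3 → A}
    (hv : ∀ χ : 𝓢(R3, ℂ), Integrable (fun p => χ p • v p))
    (h0 : ∀ χ : 𝓢(R3, ℂ), ∫ p, χ p • v p = 0) : v =ᵐ[volume] 0 := by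
  -- A bump function that equals `1` on the compact set gives local integrability.
  have hloc : LocallyIntegrable v := by
    rw [locallyIntegrable_iff]
    intro K hK
    obtain ⟨R, hR⟩ := hK.isBounded.subset_closedBall (0 : R3)
    let b : ContDiffBump (0 : R3) :=
      ⟨max R 1, max R 1 + 1, lt_max_of_lt_right one_pos, lt_add_one _⟩
    have hc : HasCompactSupport (fun x => (b x : ℂ)) :=
      b.hasCompactSupport.comp_left (g := Complex.ofReal) rfl
    have hg : ContDiff ℝ (⊤ : ℕ∞) (fun x => (b x : ℂ)) :=
      Complex.ofRealCLM.contDiff.comp b.contDiff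
    refine ((hv (hc.toSchwartzMap hg)).integrableOn (s := K)).congr_fun (fun x hx => ?_)
      hK.measurableSet
    have : b x = 1 := b.one_of_mem_closedBall
      (Metric.closedBall_subset_closedBall (le_max_left _ _) (hR hx))
    simp [this]
  refine ae_eq_zero_of_integral_contDiff_smul_eq_zero hloc fun g hg hc => ?_
  have hc' : HasCompactSupport (fun x => (g x : ℂ)) := hc.comp_left (g := Complex.ofReal) rfl
  have hg' : ContDiff ℝ (⊤ : ℕ∞) (fun x => (g x : ℂ)) := Complex.ofRealCLM.contDiff.comp hg
  simpa using h0 (hc'.toSchwartzMap hg')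

namespace IsFourierPair

variable {u u' v v' : R3 → A}

lemma congr (h : IsFourierPair u v) (hu : u =ᵐ[volume] u') (hv : v =ᵐ[volume] v') :
    IsFourierPair u' v' := by
  intro χ
  obtain ⟨h1, h2, h3⟩ := h χ
  have e1 : (fun x => unitaryFourier χ x • u x) =ᵐ[volume] fun x => unitaryFourier χ x • u' x := by
    filter_upwards [hu] with x hx
    rw [hx]
  have e2 : (fun x => χ x • v x) =ᵐ[volume] fun x => χ x • v' x := by
    filter_upwards [hv] with x hx
    rw [hx]
  exact ⟨h1.congr e1, h2.congr e2, by rw [← integral_congr_ae e1, ← integral_congr_ae e2, h3]⟩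

lemma add (h : IsFourierPair u v) (h' : IsFourierPair u' v') :
    IsFourierPair (fun x => u x + u' x) (fun p => v p + v' p) := by
  intro χ
  obtain ⟨h1, h2, h3⟩ := h χ
  obtain ⟨h1', h2', h3'⟩ := h' χ
  simp only [smul_add]
  exact ⟨h1.add h1', h2.add h2', by rw [integral_add h1 h1', integral_add h2 h2', h3, h3']⟩

lemma const_smul (h : IsFourierPair u v) (c : ℂ) :
    IsFourierPair (fun x => c • u x) (fun p => c • v p) := by
  intro χ
  obtain ⟨h1, h2, h3⟩ := h χ
  simp only [smul_comm _ c]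
  exact ⟨h1.smul c, h2.smul c, by rw [integral_smul, integral_smul, h3]⟩

lemma sub (h : IsFourierPair u v) (h' : IsFourierPair u' v') :
    IsFourierPair (fun x => u x - u' x) (fun p => v p - v' p) := by
  simpa [sub_eq_add_neg] using h.add (h'.const_smul (-1))

lemma ae_eq_right [CompleteSpace A] (h : IsFourierPair u v) (h' : IsFourierPair u v') :
    v =ᵐ[volume] v' := by
  have h0 := ae_eq_zero_of_schwartz (v := fun p => v p - v' p) (fun χ => ((h.sub h') χ).2.1)
    (fun χ => by rw [((h.sub h') χ).2.2]; simp)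
  filter_upwards [h0] with p hp using sub_eq_zero.mp hp

/-- Injectivity of the Fourier transform: every test function is a transform. -/
lemma ae_eq_left [CompleteSpace A] (h : IsFourierPair u v) (h' : IsFourierPair u' v) :
    u =ᵐ[volume] u' := by
  have key : ∀ χ : 𝓢(R3, ℂ), (χ : R3 → ℂ) = unitaryFourier (schwartzFourierInv χ) := fun χ => by
    funext x
    rw [← schwartzFourier_apply, schwartzFourier_schwartzFourierInv]
  have h0 := ae_eq_zero_of_schwartz (v := fun p => u p - u' p)
    (fun χ => by rw [key]; exact ((h.sub h') _).1)
    (fun χ => by rw [key, ← ((h.sub h') _).2.2]; simp)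
  filter_upwards [h0] with p hp using sub_eq_zero.mp hp

end IsFourierPair

/-! ### Scalar and dual-valued test functions -/

section FiniteDimensional

variable {F : Type*} [NormedAddCommGroup F] [NormedSpace ℂ F]

lemma unitaryFourier_apply_vector (ψ : 𝓢(R3, F →L[ℂ] ℂ)) (x : R3) (e : F) :
    unitaryFourier ψ x e = unitaryFourier (fun p => ψ p e) x := by
  rw [unitaryFourier, unitaryFourier, smul_apply,
    ContinuousLinearMap.integral_apply (integrable_exp_smul ψ.integrable x)]
  rfl

lemma IsFourierTransform.isFourierPair [FiniteDimensional ℂ F] {u v : R3 → F}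
    (h : IsFourierTransform u v) : IsFourierPair u v := by
  have := FiniteDimensional.complete ℂ F
  intro χ
  let b := Module.finBasis ℂ F
  let ℓ : Fin (Module.finrank ℂ F) → F →L[ℂ] ℂ := fun i => (b.coord i).toContinuousLinearMap
  -- The dual-valued test function `χ ⊗ ℓ i` tests the `i`-th coordinate with `χ`.
  let ψ : Fin (Module.finrank ℂ F) → 𝓢(R3, F →L[ℂ] ℂ) := fun i =>
    χ.postcompCLM (ContinuousLinearMap.toSpanSingleton ℂ (ℓ i))
  have hrep : ∀ w : F, w = ∑ i, ℓ i w • b i := fun w => (b.sum_repr w).symm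
  have hψ : ∀ i x, ψ i x = χ x • ℓ i := fun i x => rfl
  have hψ' : ∀ i x w, unitaryFourier (ψ i) x w = unitaryFourier χ x * ℓ i w := by
    intro i x w
    rw [unitaryFourier_apply_vector]
    simp only [hψ, smul_apply, smul_eq_mul, unitaryFourier, ← mul_assoc]
    rw [integral_mul_const]
    ring
  have e1 : (fun x => unitaryFourier χ x • u x) =
      fun x => ∑ i, (unitaryFourier (ψ i) x (u x)) • b i := by
    funext x
    conv_lhs => rw [hrep (u x), Finset.smul_sum]
    simp only [hψ', smul_smul]
  have e2 : (fun x => χ x • v x) = fun x => ∑ i, (ψ i x (v x)) • b i := by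
    funext x
    conv_lhs => rw [hrep (v x), Finset.smul_sum]
    simp only [hψ, smul_smul, smul_apply, smul_eq_mul]
  have i1 : ∀ i ∈ Finset.univ, Integrable (fun x => (unitaryFourier (ψ i) x (u x)) • b i) :=
    fun i _ => (h (ψ i)).1.smul_const (b i)
  have i2 : ∀ i ∈ Finset.univ, Integrable (fun x => (ψ i x (v x)) • b i) :=
    fun i _ => (h (ψ i)).2.1.smul_const (b i)
  rw [e1, e2, integral_finsetSum _ i1, integral_finsetSum _ i2]
  refine ⟨integrable_finsetSum _ i1, integrable_finsetSum _ i2, ?_⟩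
  simp only [integral_smul_const, (h (ψ _)).2.2]

lemma IsFourierPair.isFourierTransform [FiniteDimensional ℂ F] {u v : R3 → F}
    (h : IsFourierPair u v) : IsFourierTransform u v := by
  have := FiniteDimensional.complete ℂ F
  intro ψ
  let b := Module.finBasis ℂ F
  let ℓ : Fin (Module.finrank ℂ F) → F →L[ℂ] ℂ := fun i => (b.coord i).toContinuousLinearMap
  let χ : Fin (Module.finrank ℂ F) → 𝓢(R3, ℂ) := fun i =>
    ψ.postcompCLM (ContinuousLinearMap.apply ℂ ℂ (b i))
  have hrep : ∀ w : F, w = ∑ i, ℓ i w • b i := fun w => (b.sum_repr w).symm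
  have hχ : ∀ i x, χ i x = ψ x (b i) := fun i x => rfl
  have hχ' : ∀ i x, unitaryFourier (χ i) x = unitaryFourier ψ x (b i) := by
    intro i x
    rw [unitaryFourier_apply_vector]
    rfl
  have e1 : (fun x => unitaryFourier ψ x (u x)) =
      fun x => ∑ i, ℓ i (unitaryFourier (χ i) x • u x) := by
    funext x
    conv_lhs => rw [hrep (u x), map_sum]
    simp only [hχ', map_smul, smul_eq_mul, mul_comm]
  have e2 : (fun x => ψ x (v x)) = fun x => ∑ i, ℓ i (χ i x • v x) := by
    funext x
    conv_lhs => rw [hrep (v x), map_sum]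
    simp only [hχ, map_smul, smul_eq_mul, mul_comm]
  have i1 : ∀ i ∈ Finset.univ, Integrable (fun x => ℓ i (unitaryFourier (χ i) x • u x)) :=
    fun i _ => (ℓ i).integrable_comp (h (χ i)).1
  have i2 : ∀ i ∈ Finset.univ, Integrable (fun x => ℓ i (χ i x • v x)) :=
    fun i _ => (ℓ i).integrable_comp (h (χ i)).2.1
  rw [e1, e2, integral_finsetSum _ i1, integral_finsetSum _ i2]
  refine ⟨integrable_finsetSum _ i1, integrable_finsetSum _ i2, ?_⟩
  refine Finset.sum_congr rfl fun i _ => ?_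
  rw [(ℓ i).integral_comp_comm (h (χ i)).1, (ℓ i).integral_comp_comm (h (χ i)).2.1, (h (χ i)).2.2]

end FiniteDimensional

/-! ### The Fourier transform on `L²` -/

section Plancherel

variable {F : Type*} [NormedAddCommGroup F]

lemma map_dilation_volume :
    (volume : Measure R3).map (fun x => (2 * Real.pi)⁻¹ • x) =
      ENNReal.ofReal ((2 * Real.pi) ^ 3) • volume := by
  rw [Measure.map_addHaar_smul _ (by positivity)]
  simp only [finrank_euclideanSpace, Fintype.card_fin, inv_pow, inv_inv]
  rw [abs_of_pos (by positivity)]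

lemma memLp_comp_dilation {f : R3 → F} {q : ENNReal} (hf : MemLp f q) :
    MemLp (fun x => f ((2 * Real.pi)⁻¹ • x)) q := by
  have hm : MemLp f q ((volume : Measure R3).map (fun x => (2 * Real.pi)⁻¹ • x)) := by
    rw [map_dilation_volume]
    exact hf.smul_measure ENNReal.ofReal_ne_top
  exact hm.comp_of_map (by fun_prop)

lemma eLpNorm_two_comp_dilation {f : R3 → F} (hf : AEStronglyMeasurable f) :
    eLpNorm (fun x => f ((2 * Real.pi)⁻¹ • x)) 2 volume =
      ENNReal.ofReal ((2 * Real.pi) ^ (3 / 2 : ℝ)) * eLpNorm f 2 volume := by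
  have hm : AEStronglyMeasurable f ((volume : Measure R3).map (fun x => (2 * Real.pi)⁻¹ • x)) := by
    rw [map_dilation_volume]
    exact hf.smul_measure _
  have := eLpNorm_map_measure (p := 2) hm (by fun_prop)
  rw [show (fun x => f ((2 * Real.pi)⁻¹ • x)) = f ∘ fun x => (2 * Real.pi)⁻¹ • x from rfl, ← this,
    map_dilation_volume, eLpNorm_smul_measure_of_ne_top (by norm_num), smul_eq_mul,
    ENNReal.ofReal_rpow_of_pos (by positivity), ← Real.rpow_natCast,
    ← Real.rpow_mul (by positivity)]
  congr 3
  norm_num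

variable [InnerProductSpace ℂ F]

lemma normalization_mul_rpow :
    ENNReal.ofReal ((2 * Real.pi) ^ (-(3 / 2) : ℝ)) * ENNReal.ofReal ((2 * Real.pi) ^ (3 / 2 : ℝ))
      = 1 := by
  rw [← ENNReal.ofReal_mul (by positivity), ← Real.rpow_add (by positivity)]
  norm_num

lemma eLpNorm_dilation_smul {g : R3 → F} (hg : AEStronglyMeasurable g) :
    eLpNorm (fun x => (((2 * Real.pi) ^ (-(3 / 2) : ℝ) : ℝ) : ℂ) • g ((2 * Real.pi)⁻¹ • x)) 2 volume
      = eLpNorm g 2 volume := by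
  have := eLpNorm_const_smul ((((2 * Real.pi) ^ (-(3 / 2) : ℝ) : ℝ) : ℂ))
    (fun x => g ((2 * Real.pi)⁻¹ • x)) 2 volume
  simp only [Pi.smul_def] at this
  rw [this, eLpNorm_two_comp_dilation hg, ← mul_assoc, ← ofReal_norm, Complex.norm_real,
    Real.norm_of_nonneg normalization_pos.le, normalization_mul_rpow, one_mul]

variable [CompleteSpace F]

open FourierTransform in
/-- The Fourier transform on `L²`, transported to the unitary normalization by dilation. -/
lemma isFourierPair_Lp (g : Lp (α := R3) F 2) :
    IsFourierPair (fun x => (((2 * Real.pi) ^ (-(3 / 2) : ℝ) : ℝ) : ℂ) • g ((2 * Real.pi)⁻¹ • x))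
      (𝓕 g : Lp (α := R3) F 2) := by
  intro χ
  have hint : ∀ (χ : 𝓢(R3, ℂ)) (f : R3 → F), MemLp f 2 → Integrable (fun p => χ p • f p) :=
    fun χ f hf => memLp_one_iff_integrable.mp (hf.smul (χ.memLp 2 volume))
  have hu : ∀ x, unitaryFourier χ x = schwartzFourier χ x := fun x =>
    (schwartzFourier_apply χ x).symm
  refine ⟨?_, hint χ _ (Lp.memLp _), ?_⟩
  · simp only [hu]
    exact hint _ _ ((memLp_comp_dilation (Lp.memLp g)).const_smul _)
  · have h := DFunLike.congr_fun (Lp.fourier_toTemperedDistribution_eq g) χ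
    rw [TemperedDistribution.fourier_apply, Lp.toTemperedDistribution_apply,
      Lp.toTemperedDistribution_apply] at h
    rw [← h]
    have h2 := integral_comp_dilation (fun x => (𝓕 χ) x • g x)
    simp only [unitaryFourier_eq_fourier, ← SchwartzMap.fourier_coe, smul_eq_mul, smul_smul,
      mul_right_comm _ _ (((2 * Real.pi) ^ (-(3 / 2) : ℝ) : ℝ) : ℂ)]
    simp only [mul_smul]
    rw [integral_smul, integral_smul, h2, smul_smul, smul_smul, ← Complex.ofReal_mul,
      ← Complex.ofReal_mul, normalization_sq_mul, Complex.ofReal_one, one_smul]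

open FourierTransform in
/-- Every `L²` function is the Fourier transform of an `L²` function of the same norm. -/
lemma exists_isFourierPair_left {b : R3 → F} (hb : MemLp b 2) :
    ∃ u : R3 → F, IsFourierPair u b ∧ MemLp u 2 ∧ eLpNorm u 2 volume = eLpNorm b 2 volume := by
  let g : Lp (α := R3) F 2 := 𝓕⁻ (hb.toLp b)
  have hg : 𝓕 g = hb.toLp b := fourier_fourierInv_eq _
  refine ⟨_, (isFourierPair_Lp g).congr .rfl (by rw [hg]; exact hb.coeFn_toLp),
    (memLp_comp_dilation (Lp.memLp g)).const_smul _, ?_⟩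
  rw [eLpNorm_dilation_smul (Lp.aestronglyMeasurable g)]
  have h1 : ‖g‖ = ‖hb.toLp b‖ := by rw [← hg, Lp.norm_fourier_eq]
  rw [Lp.norm_def, Lp.norm_toLp, ENNReal.toReal_eq_toReal_iff' (Lp.eLpNorm_ne_top g)
    hb.eLpNorm_ne_top] at h1
  exact h1

open FourierTransform in
/-- Plancherel's theorem for integrable and square integrable functions. -/
lemma eLpNorm_unitaryFourier {f : R3 → F} (hf : Integrable f) (hf2 : MemLp f 2) :
    MemLp (unitaryFourier f) 2 ∧ eLpNorm (unitaryFourier f) 2 volume = eLpNorm f 2 volume := by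
  have hc : (2 * Real.pi)⁻¹ ≠ 0 := by positivity
  let u0 : R3 → F := fun x => (((2 * Real.pi) ^ (3 / 2 : ℝ) : ℝ) : ℂ) • f ((2 * Real.pi) • x)
  have hu0 : ∀ x, (((2 * Real.pi) ^ (-(3 / 2) : ℝ) : ℝ) : ℂ) • u0 ((2 * Real.pi)⁻¹ • x) = f x := by
    intro x
    simp only [u0]
    rw [smul_smul, smul_smul, ← Complex.ofReal_mul, ← Real.rpow_add (by positivity),
      mul_inv_cancel₀ (by positivity)]
    norm_num
  have hm : MemLp u0 2 := by
    refine MemLp.const_smul ?_ _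
    have hm : MemLp f 2 ((volume : Measure R3).map (fun x => (2 * Real.pi) • x)) := by
      rw [Measure.map_addHaar_smul _ (by positivity)]
      exact hf2.smul_measure ENNReal.ofReal_ne_top
    exact hm.comp_of_map (by fun_prop)
  let g : Lp (α := R3) F 2 := hm.toLp u0
  have hg : (g : R3 → F) =ᵐ[volume] u0 := hm.coeFn_toLp
  have hqmp : Measure.QuasiMeasurePreserving (fun x : R3 => (2 * Real.pi)⁻¹ • x) :=
    ⟨by fun_prop, by rw [map_dilation_volume]; exact Measure.smul_absolutelyContinuous⟩
  have hgf : (fun x => (((2 * Real.pi) ^ (-(3 / 2) : ℝ) : ℝ) : ℂ) • g ((2 * Real.pi)⁻¹ • x))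
      =ᵐ[volume] f := by
    filter_upwards [hqmp.ae_eq_comp hg] with x hx
    rw [← hu0 x]
    exact congrArg _ hx
  -- The `L²` transform and the integral define the same distribution, hence agree.
  have hb := ((isFourierPair_Lp g).congr hgf .rfl).ae_eq_right (isFourierPair_unitaryFourier hf)
  refine ⟨(Lp.memLp _).ae_eq hb, ?_⟩
  rw [← eLpNorm_congr_ae hb, ← eLpNorm_congr_ae hgf,
    eLpNorm_dilation_smul (Lp.aestronglyMeasurable g)]
  have h1 : ‖𝓕 g‖ = ‖g‖ := Lp.norm_fourier_eq g
  rwa [Lp.norm_def, Lp.norm_def, ENNReal.toReal_eq_toReal_iff' (Lp.eLpNorm_ne_top _)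
    (Lp.eLpNorm_ne_top g)] at h1

end Plancherel

/-! ### Sums of an integrable and a bounded function -/

section Kernels

variable {A : Type*} [NormedAddCommGroup A]

/-- `k` is almost everywhere the sum of an integrable function and of a bounded one. Kernels and
symbols with a singularity `‖x‖⁻²` at the origin that are bounded at infinity are of this kind. -/
def IsL1AddLinf (k : R3 → A) : Prop :=
  ∃ k₁ k₂ : R3 → A, Integrable k₁ ∧ AEStronglyMeasurable k₂ ∧ (∃ C, ∀ x, ‖k₂ x‖ ≤ C) ∧
    k =ᵐ[volume] fun x => k₁ x + k₂ x

lemma integrableOn_ball_inv_norm_sq (r : ℝ) :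
    IntegrableOn (fun x : R3 => (‖x‖ ^ 2)⁻¹) (Metric.ball 0 r) := by
  rw [integrableOn_fun_norm_addHaar volume (f := fun y : ℝ => (y ^ 2)⁻¹)]
  have h1 : IntegrableOn (fun _ : ℝ => (1 : ℝ)) (Set.Ioo 0 r) := by simp
  refine h1.congr_fun (fun y hy => ?_) measurableSet_Ioo
  have : y ≠ 0 := hy.1.ne'
  simp [this]

lemma ae_ne_zero : ∀ᵐ x : R3, x ≠ 0 := by
  simp [ae_iff]

/-- Split at the unit sphere; `‖x‖⁻²` is integrable near the origin of `R³`. -/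
lemma isL1AddLinf_of_bound {k : R3 → A} (hk : AEStronglyMeasurable k) {C : ℝ}
    (hC : ∀ x, x ≠ 0 → ‖k x‖ ≤ C * (1 + (‖x‖ ^ 2)⁻¹)) : IsL1AddLinf k := by
  have hC0 : 0 ≤ C := by
    obtain ⟨x, hx⟩ := exists_ne (0 : R3)
    have h := (norm_nonneg _).trans (hC x hx)
    exact nonneg_of_mul_nonneg_left h (by positivity)
  refine ⟨(Metric.ball 0 1).indicator k, (Metric.ball 0 1)ᶜ.indicator k, ?_,
    hk.indicator Metric.isOpen_ball.measurableSet.compl, ⟨C * 2, fun x => ?_⟩, ?_⟩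
  · rw [integrable_indicator_iff Metric.isOpen_ball.measurableSet]
    have hb : IntegrableOn (fun x : R3 => C * (1 + (‖x‖ ^ 2)⁻¹)) (Metric.ball 0 1) :=
      (Integrable.add (integrable_const_iff.2 (Or.inr (by
        simp [isFiniteMeasure_restrict])))
        (integrableOn_ball_inv_norm_sq 1)).const_mul C
    refine hb.mono' hk.restrict ?_
    filter_upwards [ae_restrict_of_ae ae_ne_zero] with x hx using hC x hx
  · by_cases hx : x ∈ (Metric.ball (0 : R3) 1)ᶜ
    · rw [Set.indicator_of_mem hx]
      have h1 : 1 ≤ ‖x‖ := by simpa using hx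
      have hx0 : x ≠ 0 := by
        rintro rfl
        norm_num at h1
      refine (hC x hx0).trans ?_
      have : (‖x‖ ^ 2)⁻¹ ≤ 1 := inv_le_one_of_one_le₀ (one_le_pow₀ h1)
      gcongr
      linarith
    · rw [Set.indicator_of_notMem hx, norm_zero]
      positivity
  · refine .of_forall fun x => ?_
    exact (congrFun (Set.indicator_self_add_compl (Metric.ball 0 1) k) x).symm

namespace IsL1AddLinf

variable {k k' : R3 → A}

lemma aestronglyMeasurable (hk : IsL1AddLinf k) : AEStronglyMeasurable k := by
  obtain ⟨k₁, k₂, h1, h2, -, h⟩ := hk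
  exact (h1.1.add h2).congr h.symm

lemma of_integrable (hk : Integrable k) : IsL1AddLinf k :=
  ⟨k, 0, hk, aestronglyMeasurable_zero, ⟨0, fun x => by simp⟩, by simp⟩

lemma add (hk : IsL1AddLinf k) (hk' : IsL1AddLinf k') : IsL1AddLinf fun x => k x + k' x := by
  obtain ⟨k₁, k₂, h1, h2, ⟨C, hC⟩, h⟩ := hk
  obtain ⟨k₁', k₂', h1', h2', ⟨C', hC'⟩, h'⟩ := hk'
  refine ⟨fun x => k₁ x + k₁' x, fun x => k₂ x + k₂' x, h1.add h1', h2.add h2',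
    ⟨C + C', fun x => (norm_add_le _ _).trans (add_le_add (hC x) (hC' x))⟩, ?_⟩
  filter_upwards [h, h'] with x hx hx'
  rw [hx, hx']
  abel

lemma norm (hk : IsL1AddLinf k) : IsL1AddLinf fun x => ‖k x‖ := by
  obtain ⟨k₁, k₂, h1, h2, ⟨C, hC⟩, h⟩ := hk
  refine ⟨fun x => ‖k₁ x + k₂ x‖ - ‖k₂ x‖, fun x => ‖k₂ x‖, ?_, h2.norm,
    ⟨C, fun x => by simpa using hC x⟩, ?_⟩
  · refine h1.mono ((h1.1.add h2).norm.sub h2.norm) (.of_forall fun x => ?_)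
    refine (abs_norm_sub_norm_le _ _).trans_eq ?_
    simp
  · filter_upwards [h] with x hx
    rw [hx]
    ring

lemma clm_comp {B : Type*} [NormedAddCommGroup B] [NormedSpace ℂ A] [NormedSpace ℂ B]
    (L : A →L[ℂ] B) (hk : IsL1AddLinf k) : IsL1AddLinf fun x => L (k x) := by
  obtain ⟨k₁, k₂, h1, h2, ⟨C, hC⟩, h⟩ := hk
  refine ⟨fun x => L (k₁ x), fun x => L (k₂ x), L.integrable_comp h1,
    L.continuous.comp_aestronglyMeasurable h2, ⟨‖L‖ * C, fun x => ?_⟩, ?_⟩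
  · exact (L.le_opNorm _).trans (by gcongr; exact hC x)
  · filter_upwards [h] with x hx
    rw [hx, map_add]

lemma comp_sub_right (hk : IsL1AddLinf k) (y : R3) : IsL1AddLinf fun x => k (x - y) := by
  obtain ⟨k₁, k₂, h1, h2, ⟨C, hC⟩, h⟩ := hk
  have hq := (measurePreserving_sub_right (volume : Measure R3) y).quasiMeasurePreserving
  exact ⟨fun x => k₁ (x - y), fun x => k₂ (x - y), h1.comp_sub_right y,
    h2.comp_quasiMeasurePreserving hq, ⟨C, fun x => hC _⟩, hq.ae_eq_comp h⟩

/-- The product with an integrable and bounded function is integrable. -/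
lemma integrable_norm_mul {G : Type*} [NormedAddCommGroup G] {g : R3 → G} (hk : IsL1AddLinf k)
    (hg : Integrable g) {C : ℝ} (hgC : ∀ x, ‖g x‖ ≤ C) :
    Integrable fun x => ‖g x‖ * ‖k x‖ := by
  obtain ⟨k₁, k₂, h1, h2, ⟨C', hC'⟩, h⟩ := hk.norm
  have : (fun x => ‖g x‖ * ‖k x‖) =ᵐ[volume] fun x => ‖g x‖ * k₁ x + ‖g x‖ * k₂ x := by
    filter_upwards [h] with x hx
    rw [hx, mul_add]
  refine Integrable.congr ?_ this.symm
  refine (h1.bdd_mul hg.norm.1 (.of_forall fun x => by simpa using hgC x)).add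
    (hg.norm.mul_bdd h2 (.of_forall hC'))

/-- Absolute convergence of the double integrals behind Fubini's theorem for the convolution with
the kernel `k`. -/
lemma integrable_prod {G H : Type*} [NormedAddCommGroup G] [NormedAddCommGroup H] {g : R3 → G}
    {f : R3 → H} (hk : IsL1AddLinf k) (hg : Integrable g) {C : ℝ} (hgC : ∀ x, ‖g x‖ ≤ C)
    (hf : Integrable f) :
    Integrable (fun z : R3 × R3 => ‖g z.1‖ * ‖k (z.1 - z.2)‖ * ‖f z.2‖)
      ((volume : Measure R3).prod volume) := by
  obtain ⟨k₁, k₂, h1, h2, ⟨C', hC'⟩, h⟩ := hk.norm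
  have hq : Measure.QuasiMeasurePreserving (fun z : R3 × R3 => z.1 - z.2)
      ((volume : Measure R3).prod volume) volume :=
    quasiMeasurePreserving_sub_of_right_invariant _ _
  have : (fun z : R3 × R3 => ‖g z.1‖ * ‖k (z.1 - z.2)‖ * ‖f z.2‖)
      =ᵐ[(volume : Measure R3).prod volume] fun z =>
      ‖g z.1‖ * (‖f z.2‖ * k₁ (z.1 - z.2)) + (‖g z.1‖ * ‖f z.2‖) * k₂ (z.1 - z.2) := by
    filter_upwards [hq.ae_eq_comp h] with z hz
    simp only [Function.comp_apply] at hz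
    rw [hz]
    ring
  refine Integrable.congr ?_ this.symm
  refine Integrable.add ?_ ?_
  · exact (hf.norm.convolution_integrand (ContinuousLinearMap.mul ℝ ℝ) h1).bdd_mul
      hg.norm.1.comp_fst (.of_forall fun z => by simpa using hgC z.1)
  · exact (hg.norm.mul_prod hf.norm).mul_bdd (h2.comp_quasiMeasurePreserving hq)
      (.of_forall fun z => hC' _)

lemma convolution [NormedSpace ℂ A] {B : R3 → ℂ} (hB : Integrable B)
    (hk : IsL1AddLinf k) : IsL1AddLinf fun x => ∫ z, B z • k (x - z) := by
  obtain ⟨k₁, k₂, h1, h2, ⟨C, hC⟩, h⟩ := hk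
  have hint := hB.convolution_integrand (ContinuousLinearMap.lsmul ℂ ℂ) h1
  have hB2 : ∀ x, Integrable fun z => B z • k₂ (x - z) := fun x =>
    hB.smul_bdd C (h2.comp_quasiMeasurePreserving
      (quasiMeasurePreserving_sub_left_of_right_invariant volume x)) (.of_forall fun z => hC _)
  refine ⟨fun x => ∫ z, B z • k₁ (x - z), fun x => ∫ z, B z • k₂ (x - z), hint.integral_prod_left,
    ?_, ⟨(∫ z, ‖B z‖) * C, fun x => ?_⟩, ?_⟩
  · exact (hB.1.convolution_integrand (ContinuousLinearMap.lsmul ℂ ℂ) h2).integral_prod_right'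
  · refine (norm_integral_le_integral_norm _).trans ?_
    rw [← integral_mul_const]
    refine integral_mono (hB2 x).norm (hB.norm.mul_const C) fun z => ?_
    simp only [norm_smul]
    gcongr
    exact hC _
  · filter_upwards [hint.prod_right_ae] with x hx
    have hq := quasiMeasurePreserving_sub_left_of_right_invariant (volume : Measure R3) x
    simp only [ContinuousLinearMap.lsmul_apply] at hx
    rw [← integral_add hx (hB2 x)]
    refine integral_congr_ae ?_
    filter_upwards [hq.ae_eq_comp h] with z hz
    simp only [Function.comp_apply] at hz
    simp only [hz, smul_add]

end IsL1AddLinf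

end Kernels

/-! ### Kernels and their symbols -/

section Symbols

variable {A : Type*} [NormedAddCommGroup A] [NormedSpace ℂ A]

/-- The convolution operator with kernel `k` is the Fourier multiplier with symbol `s`, that is,
the Fourier transform of `k` is `(2π)^(-3/2) s`. It is tested against the translates of the
transforms of test functions, the form in which it enters in convolutions. -/
structure HasSymbol (k s : R3 → A) : Prop where
  kernel : IsL1AddLinf k
  symbol : IsL1AddLinf s
  eq : ∀ (χ : 𝓢(R3, ℂ)) (y : R3), ∫ x, unitaryFourier χ x • k (x - y) =
    (((2 * Real.pi) ^ (-(3 / 2) : ℝ) : ℝ) : ℂ) •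
      ∫ p, Complex.exp (-(Complex.I * ((inner ℝ p y : ℝ) : ℂ))) • χ p • s p

lemma IsL1AddLinf.integrable_schwartz_smul {s : R3 → A} (hs : IsL1AddLinf s) (χ : 𝓢(R3, ℂ)) :
    Integrable fun p => χ p • s p := by
  obtain ⟨C, hC⟩ := exists_bound_schwartz χ
  refine (hs.integrable_norm_mul χ.integrable hC).mono
    (χ.continuous.aestronglyMeasurable.smul hs.aestronglyMeasurable) (.of_forall fun x => ?_)
  simp [norm_smul]

lemma IsL1AddLinf.integrable_fourier_smul {k : R3 → A} (hk : IsL1AddLinf k) (χ : 𝓢(R3, ℂ))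
    (y : R3) : Integrable fun x => unitaryFourier χ x • k (x - y) := by
  simpa only [schwartzFourier_apply] using
    (hk.comp_sub_right y).integrable_schwartz_smul (schwartzFourier χ)

namespace HasSymbol

variable {k s k' s' : R3 → A}

lemma add (h : HasSymbol k s) (h' : HasSymbol k' s') :
    HasSymbol (fun x => k x + k' x) (fun p => s p + s' p) := by
  refine ⟨h.kernel.add h'.kernel, h.symbol.add h'.symbol, fun χ y => ?_⟩
  simp only [smul_add]
  rw [integral_add (h.kernel.integrable_fourier_smul χ y) (h'.kernel.integrable_fourier_smul χ y),
    integral_add (integrable_exp_smul_right (h.symbol.integrable_schwartz_smul χ) y)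
      (integrable_exp_smul_right (h'.symbol.integrable_schwartz_smul χ) y), smul_add,
    h.eq, h'.eq]

lemma clm_comp {B : Type*} [NormedAddCommGroup B] [NormedSpace ℂ B] [CompleteSpace A]
    [CompleteSpace B] (L : A →L[ℂ] B) (h : HasSymbol k s) :
    HasSymbol (fun x => L (k x)) (fun p => L (s p)) := by
  refine ⟨h.kernel.clm_comp L, h.symbol.clm_comp L, fun χ y => ?_⟩
  simp only [← map_smul]
  rw [L.integral_comp_comm (h.kernel.integrable_fourier_smul χ y), h.eq,
    L.integral_comp_comm (integrable_exp_smul_right (h.symbol.integrable_schwartz_smul χ) y),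
    map_smul]

lemma congr_symbol (h : HasSymbol k s) (hs : s =ᵐ[volume] s') : HasSymbol k s' := by
  obtain ⟨s₁, s₂, h1, h2, h3, h4⟩ := h.symbol
  refine ⟨h.kernel, ⟨s₁, s₂, h1, h2, h3, hs.symm.trans h4⟩, fun χ y => ?_⟩
  rw [h.eq]
  congr 1
  refine integral_congr_ae ?_
  filter_upwards [hs] with p hp
  rw [hp]

lemma congr_kernel (h : HasSymbol k s) (hk : k =ᵐ[volume] k') : HasSymbol k' s := by
  obtain ⟨s₁, s₂, h1, h2, h3, h4⟩ := h.kernel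
  refine ⟨⟨s₁, s₂, h1, h2, h3, hk.symm.trans h4⟩, h.symbol, fun χ y => ?_⟩
  rw [← h.eq]
  refine integral_congr_ae ?_
  have hq := (measurePreserving_sub_right (volume : Measure R3) y).quasiMeasurePreserving
  filter_upwards [hq.ae_eq_comp hk] with x hx
  simp only [Function.comp_apply] at hx
  simp only [hx]

/-- The symbol of an integrable kernel is its Fourier integral. -/
lemma of_integrable [CompleteSpace A] (hk : Integrable k) (hsm : IsL1AddLinf s)
    (hs : ∀ p, unitaryFourier k p = (((2 * Real.pi) ^ (-(3 / 2) : ℝ) : ℝ) : ℂ) • s p) :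
    HasSymbol k s := by
  refine ⟨.of_integrable hk, hsm, fun χ y => ?_⟩
  rw [← integral_unitaryFourier_smul χ.integrable (hk.comp_sub_right y), ← integral_smul]
  congr 1
  funext p
  have h1 : unitaryFourier (fun x => k (x - y)) p =
      Complex.exp (-(Complex.I * ((inner ℝ p y : ℝ) : ℂ))) • unitaryFourier k p := by
    simp only [unitaryFourier]
    rw [← integral_add_right_eq_self _ y, smul_comm (Complex.exp _),
      ← integral_smul (Complex.exp _)]
    congr 2
    funext x
    simp only [add_sub_cancel_right, smul_smul, ← Complex.exp_add, inner_add_right]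
    congr 2
    push_cast
    ring
  rw [h1, hs, smul_comm (χ p), smul_comm (χ p), smul_comm (Complex.exp _)]

/-- The symbol of a convolution of kernels is the product of the symbols. -/
lemma convolution [CompleteSpace A] {B b : R3 → ℂ} (hB : Integrable B)
    (hb : ∀ p, unitaryFourier B p = (((2 * Real.pi) ^ (-(3 / 2) : ℝ) : ℝ) : ℂ) * b p)
    (hbs : IsL1AddLinf fun p => b p • s p) (h : HasSymbol k s) :
    HasSymbol (fun x => ∫ z, B z • k (x - z)) (fun p => b p • s p) := by
  refine ⟨h.kernel.convolution hB, hbs, fun χ y => ?_⟩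
  obtain ⟨C, hC⟩ := exists_bound_unitaryFourier χ
  have hχ := integrable_schwartz_unitaryFourier χ
  have hq : Measure.QuasiMeasurePreserving (fun z : R3 × R3 => z.1 - z.2)
      ((volume : Measure R3).prod volume) volume :=
    quasiMeasurePreserving_sub_of_right_invariant _ _
  have hky := h.kernel.comp_sub_right y
  have hswap : Integrable (Function.uncurry fun x z : R3 =>
      unitaryFourier χ x • B z • k (x - z - y)) ((volume : Measure R3).prod volume) := by
    refine (hky.integrable_prod hχ hC hB).mono ?_ (.of_forall fun z => ?_)
    · exact hχ.1.comp_fst.smul (hB.1.comp_snd.smul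
        (hky.aestronglyMeasurable.comp_quasiMeasurePreserving hq))
    · simp only [Function.uncurry, norm_smul, norm_mul, norm_norm]
      exact le_of_eq (by ring)
  have hbint : Integrable (Function.uncurry fun z p : R3 =>
      Complex.exp (-(Complex.I * ((inner ℝ p (y + z) : ℝ) : ℂ))) • B z • χ p • s p)
      ((volume : Measure R3).prod volume) := by
    have h0 : Integrable (fun q : R3 × R3 => B q.1 • χ q.2 • s q.2)
        ((volume : Measure R3).prod volume) :=
      hB.smul_prod (h.symbol.integrable_schwartz_smul χ)
    refine h0.bdd_smul 1 (Continuous.aestronglyMeasurable (by fun_prop)) (.of_forall fun q => ?_)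
    rw [norm_exp_I_inner]
  calc ∫ x, unitaryFourier χ x • ∫ z, B z • k (x - y - z)
      = ∫ x, ∫ z, unitaryFourier χ x • B z • k (x - z - y) := by
        congr 1
        funext x
        rw [← integral_smul]
        simp only [sub_right_comm x y]
    _ = ∫ z, ∫ x, unitaryFourier χ x • B z • k (x - z - y) := integral_integral_swap hswap
    _ = ∫ z, (((2 * Real.pi) ^ (-(3 / 2) : ℝ) : ℝ) : ℂ) • ∫ p,
          Complex.exp (-(Complex.I * ((inner ℝ p (y + z) : ℝ) : ℂ))) • B z • χ p • s p := by
        congr 1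
        funext z
        simp only [smul_comm _ (B z), sub_sub]
        rw [integral_smul, integral_smul, smul_comm, ← h.eq]
        simp only [add_comm]
    _ = (((2 * Real.pi) ^ (-(3 / 2) : ℝ) : ℝ) : ℂ) • ∫ p, ∫ z,
          Complex.exp (-(Complex.I * ((inner ℝ p (y + z) : ℝ) : ℂ))) • B z • χ p • s p := by
        rw [integral_smul, integral_integral_swap hbint]
    _ = _ := by
        congr 2
        funext p
        have hc : (((2 * Real.pi) ^ (-(3 / 2) : ℝ) : ℝ) : ℂ) ≠ 0 :=
          Complex.ofReal_ne_zero.2 normalization_pos.ne'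
        have hbp : ∫ z, Complex.exp (-(Complex.I * ((inner ℝ p z : ℝ) : ℂ))) * B z = b p :=
          mul_left_cancel₀ hc (hb p)
        rw [← hbp]
        simp only [smul_comm (χ p), ← integral_smul_const, ← integral_smul]
        congr 1
        funext z
        simp only [smul_smul, ← mul_assoc, ← Complex.exp_add, inner_add_right]
        congr 4
        push_cast
        ring

/-- Superposition: if the kernel `h t` has the symbol `σ t` for all `t > 0`, then `∫ h t dt` has
the symbol `∫ σ t dt`, provided that both integrals converge absolutely with a bound
`‖x‖⁻²` near the origin and a uniform bound at infinity. -/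
lemma superposition [CompleteSpace A] {h σ : ℝ → R3 → A}
    (hm : AEStronglyMeasurable (fun z : R3 × ℝ => h z.2 z.1)
      ((volume : Measure R3).prod (volume.restrict (Set.Ioi 0))))
    (hσm : AEStronglyMeasurable (fun z : R3 × ℝ => σ z.2 z.1)
      ((volume : Measure R3).prod (volume.restrict (Set.Ioi 0))))
    (hint : ∀ x, x ≠ 0 → IntegrableOn (fun t => h t x) (Set.Ioi 0))
    (hσint : ∀ p, p ≠ 0 → IntegrableOn (fun t => σ t p) (Set.Ioi 0))
    {C : ℝ} (hC : ∀ x, x ≠ 0 → ∫ t in Set.Ioi 0, ‖h t x‖ ≤ C * (1 + (‖x‖ ^ 2)⁻¹))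
    (hσC : ∀ p, p ≠ 0 → ∫ t in Set.Ioi 0, ‖σ t p‖ ≤ C * (1 + (‖p‖ ^ 2)⁻¹))
    (hs : ∀ t, 0 < t → HasSymbol (h t) (σ t)) :
    HasSymbol (fun x => ∫ t in Set.Ioi 0, h t x) (fun p => ∫ t in Set.Ioi 0, σ t p) := by
  have hK : IsL1AddLinf fun x => ∫ t in Set.Ioi 0, h t x :=
    isL1AddLinf_of_bound hm.integral_prod_right' (C := C)
      fun x hx => (norm_integral_le_integral_norm _).trans (hC x hx)
  have hS : IsL1AddLinf fun p => ∫ t in Set.Ioi 0, σ t p :=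
    isL1AddLinf_of_bound hσm.integral_prod_right' (C := C)
      fun x hx => (norm_integral_le_integral_norm _).trans (hσC x hx)
  have hN : IsL1AddLinf fun x => ∫ t in Set.Ioi 0, ‖h t x‖ :=
    isL1AddLinf_of_bound hm.norm.integral_prod_right' (C := C) fun x hx => by
      rw [Real.norm_of_nonneg (integral_nonneg fun t => norm_nonneg _)]
      exact hC x hx
  have hSN : IsL1AddLinf fun p => ∫ t in Set.Ioi 0, ‖σ t p‖ :=
    isL1AddLinf_of_bound hσm.norm.integral_prod_right' (C := C) fun x hx => by
      rw [Real.norm_of_nonneg (integral_nonneg fun t => norm_nonneg _)]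
      exact hσC x hx
  refine ⟨hK, hS, fun χ y => ?_⟩
  obtain ⟨C₁, hC₁⟩ := exists_bound_unitaryFourier χ
  obtain ⟨C₂, hC₂⟩ := exists_bound_schwartz χ
  have hχ := integrable_schwartz_unitaryFourier χ
  have hq : Measure.QuasiMeasurePreserving (fun z : R3 × ℝ => (z.1 - y, z.2))
      ((volume : Measure R3).prod (volume.restrict (Set.Ioi 0)))
      ((volume : Measure R3).prod (volume.restrict (Set.Ioi 0))) :=
    ((measurePreserving_sub_right (volume : Measure R3) y).prod
      (MeasurePreserving.id _)).quasiMeasurePreserving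
  have hm' : AEStronglyMeasurable (fun z : R3 × ℝ => h z.2 (z.1 - y))
      ((volume : Measure R3).prod (volume.restrict (Set.Ioi 0))) :=
    hm.comp_quasiMeasurePreserving hq
  have hprod : Integrable (Function.uncurry fun (x : R3) (t : ℝ) =>
      unitaryFourier χ x • h t (x - y))
      ((volume : Measure R3).prod (volume.restrict (Set.Ioi 0))) := by
    refine (integrable_prod_iff (hχ.1.comp_fst.smul hm')).2 ⟨?_, ?_⟩
    · filter_upwards [(measurePreserving_sub_right (volume : Measure R3)
        y).quasiMeasurePreserving.ae ae_ne_zero] with x hx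
      exact Integrable.smul (unitaryFourier χ x) (hint _ hx)
    · simp only [Pi.smul_apply', norm_smul, integral_const_mul]
      refine ((hN.comp_sub_right y).integrable_norm_mul hχ hC₁).congr (.of_forall fun x => ?_)
      simp only
      rw [Real.norm_of_nonneg (integral_nonneg fun t => norm_nonneg _)]
  have hσprod : Integrable (Function.uncurry fun (t : ℝ) (p : R3) =>
      Complex.exp (-(Complex.I * ((inner ℝ p y : ℝ) : ℂ))) • χ p • σ t p)
      ((volume.restrict (Set.Ioi 0)).prod (volume : Measure R3)) := by
    have h0 : Integrable (fun z : R3 × ℝ => χ z.1 • σ z.2 z.1)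
        ((volume : Measure R3).prod (volume.restrict (Set.Ioi 0))) := by
      refine (integrable_prod_iff
        (χ.continuous.aestronglyMeasurable.comp_fst.smul hσm)).2 ⟨?_, ?_⟩
      · filter_upwards [ae_ne_zero] with p hp using
          Integrable.smul (χ p) (hσint _ hp)
      · simp only [Pi.smul_apply', norm_smul, integral_const_mul]
        refine (hSN.integrable_norm_mul χ.integrable hC₂).congr (.of_forall fun x => ?_)
        simp only
        rw [Real.norm_of_nonneg (integral_nonneg fun t => norm_nonneg _)]
    refine h0.swap.bdd_smul 1 (Continuous.aestronglyMeasurable (by fun_prop))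
      (.of_forall fun q => ?_)
    rw [norm_exp_I_inner]
  calc ∫ x, unitaryFourier χ x • ∫ t in Set.Ioi 0, h t (x - y)
      = ∫ x, ∫ t in Set.Ioi 0, unitaryFourier χ x • h t (x - y) := by simp only [integral_smul]
    _ = ∫ t in Set.Ioi 0, ∫ x, unitaryFourier χ x • h t (x - y) := integral_integral_swap hprod
    _ = ∫ t in Set.Ioi 0, (((2 * Real.pi) ^ (-(3 / 2) : ℝ) : ℝ) : ℂ) •
          ∫ p, Complex.exp (-(Complex.I * ((inner ℝ p y : ℝ) : ℂ))) • χ p • σ t p :=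
        setIntegral_congr_fun measurableSet_Ioi fun t ht => (hs t ht).eq χ y
    _ = _ := by
        rw [integral_smul, integral_integral_swap hσprod]
        simp only [integral_smul]

end HasSymbol

end Symbols

/-! ### Convolution with operator valued kernels -/

section VectorValued

variable {F : Type*} [NormedAddCommGroup F] [NormedSpace ℂ F]
  {K S : R3 → F →L[ℂ] F} {f : R3 → F}

lemma aestronglyMeasurable_clm_apply {X : Type*} [MeasurableSpace X] {μ : Measure X}
    {L : X → F →L[ℂ] F} {u : X → F} (hL : AEStronglyMeasurable L μ)
    (hu : AEStronglyMeasurable u μ) : AEStronglyMeasurable (fun x => L x (u x)) μ :=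
  (ContinuousLinearMap.id ℂ (F →L[ℂ] F)).aestronglyMeasurable_comp₂ hL hu

/-- Convergence of the convolution of an operator valued kernel with an integrable function. -/
lemma IsL1AddLinf.ae_integrable_convolution (hK : IsL1AddLinf K) (hf : Integrable f) :
    ∀ᵐ x, Integrable fun y => K (x - y) (f y) := by
  -- Any positive integrable and bounded weight in `x` gives a convergent double integral.
  have hg : Integrable fun x : R3 => (1 + ‖x‖) ^ (-(4 : ℝ)) := integrable_one_add_norm (by norm_num)
  have hpos : ∀ x : R3, 0 < (1 + ‖x‖) ^ (-(4 : ℝ)) := fun x => by positivity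
  have h1 : ∀ x : R3, ‖(1 + ‖x‖) ^ (-(4 : ℝ))‖ ≤ 1 := fun x => by
    rw [Real.norm_of_nonneg (hpos x).le]
    exact Real.rpow_le_one_of_one_le_of_nonpos (by simp) (by norm_num)
  filter_upwards [(hK.integrable_prod hg h1 hf).prod_right_ae] with x hx
  have hx' : Integrable fun y => ‖K (x - y)‖ * ‖f y‖ := by
    refine (hx.const_mul ((1 + ‖x‖) ^ (-(4 : ℝ)))⁻¹).congr (.of_forall fun y => ?_)
    have := (hpos x).ne'
    simp only [Real.norm_of_nonneg (hpos x).le]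
    field_simp
  refine hx'.mono (aestronglyMeasurable_clm_apply
    (hK.aestronglyMeasurable.comp_quasiMeasurePreserving
      (quasiMeasurePreserving_sub_left_of_right_invariant volume x)) hf.1) (.of_forall fun y => ?_)
  rw [norm_mul, norm_norm, norm_norm]
  exact ContinuousLinearMap.le_opNorm _ _

/-- Convolution with `K` acts on integrable functions as multiplication by the symbol. -/
lemma HasSymbol.isFourierPair_convolution [CompleteSpace F] (h : HasSymbol K S)
    (hf : Integrable f) :
    IsFourierPair (fun x => ∫ y, K (x - y) (f y)) (fun p => S p (unitaryFourier f p)) := by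
  intro χ
  obtain ⟨C, hC⟩ := exists_bound_unitaryFourier χ
  obtain ⟨C₂, hC₂⟩ := exists_bound_schwartz χ
  have hχ := integrable_schwartz_unitaryFourier χ
  have hq : Measure.QuasiMeasurePreserving (fun z : R3 × R3 => z.1 - z.2)
      ((volume : Measure R3).prod volume) volume :=
    quasiMeasurePreserving_sub_of_right_invariant _ _
  have hprod : Integrable (Function.uncurry fun x y : R3 =>
      unitaryFourier χ x • K (x - y) (f y)) ((volume : Measure R3).prod volume) := by
    refine (h.kernel.integrable_prod hχ hC hf).mono ?_ (.of_forall fun z => ?_)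
    · exact hχ.1.comp_fst.smul (aestronglyMeasurable_clm_apply
        (h.kernel.aestronglyMeasurable.comp_quasiMeasurePreserving hq) hf.1.comp_snd)
    · simp only [Function.uncurry, norm_smul, norm_mul, norm_norm, mul_assoc]
      gcongr
      exact ContinuousLinearMap.le_opNorm _ _
  have hSχ := h.symbol.integrable_schwartz_smul χ
  have hSprod : Integrable (Function.uncurry fun y p : R3 =>
      Complex.exp (-(Complex.I * ((inner ℝ p y : ℝ) : ℂ))) • (χ p • S p) (f y))
      ((volume : Measure R3).prod volume) := by
    have h0 : Integrable (fun q : R3 × R3 => (χ q.2 • S q.2) (f q.1))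
        ((volume : Measure R3).prod volume) := by
      refine (hf.norm.mul_prod hSχ.norm).mono
        (aestronglyMeasurable_clm_apply hSχ.1.comp_snd hf.1.comp_fst) (.of_forall fun z => ?_)
      rw [norm_mul, norm_norm, norm_norm, mul_comm]
      exact ContinuousLinearMap.le_opNorm _ _
    refine h0.bdd_smul 1 (Continuous.aestronglyMeasurable (by fun_prop)) (.of_forall fun q => ?_)
    rw [norm_exp_I_inner]
  have hsplit : ∀ x, unitaryFourier χ x • ∫ y, K (x - y) (f y) =
      ∫ y, unitaryFourier χ x • K (x - y) (f y) := fun x => (integral_smul _ _).symm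
  refine ⟨?_, ?_, ?_⟩
  · simp only [hsplit]
    exact hprod.integral_prod_left
  · refine (hSχ.norm.mul_const ((2 * Real.pi) ^ (-(3 / 2) : ℝ) * ∫ x, ‖f x‖)).mono
      (χ.continuous.aestronglyMeasurable.smul (aestronglyMeasurable_clm_apply
        h.symbol.aestronglyMeasurable (continuous_unitaryFourier hf).aestronglyMeasurable))
      (.of_forall fun p => ?_)
    rw [norm_mul, norm_norm, ← smul_apply]
    refine (ContinuousLinearMap.le_opNorm _ _).trans ?_
    gcongr
    exact (norm_unitaryFourier_le f p).trans (le_abs_self _)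
  · simp only [hsplit]
    rw [integral_integral_swap hprod]
    have h1 : ∀ y, ∫ x, unitaryFourier χ x • K (x - y) (f y) =
        (((2 * Real.pi) ^ (-(3 / 2) : ℝ) : ℝ) : ℂ) •
          ∫ p, Complex.exp (-(Complex.I * ((inner ℝ p y : ℝ) : ℂ))) • (χ p • S p) (f y) := by
      intro y
      have := DFunLike.congr_fun (h.eq χ y) (f y)
      rw [ContinuousLinearMap.integral_apply (h.kernel.integrable_fourier_smul χ y),
        smul_apply,
        ContinuousLinearMap.integral_apply (integrable_exp_smul_right hSχ y)] at this
      exact this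
    simp only [h1]
    rw [integral_smul, integral_integral_swap hSprod, ← integral_smul]
    congr 1
    funext p
    simp only [← map_smul]
    rw [ContinuousLinearMap.integral_comp_comm _ (integrable_exp_smul hf p)]
    simp only [unitaryFourier, map_smul, smul_apply]
    rw [smul_comm]

end VectorValued

/-! ### Convergence in weighted spaces -/

section Weights

variable {F : Type*} [NormedAddCommGroup F]

/-- Dominated convergence in `L²`. -/
lemma tendsto_eLpNorm_two_of_dominated {f : ℕ → R3 → F} {g : R3 → ℝ}
    (hf : ∀ n, AEStronglyMeasurable (f n)) (hg : MemLp g 2)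
    (hb : ∀ n, ∀ᵐ x, ‖f n x‖ ≤ g x) (h0 : ∀ᵐ x, Tendsto (fun n => f n x) atTop (𝓝 0)) :
    Tendsto (fun n => eLpNorm (f n) 2 volume) atTop (𝓝 0) := by
  have h1 : Tendsto (fun n => ∫⁻ x, ‖f n x‖ₑ ^ (2 : ℝ)) atTop (𝓝 (∫⁻ _ : R3, 0)) := by
    refine tendsto_lintegral_of_dominated_convergence' (fun x => ‖g x‖ₑ ^ (2 : ℝ))
      (fun n => (hf n).enorm.pow_const _) (fun n => ?_) ?_ ?_
    · filter_upwards [hb n] with x hx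
      gcongr
      rw [enorm_le_iff_norm_le]
      exact hx.trans (Real.le_norm_self _)
    · have := (eLpNorm_lt_top_iff_lintegral_rpow_enorm_lt_top two_ne_zero
        ENNReal.ofNat_ne_top).1 hg.2
      simpa using this.ne
    · filter_upwards [h0] with x hx
      have h2 := ((ENNReal.continuous_rpow_const (y := 2)).comp continuous_enorm).tendsto (0 : F)
      simp only [Function.comp_apply, enorm_zero, ENNReal.zero_rpow_of_pos zero_lt_two] at h2
      exact h2.comp hx
  simp only [eLpNorm_eq_lintegral_rpow_enorm_toReal two_ne_zero ENNReal.ofNat_ne_top]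
  have h2 := (ENNReal.continuous_rpow_const (y := 1 / (2 : ENNReal).toReal)).tendsto 0
  rw [lintegral_zero] at h1
  have h3 := h2.comp h1
  simpa [Function.comp_def] using h3

variable [NormedSpace ℂ F]

lemma eLpNorm_clm_apply_le {L : R3 → F →L[ℂ] F} {u : R3 → F} {p q r : ENNReal}
    [ENNReal.HolderTriple p q r]
    (hL : AEStronglyMeasurable L) (hu : AEStronglyMeasurable u) :
    eLpNorm (fun x => L x (u x)) r volume ≤ eLpNorm L p volume * eLpNorm u q volume := by
  simpa using eLpNorm_le_eLpNorm_mul_eLpNorm'_of_norm (r := r) hL hu (fun L u => L u) 1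
    (.of_forall fun x => by simpa using (L x).le_opNorm (u x))

lemma memLp_clm_apply {L : R3 → F →L[ℂ] F} {u : R3 → F} {p q r : ENNReal}
    [ENNReal.HolderTriple p q r] (hL : MemLp L p) (hu : MemLp u q) :
    MemLp (fun x => L x (u x)) r :=
  ⟨aestronglyMeasurable_clm_apply hL.1 hu.1,
    (eLpNorm_clm_apply_le hL.1 hu.1).trans_lt (ENNReal.mul_lt_top hL.2 hu.2)⟩

/-- The family `R E` inverts `T - E` for `E` in the gap and at the threshold `E₀`, with a bound
`‖p‖⁻²` near `p = 0` and decay `‖p‖⁻ᵏ` at infinity that are uniform in `E`. Nothing is asked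
at `p = 0`, where `T - E₀` is not invertible. -/
structure IsResolventSymbol (T : R3 → F →L[ℂ] F) (R : ℝ → R3 → F →L[ℂ] F) (gap : Set ℝ) (E₀ : ℝ)
    (k : ℕ) : Prop where
  temperate : T.HasTemperateGrowth
  measurable : ∀ E, AEStronglyMeasurable (R E)
  left_inv : ∀ E ∈ insert E₀ gap, ∀ p, p ≠ 0 → ∀ v, R E p (T p v - (E : ℂ) • v) = v
  right_inv : ∀ E ∈ insert E₀ gap, ∀ p, p ≠ 0 → ∀ v, T p (R E p v) - (E : ℂ) • R E p v = v
  bound : ∃ C, ∀ E ∈ insert E₀ gap, ∀ p, p ≠ 0 →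
    (‖p‖ < 1 → ‖R E p‖ ≤ C * (‖p‖ ^ 2)⁻¹) ∧ (1 ≤ ‖p‖ → ‖R E p‖ ≤ C * (‖p‖ ^ k)⁻¹)
  continuousAt : ∀ p, p ≠ 0 → ContinuousAt (fun E => R E p) E₀

lemma IsWeight.aestronglyMeasurable {k : ℕ} {w : R3 → F →L[ℂ] F} (hw : IsWeight k w) :
    AEStronglyMeasurable w := by
  have h1 := hw.1.1
  have h2 := hw.2.1
  have hn : ∀ j : ℕ, AEStronglyMeasurable fun p : R3 => ((‖p‖ ^ j : ℝ) : ℂ) := fun j =>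
    Continuous.aestronglyMeasurable (by fun_prop)
  have h1' : AEStronglyMeasurable fun p : R3 => ((‖p‖ ^ 2 : ℝ) : ℂ) •
      ({p : R3 | ‖p‖ < 1}.indicator (fun p => (((‖p‖ ^ 2)⁻¹ : ℝ) : ℂ) • w p) p) :=
    (hn 2).smul h1
  have h2' : AEStronglyMeasurable fun p : R3 => ((‖p‖ ^ k : ℝ) : ℂ) •
      ({p : R3 | 1 ≤ ‖p‖}.indicator (fun p => (((‖p‖ ^ k)⁻¹ : ℝ) : ℂ) • w p) p) :=
    (hn k).smul h2
  refine (h1'.add h2').congr ?_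
  filter_upwards [ae_ne_zero] with p hp
  have hp' : ((‖p‖ : ℝ) : ℂ) ≠ 0 := by simpa using hp
  by_cases h : ‖p‖ < 1
  · simp [Set.indicator, h, not_le.2 h, smul_smul, hp']
  · simp [Set.indicator, h, not_lt.1 h, smul_smul, hp']

/-- The function `‖p‖⁻²` for `‖p‖ < 1` and `‖p‖⁻ᵏ` for `‖p‖ ≥ 1`, times `‖w p‖`. -/
def weightBound (k : ℕ) (w : R3 → F →L[ℂ] F) (p : R3) : ℝ :=
  ‖{p : R3 | ‖p‖ < 1}.indicator (fun p => (((‖p‖ ^ 2)⁻¹ : ℝ) : ℂ) • w p) p‖ +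
  ‖{p : R3 | 1 ≤ ‖p‖}.indicator (fun p => (((‖p‖ ^ k)⁻¹ : ℝ) : ℂ) • w p) p‖

lemma weightBound_nonneg (k : ℕ) (w : R3 → F →L[ℂ] F) (p : R3) : 0 ≤ weightBound k w p := by
  unfold weightBound
  positivity

lemma norm_mul_le_weightBound {k : ℕ} {w : R3 → F →L[ℂ] F} {L : F →L[ℂ] F} {C : ℝ} {p : R3}
    (h1 : ‖p‖ < 1 → ‖L‖ ≤ C * (‖p‖ ^ 2)⁻¹) (h2 : 1 ≤ ‖p‖ → ‖L‖ ≤ C * (‖p‖ ^ k)⁻¹) (v : F) :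
    ‖w p (L v)‖ ≤ C * (weightBound k w p * ‖v‖) := by
  have h0 : ‖w p (L v)‖ ≤ ‖w p‖ * (‖L‖ * ‖v‖) :=
    ((w p).le_opNorm _).trans (by gcongr; exact L.le_opNorm v)
  refine h0.trans ?_
  rw [← mul_assoc, ← mul_assoc]
  refine mul_le_mul_of_nonneg_right ?_ (norm_nonneg v)
  rw [weightBound, mul_comm C]
  rcases lt_or_ge ‖p‖ 1 with h | h
  · have := h1 h
    simp only [Set.indicator, Set.mem_ofPred_eq, h, if_true, not_le.2 h, if_false, norm_zero,
      add_zero, norm_smul, Complex.norm_real, norm_inv, norm_pow, norm_norm]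
    calc ‖w p‖ * ‖L‖ ≤ ‖w p‖ * (C * (‖p‖ ^ 2)⁻¹) := by gcongr
      _ = _ := by ring
  · have := h2 h
    simp only [Set.indicator, Set.mem_ofPred_eq, h, if_true, not_lt.2 h, if_false, norm_zero,
      zero_add, norm_smul, Complex.norm_real, norm_inv, norm_pow, norm_norm]
    calc ‖w p‖ * ‖L‖ ≤ ‖w p‖ * (C * (‖p‖ ^ k)⁻¹) := by gcongr
      _ = _ := by ring

lemma IsWeight.eLpNorm_weightBound_mul_le {k : ℕ} {w : R3 → F →L[ℂ] F} (hw : IsWeight k w)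
    {h : R3 → F} (hh : AEStronglyMeasurable h) :
    eLpNorm (fun p => weightBound k w p * ‖h p‖) 2 volume ≤
      eLpNorm ({p : R3 | ‖p‖ < 1}.indicator fun p => (((‖p‖ ^ 2)⁻¹ : ℝ) : ℂ) • w p) 2 volume *
        eLpNorm h ⊤ volume +
      eLpNorm ({p : R3 | 1 ≤ ‖p‖}.indicator fun p => (((‖p‖ ^ k)⁻¹ : ℝ) : ℂ) • w p) ⊤ volume *
        eLpNorm h 2 volume := by
  simp only [weightBound, add_mul]
  refine (eLpNorm_add_le (hw.1.1.norm.mul hh.norm) (hw.2.1.norm.mul hh.norm) one_le_two).trans ?_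
  gcongr
  · simpa only [ENNReal.coe_one, one_mul] using!
      eLpNorm_le_eLpNorm_mul_eLpNorm'_of_norm (p := 2) (q := ⊤) (r := 2) hw.1.1 hh
      (fun a b => ‖a‖ * ‖b‖) 1 (.of_forall fun x => by simp)
  · simpa only [ENNReal.coe_one, one_mul] using!
      eLpNorm_le_eLpNorm_mul_eLpNorm'_of_norm (p := ⊤) (q := 2) (r := 2) hw.2.1 hh
      (fun a b => ‖a‖ * ‖b‖) 1 (.of_forall fun x => by simp)

lemma IsWeight.memLp_weightBound_mul {k : ℕ} {w : R3 → F →L[ℂ] F} (hw : IsWeight k w)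
    {h : R3 → F} (h1 : MemLp h ⊤) (h2 : MemLp h 2) :
    MemLp (fun p => weightBound k w p * ‖h p‖) 2 :=
  ⟨(hw.1.1.norm.add hw.2.1.norm).mul h1.1.norm, (hw.eLpNorm_weightBound_mul_le h1.1).trans_lt
    (ENNReal.add_lt_top.2 ⟨ENNReal.mul_lt_top hw.1.2 h1.2, ENNReal.mul_lt_top hw.2.2 h2.2⟩)⟩

/-- If `h n → h₀` in `L² ∩ L^∞` and `E n → E₀` in the gap, then the functions `R (E n) h n` converge
in all the weighted spaces. -/
lemma IsResolventSymbol.weightedTendsto {T : R3 → F →L[ℂ] F} {R : ℝ → R3 → F →L[ℂ] F}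
    {gap : Set ℝ} {E₀ : ℝ} {k : ℕ} (hR : IsResolventSymbol T R gap E₀ k) {w : R3 → F →L[ℂ] F}
    (hw : IsWeight k w) {E : ℕ → ℝ} (hE : ∀ n, E n ∈ gap) (hE₀ : Tendsto E atTop (𝓝 E₀))
    {h : ℕ → R3 → F} {h₀ : R3 → F} (ht : ∀ n, MemLp (h n) ⊤) (h2 : ∀ n, MemLp (h n) 2)
    (h₀t : MemLp h₀ ⊤) (h₀2 : MemLp h₀ 2)
    (hlt : Tendsto (fun n => eLpNorm (fun p => h n p - h₀ p) ⊤ volume) atTop (𝓝 0))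
    (hl2 : Tendsto (fun n => eLpNorm (fun p => h n p - h₀ p) 2 volume) atTop (𝓝 0)) :
    WeightedTendsto w (fun n p => R (E n) p (h n p)) (fun p => R E₀ p (h₀ p)) := by
  obtain ⟨C, hC⟩ := hR.bound
  have hmeas : ∀ (E : ℝ) {g : R3 → F}, AEStronglyMeasurable g →
      AEStronglyMeasurable fun p => w p (R E p (g p)) := fun E g hg =>
    aestronglyMeasurable_clm_apply hw.aestronglyMeasurable
      (aestronglyMeasurable_clm_apply (hR.measurable E) hg)
  have hbd : ∀ E ∈ insert E₀ gap, ∀ p, p ≠ 0 → ∀ v,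
      ‖w p (R E p v)‖ ≤ C * (weightBound k w p * ‖v‖) := fun E hE p hp v =>
    norm_mul_le_weightBound (hC E hE p hp).1 (hC E hE p hp).2 v
  have hmem : ∀ E ∈ insert E₀ gap, ∀ g : R3 → F, MemLp g ⊤ → MemLp g 2 →
      MemLp (fun p => w p (R E p (g p))) 2 := fun E hE g ht h2 => by
    refine ((hw.memLp_weightBound_mul ht h2).const_mul C).mono' (hmeas E ht.1) ?_
    filter_upwards [ae_ne_zero] with p hp using hbd E hE p hp _
  have h0 : E₀ ∈ insert E₀ gap := Set.mem_insert _ _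
  have hn : ∀ n, E n ∈ insert E₀ gap := fun n => Set.mem_insert_of_mem _ (hE n)
  refine ⟨fun n => hmem _ (hn n) _ (ht n) (h2 n), hmem _ h0 _ h₀t h₀2, ?_⟩
  -- `R(E n) h n - R(E₀) h₀ = R(E n) (h n - h₀) + (R(E n) - R(E₀)) h₀`: a uniform bound for the
  -- first term, dominated convergence for the second.
  have hA : Tendsto (fun n => eLpNorm (fun p => w p (R (E n) p (h n p - h₀ p))) 2 volume) atTop
      (𝓝 0) := by
    have hlim : Tendsto (fun n => ENNReal.ofReal |C| *
        (eLpNorm ({p : R3 | ‖p‖ < 1}.indicator fun p => (((‖p‖ ^ 2)⁻¹ : ℝ) : ℂ) • w p) 2 volume *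
          eLpNorm (fun p => h n p - h₀ p) ⊤ volume +
        eLpNorm ({p : R3 | 1 ≤ ‖p‖}.indicator fun p => (((‖p‖ ^ k)⁻¹ : ℝ) : ℂ) • w p) ⊤ volume *
          eLpNorm (fun p => h n p - h₀ p) 2 volume)) atTop (𝓝 0) := by
      have := ENNReal.Tendsto.const_mul (a := ENNReal.ofReal |C|)
        ((ENNReal.Tendsto.const_mul hlt (Or.inr hw.1.2.ne)).add
        (ENNReal.Tendsto.const_mul hl2 (Or.inr hw.2.2.ne))) (Or.inr ENNReal.ofReal_ne_top)
      simpa using this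
    refine tendsto_of_tendsto_of_tendsto_of_le_of_le tendsto_const_nhds hlim
      (fun _ => zero_le) fun n => ?_
    have hm : AEStronglyMeasurable fun p => h n p - h₀ p := (ht n).1.sub h₀t.1
    refine le_trans ?_ (mul_le_mul_right (hw.eLpNorm_weightBound_mul_le hm) _)
    refine eLpNorm_le_mul_eLpNorm_of_ae_le_mul ?_ 2
    filter_upwards [ae_ne_zero] with p hp
    refine (hbd _ (hn n) p hp _).trans ?_
    rw [norm_mul, norm_norm, Real.norm_of_nonneg (weightBound_nonneg _ _ _)]
    have := weightBound_nonneg k w p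
    gcongr
    exact le_abs_self C
  have hB : Tendsto (fun n => eLpNorm (fun p => w p (R (E n) p (h₀ p)) - w p (R E₀ p (h₀ p))) 2
      volume) atTop (𝓝 0) := by
    refine tendsto_eLpNorm_two_of_dominated
      (fun n => (hmeas _ h₀t.1).sub (hmeas _ h₀t.1))
      (((hw.memLp_weightBound_mul h₀t h₀2).const_mul C).const_mul 2) (fun n => ?_) ?_
    · filter_upwards [ae_ne_zero] with p hp
      refine (norm_sub_le _ _).trans ?_
      rw [two_mul]
      exact add_le_add (hbd _ (hn n) p hp _) (hbd _ h0 p hp _)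
    · filter_upwards [ae_ne_zero] with p hp
      have h1 : Tendsto (fun n => R (E n) p) atTop (𝓝 (R E₀ p)) :=
        (hR.continuousAt p hp).tendsto.comp hE₀
      have h2 : Tendsto (fun n => w p (R (E n) p (h₀ p))) atTop (𝓝 (w p (R E₀ p (h₀ p)))) :=
        ((w p).continuous.tendsto _).comp
          (((ContinuousLinearMap.apply ℂ F (h₀ p)).continuous.tendsto _).comp h1)
      simpa using h2.sub_const (w p (R E₀ p (h₀ p)))
  have hsum := hA.add hB
  rw [add_zero] at hsum
  refine tendsto_of_tendsto_of_tendsto_of_le_of_le tendsto_const_nhds hsum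
    (fun _ => zero_le) fun n => ?_
  refine le_trans (le_of_eq ?_) (eLpNorm_add_le (hmeas _ ((ht n).1.sub h₀t.1))
    ((hmeas _ h₀t.1).sub (hmeas _ h₀t.1)) one_le_two)
  congr 1
  funext p
  simp

end Weights

/-! ### Local convergence of the states -/

section Inverse

variable {A : Type*} [NormedAddCommGroup A] [NormedSpace ℂ A]

lemma unitaryFourierInv_eq_neg (g : R3 → A) (x : R3) :
    unitaryFourierInv g x = unitaryFourier g (-x) := by
  simp only [unitaryFourierInv, unitaryFourier, inner_neg_left, real_inner_comm x]
  simp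

lemma norm_unitaryFourierInv_le (g : R3 → A) (x : R3) :
    ‖unitaryFourierInv g x‖ ≤ (2 * Real.pi) ^ (-(3 / 2) : ℝ) * ∫ p, ‖g p‖ := by
  rw [unitaryFourierInv_eq_neg]
  exact norm_unitaryFourier_le g _

/-- The inversion formula: an integrable function is the Fourier transform of its inverse
transform. -/
lemma isFourierPair_unitaryFourierInv [CompleteSpace A] {a : R3 → A} (ha : Integrable a) :
    IsFourierPair (unitaryFourierInv a) a := by
  intro χ
  obtain ⟨C, hC⟩ := exists_bound_schwartz χ
  have hcont : Continuous (unitaryFourierInv a) := by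
    rw [funext (unitaryFourierInv_eq_neg a)]
    exact (continuous_unitaryFourier ha).comp continuous_neg
  refine ⟨(integrable_schwartz_unitaryFourier χ).smul_bdd _ hcont.aestronglyMeasurable
    (.of_forall (norm_unitaryFourierInv_le a)),
    ha.bdd_smul C χ.continuous.aestronglyMeasurable (.of_forall hC), ?_⟩
  have h1 : ∀ p, unitaryFourier χ (-p) = schwartzFourierInv χ p := fun p => by
    rw [schwartzFourierInv_apply, unitaryFourierInv_eq_neg]
  have h2 := integral_unitaryFourier_smul (schwartzFourierInv χ).integrable ha
  simp only [← schwartzFourier_apply (schwartzFourierInv χ), schwartzFourier_schwartzFourierInv,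
    ← h1] at h2
  rw [← h2, ← integral_neg_eq_self]
  simp only [neg_neg, unitaryFourierInv_eq_neg]

end Inverse

section General

variable {F : Type*} [NormedAddCommGroup F]

/-- The weight `|p|` for `|p| < 1` and `1` for `|p| ≥ 1`. It is admissible, and
convergence in the corresponding space implies convergence of the inverse transforms
in `L^∞ + L²`. -/
def localWeight [NormedSpace ℂ F] (p : R3) : F →L[ℂ] F :=
  ((min ‖p‖ 1 : ℝ) : ℂ) • ContinuousLinearMap.id ℂ F

lemma norm_localWeight_apply [NormedSpace ℂ F] (p : R3) (v : F) :
    ‖(localWeight p : F →L[ℂ] F) v‖ = min ‖p‖ 1 * ‖v‖ := by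
  simp only [localWeight, smul_apply, ContinuousLinearMap.id_apply, norm_smul, Complex.norm_real]
  rw [Real.norm_of_nonneg (by positivity)]

lemma norm_localWeight_le [NormedSpace ℂ F] (p : R3) :
    ‖(localWeight p : F →L[ℂ] F)‖ ≤ min ‖p‖ 1 :=
  ContinuousLinearMap.opNorm_le_bound _ (by positivity) fun v => (norm_localWeight_apply p v).le

lemma memLp_inv_norm_ball : MemLp ((Metric.ball (0 : R3) 1).indicator fun p => ‖p‖⁻¹) 2 := by
  have hm : AEStronglyMeasurable ((Metric.ball (0 : R3) 1).indicator fun p => ‖p‖⁻¹) volume :=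
    (Measurable.aestronglyMeasurable (by fun_prop)).indicator Metric.isOpen_ball.measurableSet
  rw [memLp_two_iff_integrable_sq hm]
  have := integrableOn_ball_inv_norm_sq 1
  rw [← integrable_indicator_iff Metric.isOpen_ball.measurableSet] at this
  refine this.congr (.of_forall fun p => ?_)
  by_cases hp : p ∈ Metric.ball (0 : R3) 1 <;> simp [Set.indicator, hp]

lemma isWeight_localWeight [NormedSpace ℂ F] (k : ℕ) :
    IsWeight k (localWeight : R3 → F →L[ℂ] F) := by
  have hcont : Continuous (localWeight : R3 → F →L[ℂ] F) := by
    unfold localWeight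
    fun_prop
  have hm : ∀ j : ℕ, AEStronglyMeasurable
      (fun p : R3 => (((‖p‖ ^ j)⁻¹ : ℝ) : ℂ) • (localWeight p : F →L[ℂ] F)) volume := fun j =>
    (show Measurable fun p : R3 => (((‖p‖ ^ j)⁻¹ : ℝ) : ℂ) by
      fun_prop).aestronglyMeasurable.smul hcont.aestronglyMeasurable
  constructor
  · refine memLp_inv_norm_ball.mono'
      ((hm 2).indicator (measurableSet_lt (by fun_prop) (by fun_prop))) (.of_forall fun p => ?_)
    by_cases hp : ‖p‖ < 1
    · simp only [Set.indicator, Set.mem_ofPred_eq, hp, if_true, mem_ball_zero_iff, norm_smul,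
        Complex.norm_real, norm_inv, norm_pow, norm_norm]
      calc (‖p‖ ^ 2)⁻¹ * ‖(localWeight p : F →L[ℂ] F)‖ ≤ (‖p‖ ^ 2)⁻¹ * ‖p‖ := by
            gcongr
            exact (norm_localWeight_le p).trans (min_le_left _ _)
        _ ≤ ‖p‖⁻¹ := by
            rcases eq_or_ne ‖p‖ 0 with h | h
            · simp [h]
            · apply le_of_eq
              field_simp
    · simp [Set.indicator, hp]
  · refine memLp_top_of_bound ((hm k).indicator (measurableSet_le (by fun_prop) (by fun_prop))) 1
      (.of_forall fun p => ?_)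
    by_cases hp : 1 ≤ ‖p‖
    · simp only [Set.indicator, Set.mem_ofPred_eq, hp, if_true, norm_smul,
        Complex.norm_real, norm_inv, norm_pow, norm_norm]
      exact mul_le_one₀ (inv_le_one_of_one_le₀ (one_le_pow₀ hp)) (norm_nonneg _)
        ((norm_localWeight_le p).trans (min_le_right _ _))
    · simp [Set.indicator, hp]

/-- If `D n → 0` with the weight `localWeight`, and `D n` is the Fourier transform of `d n`, then
`d n` tends to `0` almost everywhere along a subsequence; the subsequence can be chosen
such that the same is true of another sequence that tends to `0` in `L²`. -/
lemma exists_subseq_tendsto_ae [InnerProductSpace ℂ F] [CompleteSpace F] {d D e : ℕ → R3 → F}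
    (hd : ∀ n, IsFourierPair (d n) (D n)) (hD : ∀ n, AEStronglyMeasurable (D n))
    (hmem : ∀ n, MemLp (fun p => (localWeight p : F →L[ℂ] F) (D n p)) 2)
    (hlim : Tendsto (fun n => eLpNorm (fun p => (localWeight p : F →L[ℂ] F) (D n p)) 2 volume)
      atTop (𝓝 0))
    (he : ∀ n, AEStronglyMeasurable (e n))
    (helim : Tendsto (fun n => eLpNorm (e n) 2 volume) atTop (𝓝 0)) :
    ∃ ns : ℕ → ℕ, StrictMono ns ∧ ∀ᵐ x, Tendsto (fun i => d (ns i) x) atTop (𝓝 0) ∧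
      Tendsto (fun i => e (ns i) x) atTop (𝓝 0) := by
  let B : Set R3 := Metric.ball 0 1
  have hB : MeasurableSet B := Metric.isOpen_ball.measurableSet
  -- Inside the unit ball `D n` is small in `L¹`, since `‖p‖⁻¹` is square integrable there; outside
  -- it is small in `L²`.
  have ha : ∀ n, eLpNorm (B.indicator (D n)) 1 volume ≤
      eLpNorm (B.indicator fun p => ‖p‖⁻¹) 2 volume *
        eLpNorm (fun p => (localWeight p : F →L[ℂ] F) (D n p)) 2 volume := by
    intro n
    have h1 := eLpNorm_le_eLpNorm_mul_eLpNorm'_of_norm (p := 2) (q := 2) (r := 1)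
      memLp_inv_norm_ball.1 (hmem n).1 (fun a b => (a : ℝ) • b) 1
      (.of_forall fun x => by simp [norm_smul])
    rw [ENNReal.coe_one, one_mul] at h1
    refine le_trans (eLpNorm_mono_ae ?_) h1
    filter_upwards [ae_ne_zero] with p hp
    rw [norm_smul, norm_localWeight_apply]
    by_cases hpB : p ∈ B
    · have : ‖p‖ < 1 := by simpa [B] using hpB
      have h0 : ‖p‖ ≠ 0 := by simpa using hp
      rw [Set.indicator_of_mem hpB, Set.indicator_of_mem hpB, min_eq_left this.le, norm_inv,
        norm_norm, inv_mul_cancel_left₀ h0]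
    · rw [Set.indicator_of_notMem hpB, norm_zero]
      positivity
  have hb : ∀ n, eLpNorm (Bᶜ.indicator (D n)) 2 volume ≤
        eLpNorm (fun p => (localWeight p : F →L[ℂ] F) (D n p)) 2 volume := by
    intro n
    refine eLpNorm_mono fun p => ?_
    rw [norm_localWeight_apply]
    by_cases hpB : p ∈ Bᶜ
    · have : 1 ≤ ‖p‖ := by simpa [B] using hpB
      rw [Set.indicator_of_mem hpB, min_eq_right this, one_mul]
    · rw [Set.indicator_of_notMem hpB, norm_zero]
      positivity
  have haint : ∀ n, Integrable (B.indicator (D n)) := fun n =>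
    memLp_one_iff_integrable.1 ⟨(hD n).indicator hB, (ha n).trans_lt
      (ENNReal.mul_lt_top memLp_inv_norm_ball.2 (hmem n).2)⟩
  have hbmem : ∀ n, MemLp (Bᶜ.indicator (D n)) 2 := fun n =>
    ⟨(hD n).indicator hB.compl, (hb n).trans_lt (hmem n).2⟩
  choose u hu humem hunorm using fun n => exists_isFourierPair_left (hbmem n)
  have hsplit : ∀ n, d n =ᵐ[volume] fun x => unitaryFourierInv (B.indicator (D n)) x + u n x := by
    intro n
    refine (hd n).ae_eq_left
      (((isFourierPair_unitaryFourierInv (haint n)).add (hu n)).congr .rfl ?_)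
    refine .of_forall fun p => ?_
    exact congrFun (Set.indicator_self_add_compl B (D n)) p
  have hv : ∀ x, Tendsto (fun n => unitaryFourierInv (B.indicator (D n)) x) atTop (𝓝 0) := by
    intro x
    have hL1 : Tendsto (fun n => eLpNorm (B.indicator (D n)) 1 volume) atTop (𝓝 0) := by
      have := ENNReal.Tendsto.const_mul hlim (Or.inr memLp_inv_norm_ball.2.ne)
      rw [mul_zero] at this
      exact tendsto_of_tendsto_of_tendsto_of_le_of_le tendsto_const_nhds this
        (fun _ => zero_le) ha
    have hL1' : Tendsto (fun n => ∫ p, ‖B.indicator (D n) p‖) atTop (𝓝 0) := by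
      have := (ENNReal.tendsto_toReal ENNReal.zero_ne_top).comp hL1
      rw [ENNReal.toReal_zero] at this
      refine this.congr fun n => ?_
      rw [Function.comp_apply, eLpNorm_one_eq_lintegral_enorm,
        integral_norm_eq_lintegral_enorm (haint n).1]
    refine squeeze_zero_norm (fun n => norm_unitaryFourierInv_le _ x) ?_
    simpa using hL1'.const_mul ((2 * Real.pi) ^ (-(3 / 2) : ℝ))
  -- One subsequence for both: pass to it in the sum of the norms.
  let h : ℕ → R3 → ℝ := fun n x => ‖u n x‖ + ‖e n x‖
  have hh : Tendsto (fun n => eLpNorm (h n - 0) 2 volume) atTop (𝓝 0) := by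
    have hlim2 : Tendsto (fun n => eLpNorm (fun p => (localWeight p : F →L[ℂ] F) (D n p)) 2 volume
        + eLpNorm (e n) 2 volume) atTop (𝓝 0) := by simpa using hlim.add helim
    refine tendsto_of_tendsto_of_tendsto_of_le_of_le tendsto_const_nhds hlim2
        (fun _ => zero_le) fun n => ?_
    rw [sub_zero]
    refine (eLpNorm_add_le (humem n).1.norm (he n).norm one_le_two).trans ?_
    rw [eLpNorm_norm, eLpNorm_norm, hunorm]
    gcongr
    exact hb n
  obtain ⟨ns, hns, hlimns⟩ := (tendstoInMeasure_of_tendsto_eLpNorm two_ne_zero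
    (fun n => (humem n).1.norm.add (he n).norm) aestronglyMeasurable_zero hh).exists_seq_tendsto_ae
  refine ⟨ns, hns, ?_⟩
  filter_upwards [hlimns, ae_all_iff.2 hsplit] with x hx hsx
  simp only [Pi.zero_apply] at hx
  have hux : Tendsto (fun i => u (ns i) x) atTop (𝓝 0) :=
    squeeze_zero_norm (fun i => le_add_of_nonneg_right (norm_nonneg (e (ns i) x))) hx
  refine ⟨?_, squeeze_zero_norm (fun i => le_add_of_nonneg_left (norm_nonneg (u (ns i) x))) hx⟩
  simp only [hsx]
  simpa using ((hv x).comp hns.tendsto_atTop).add hux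

end General

/-! ### Threshold states for a general kinetic energy -/

section Abstract

variable {F : Type*} [NormedAddCommGroup F]

/-- `W` is a square root of the potential `V`, with `W ∈ L² ∩ L^∞`. -/
structure IsPotentialRoot [NormedSpace ℂ F] (V W : R3 → F →L[ℂ] F) : Prop where
  memLp_two : MemLp W 2
  memLp_top : MemLp W ⊤
  sq : ∀ᵐ x, ∀ v, V x v = W x (W x v)

lemma eLpNorm_top_unitaryFourier_le [NormedSpace ℂ F] {f : R3 → F} (hf : AEStronglyMeasurable f) :
    eLpNorm (unitaryFourier f) ⊤ volume ≤
      ENNReal.ofReal ((2 * Real.pi) ^ (-(3 / 2) : ℝ)) * eLpNorm f 1 volume := by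
  by_cases h : Integrable f
  · rw [eLpNorm_exponent_top]
    refine (eLpNormEssSup_le_of_ae_bound (.of_forall (norm_unitaryFourier_le f))).trans ?_
    rw [ENNReal.ofReal_mul normalization_pos.le, eLpNorm_one_eq_lintegral_enorm,
      ofReal_integral_norm_eq_lintegral_enorm h]
  · have h1 : eLpNorm f 1 volume = ⊤ := by
      by_contra hne
      exact h (memLp_one_iff_integrable.1 ⟨hf, lt_top_iff_ne_top.2 hne⟩)
    rw [h1, ENNReal.mul_top]
    · exact le_top
    · simpa using normalization_pos

lemma memLp_top_unitaryFourier [NormedSpace ℂ F] [CompleteSpace F] {f : R3 → F}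
    (hf : Integrable f) : MemLp (unitaryFourier f) ⊤ :=
  memLp_top_of_bound (continuous_unitaryFourier hf).aestronglyMeasurable _
    (.of_forall (norm_unitaryFourier_le f))

/-- An `L²` solution of `(T - lam V) φ = E φ` satisfies `φ^ = (T - E)⁻¹ (lam V φ)^`. -/
lemma SolvesInL2.isFourierPair [NormedSpace ℂ F] [FiniteDimensional ℂ F]
    {T V : R3 → F →L[ℂ] F} {R : ℝ → R3 → F →L[ℂ] F}
    {gap : Set ℝ} {E₀ : ℝ} {k : ℕ} (hR : IsResolventSymbol T R gap E₀ k) {lam E : ℝ} {u f : R3 → F}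
    (h : SolvesInL2 T V lam E u) (hE : E ∈ gap) (hf : Integrable f)
    (hfV : f =ᵐ[volume] fun x => (lam : ℂ) • V x (u x)) :
    IsFourierPair u (fun p => R E p (unitaryFourier f p)) := by
  have := FiniteDimensional.complete ℂ F
  obtain ⟨v, ⟨-, -, uhat, hu, hv⟩, heq⟩ := h
  have h1 := hv.isFourierPair.sub (hu.isFourierPair.const_smul (E : ℂ))
  have h2 : (fun x => v x - (E : ℂ) • u x) =ᵐ[volume] f := by
    filter_upwards [heq, hfV] with x hx hfx
    rw [hfx, ← hx]
    abel
  have h3 := (h1.congr h2 .rfl).ae_eq_right (isFourierPair_unitaryFourier hf)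
  refine hu.isFourierPair.congr .rfl ?_
  filter_upwards [h3, ae_ne_zero] with p hp hp0
  rw [← hp, hR.left_inv E (Set.mem_insert_of_mem _ hE) p hp0]

/-- If `φ₀` has the Fourier transform `(T - E₀)⁻¹ f^` with `f = lam V φ₀`, then it satisfies
`(T - lam V) φ₀ = E₀ φ₀` as a tempered distribution. -/
lemma IsResolventSymbol.solvesInTempered [NormedSpace ℂ F] [FiniteDimensional ℂ F]
    {T V : R3 → F →L[ℂ] F} {R : ℝ → R3 → F →L[ℂ] F}
    {gap : Set ℝ} {E₀ : ℝ} {k : ℕ} (hR : IsResolventSymbol T R gap E₀ k) {lam : ℝ} {u g : R3 → F}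
    (hg : Integrable g) (hgV : g =ᵐ[volume] fun x => V x (u x))
    (h : IsFourierPair u (fun p => R E₀ p (unitaryFourier (fun x => (lam : ℂ) • g x) p))) :
    SolvesInTempered T V lam E₀ u := by
  have := FiniteDimensional.complete ℂ F
  intro ψ
  -- In momentum space `ψ` becomes `η`, and its kinetic transpose becomes `χ = η ∘ T`.
  let η : 𝓢(R3, F →L[ℂ] ℂ) := schwartzFourierInv ψ
  let χ : 𝓢(R3, F →L[ℂ] ℂ) :=
    SchwartzMap.bilinLeftCLM (ContinuousLinearMap.compL ℂ F F ℂ) hR.temperate η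
  have hη : ∀ x, unitaryFourier η x = ψ x := fun x => by
    rw [← schwartzFourier_apply, schwartzFourier_schwartzFourierInv]
  have hχT : ∀ p, χ p = (η p).comp (T p) := fun p => rfl
  have hχ : transposeKinetic T ψ = unitaryFourier χ := by
    rw [transposeKinetic]
    congr 1
    funext p
    rw [hχT, ← schwartzFourierInv_apply]
  have hF : Integrable fun x => (lam : ℂ) • g x := hg.smul _
  obtain ⟨i1, i2, i3⟩ := h.isFourierTransform χ
  obtain ⟨j1, j2, j3⟩ := h.isFourierTransform η
  obtain ⟨-, k2, k3⟩ := (isFourierPair_unitaryFourier hF).isFourierTransform η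
  simp only [hη] at j1 j3 k3
  obtain ⟨C, hC⟩ := exists_bound_schwartz ψ
  have hV : (fun x => ψ x (g x)) =ᵐ[volume] fun x => ψ x (V x (u x)) := by
    filter_upwards [hgV] with x hx
    rw [hx]
  have hψg : Integrable fun x => ψ x (g x) := by
    refine (hg.norm.const_mul C).mono'
      ((ContinuousLinearMap.id ℂ (F →L[ℂ] ℂ)).aestronglyMeasurable_comp₂
        ψ.continuous.aestronglyMeasurable hg.1) (.of_forall fun x => ?_)
    exact ((ψ x).le_opNorm _).trans (by gcongr; exact hC x)
  rw [hχ]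
  refine ⟨i1, hψg.congr hV, j1, ?_⟩
  rw [← i3, ← j3, ← integral_congr_ae hV]
  have e1 : ∫ p, χ p (R E₀ p (unitaryFourier (fun x => (lam : ℂ) • g x) p)) =
      ∫ p, ((E₀ : ℂ) * η p (R E₀ p (unitaryFourier (fun x => (lam : ℂ) • g x) p)) +
        η p (unitaryFourier (fun x => (lam : ℂ) • g x) p)) := by
    refine integral_congr_ae ?_
    filter_upwards [ae_ne_zero] with p hp
    have := hR.right_inv E₀ (Set.mem_insert _ _) p hp
      (unitaryFourier (fun x => (lam : ℂ) • g x) p)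
    rw [hχT, ContinuousLinearMap.comp_apply, sub_eq_iff_eq_add'.1 this, map_add, map_smul,
      smul_eq_mul]
  have e2 : ∫ x, ψ x ((lam : ℂ) • g x) = (lam : ℂ) * ∫ x, ψ x (g x) := by
    simp only [map_smul]
    rw [integral_smul, smul_eq_mul]
  rw [e1, integral_add (j2.const_mul _) k2, k3, e2, integral_const_mul]
  ring

variable [InnerProductSpace ℂ F] [FiniteDimensional ℂ F]

/-- The theorem for a general symbol: the Green function may be any family `G E` that
converges off the diagonal to a kernel whose symbol is `(T - E₀)⁻¹`. -/
theorem thresholdConclusion_of_symbol {T V W : R3 → F →L[ℂ] F} {R G : ℝ → R3 → F →L[ℂ] F}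
    {K : R3 → F →L[ℂ] F} {gap : Set ℝ} {E₀ lamc : ℝ} {l lK : Filter ℝ} {k : ℕ} [NeBot lK]
    (hR : IsResolventSymbol T R gap E₀ k) (hW : IsPotentialRoot V W) (hl : l ≤ 𝓝 lamc)
    (hG : ∀ x, x ≠ 0 → Tendsto (fun E => G E x) lK (𝓝 (K x))) (hK : HasSymbol K (R E₀))
    {E : ℝ → ℝ} {lam : ℕ → ℝ} {φ : ℕ → R3 → F} {μ₀ : R3 → F}
    (hseq : IsThresholdSequence T V W gap E₀ l E lam φ μ₀) {weights : Set (R3 → F →L[ℂ] F)}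
    (hw : ∀ w ∈ weights, IsWeight k w) :
    ThresholdConclusion T V W G lK E₀ lamc φ μ₀ weights := by
  have := FiniteDimensional.complete ℂ F
  have hlim : ∀ x, x ≠ 0 → limitKernel G lK x = K x := fun x hx => (hG x hx).limUnder_eq
  have hKlim : HasSymbol (limitKernel G lK) (R E₀) := by
    refine hK.congr_kernel ?_
    filter_upwards [ae_ne_zero] with x hx using (hlim x hx).symm
  have hE₀ : Tendsto (fun n => E (lam n)) atTop (𝓝 E₀) := hseq.threshold.2.comp hseq.coupling
  have hlam : Tendsto lam atTop (𝓝 lamc) := hseq.coupling.mono_right hl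
  have hφ : ∀ n, MemLp (φ n) 2 := fun n => by
    obtain ⟨v, hv, -⟩ := hseq.solves n
    exact hv.1
  have hWφ : ∀ n, MemLp (fun x => W x (φ n x)) 2 := fun n => memLp_clm_apply hW.memLp_top (hφ n)
  have hdiff : ∀ n, MemLp (fun x => W x (φ n x) - μ₀ x) 2 := fun n => (hWφ n).sub hseq.limit_memLp
  let g : R3 → F := fun x => W x (μ₀ x)
  let f : ℕ → R3 → F := fun n x => (lam n : ℂ) • W x (W x (φ n x))
  let f₀ : R3 → F := fun x => (lamc : ℂ) • g x
  -- Hölder's inequality with `W ∈ L²` and with `W ∈ L^∞` gives `f n → f₀` in `L¹` and in `L²`.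
  have hconv : ∀ q r : ENNReal, ENNReal.HolderTriple q 2 r → MemLp W q → 1 ≤ r →
      (∀ n, MemLp (f n) r) ∧ MemLp f₀ r ∧
      Tendsto (fun n => eLpNorm (fun x => f n x - f₀ x) r volume) atTop (𝓝 0) := by
    intro q r _ hWq hr
    have hg : MemLp g r := memLp_clm_apply hWq hseq.limit_memLp
    refine ⟨fun n => (memLp_clm_apply hWq (hWφ n)).const_smul _, hg.const_smul _, ?_⟩
    have hbd : ∀ n, eLpNorm (fun x => f n x - f₀ x) r volume ≤
        ‖(lam n : ℂ)‖ₑ * (eLpNorm W q volume *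
          eLpNorm (fun x => W x (φ n x) - μ₀ x) 2 volume) +
        ‖((lam n - lamc : ℝ) : ℂ)‖ₑ * eLpNorm g r volume := by
      intro n
      have h1 : (fun x => f n x - f₀ x) = fun x => (lam n : ℂ) • W x (W x (φ n x) - μ₀ x) +
          ((lam n - lamc : ℝ) : ℂ) • g x := by
        funext x
        simp only [f, f₀, g, map_sub, smul_sub, Complex.ofReal_sub, sub_smul]
        abel
      rw [h1]
      refine (eLpNorm_add_le ((aestronglyMeasurable_clm_apply hWq.1 (hdiff n).1).const_smul _)
        (hg.1.const_smul _) hr).trans ?_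
      refine add_le_add (eLpNorm_const_smul_le.trans ?_) eLpNorm_const_smul_le
      gcongr
      exact eLpNorm_clm_apply_le hWq.1 (hdiff n).1
    have hc : Tendsto (fun n => ‖(lam n : ℂ)‖ₑ) atTop (𝓝 ‖(lamc : ℂ)‖ₑ) :=
      ((Complex.continuous_ofReal.tendsto _).comp hlam).enorm
    have hc' : Tendsto (fun n => ‖((lam n - lamc : ℝ) : ℂ)‖ₑ) atTop (𝓝 0) := by
      have h2 : Tendsto (fun n => lam n - lamc) atTop (𝓝 0) := by
        simpa using hlam.sub_const lamc
      simpa using ((Complex.continuous_ofReal.tendsto _).comp h2).enorm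
    have h3 : Tendsto (fun n => ‖(lam n : ℂ)‖ₑ * (eLpNorm W q volume *
          eLpNorm (fun x => W x (φ n x) - μ₀ x) 2 volume) +
        ‖((lam n - lamc : ℝ) : ℂ)‖ₑ * eLpNorm g r volume) atTop (𝓝 0) := by
      have h4 := ENNReal.Tendsto.const_mul (a := eLpNorm W q volume) hseq.limit
        (Or.inr hWq.2.ne)
      rw [mul_zero] at h4
      have h5 := ENNReal.Tendsto.mul hc (Or.inr ENNReal.zero_ne_top) h4 (Or.inr enorm_ne_top)
      have h6 := ENNReal.Tendsto.mul_const (b := eLpNorm g r volume) hc' (Or.inr hg.2.ne)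
      simpa using h5.add h6
    exact tendsto_of_tendsto_of_tendsto_of_le_of_le tendsto_const_nhds h3
        (fun _ => zero_le) hbd
  obtain ⟨hf1, hf₀1, hl1⟩ := hconv 2 1 inferInstance hW.memLp_two le_rfl
  obtain ⟨hf2, hf₀2, hl2⟩ := hconv ⊤ 2 inferInstance hW.memLp_top one_le_two
  have hfi : ∀ n, Integrable (f n) := fun n => memLp_one_iff_integrable.1 (hf1 n)
  have hf₀i : Integrable f₀ := memLp_one_iff_integrable.1 hf₀1
  have hgi : Integrable g := memLp_one_iff_integrable.1
    (memLp_clm_apply hW.memLp_two hseq.limit_memLp)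
  have hsub : ∀ n, (fun p => unitaryFourier (f n) p - unitaryFourier f₀ p) =
      unitaryFourier fun x => f n x - f₀ x := fun n =>
    funext fun p => (unitaryFourier_sub (hfi n) hf₀i p).symm
  have hWT : ∀ w, IsWeight k w → WeightedTendsto w
      (fun n p => R (E (lam n)) p (unitaryFourier (f n) p))
      (fun p => R E₀ p (unitaryFourier f₀ p)) := by
    intro w hw
    refine hR.weightedTendsto hw hseq.energy hE₀ (fun n => memLp_top_unitaryFourier (hfi n))
      (fun n => (eLpNorm_unitaryFourier (hfi n) (hf2 n)).1) (memLp_top_unitaryFourier hf₀i)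
      (eLpNorm_unitaryFourier hf₀i hf₀2).1 ?_ ?_
    · have := ENNReal.Tendsto.const_mul (a := ENNReal.ofReal ((2 * Real.pi) ^ (-(3 / 2) : ℝ))) hl1
        (Or.inr ENNReal.ofReal_ne_top)
      rw [mul_zero] at this
      refine tendsto_of_tendsto_of_tendsto_of_le_of_le tendsto_const_nhds this
        (fun _ => zero_le) fun n => ?_
      simp only [hsub]
      exact eLpNorm_top_unitaryFourier_le ((hf1 n).sub hf₀1).1
    · refine hl2.congr fun n => ?_
      rw [hsub]
      exact (eLpNorm_unitaryFourier ((hfi n).sub hf₀i) ((hf2 n).sub hf₀2)).2.symm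
  have hpair : ∀ n, IsFourierPair (φ n) (fun p => R (E (lam n)) p (unitaryFourier (f n) p)) := by
    intro n
    refine (hseq.solves n).isFourierPair hR (hseq.energy n) (hfi n) ?_
    filter_upwards [hW.sq] with x hx
    simp only [f, hx]
  have hstate : thresholdState (limitKernel G lK) W lamc μ₀ =
      fun x => ∫ y, limitKernel G lK (x - y) (f₀ y) := by
    funext x
    simp only [thresholdState, f₀, g, map_smul]
    rw [integral_smul]
  have hpair₀ : IsFourierPair (thresholdState (limitKernel G lK) W lamc μ₀)
      (fun p => R E₀ p (unitaryFourier f₀ p)) := by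
    rw [hstate]
    exact hKlim.isFourierPair_convolution hf₀i
  -- `W φ₀ = μ₀`, from almost everywhere convergence of `φ n` along a subsequence.
  have hWstate : g =ᵐ[volume] fun x => V x (thresholdState (limitKernel G lK) W lamc μ₀ x) := by
    obtain ⟨hm, hm₀, hmlim⟩ := hWT _ (isWeight_localWeight k)
    have hD : ∀ n, AEStronglyMeasurable (fun p => R (E (lam n)) p (unitaryFourier (f n) p) -
        R E₀ p (unitaryFourier f₀ p)) volume := fun n =>
      (aestronglyMeasurable_clm_apply (hR.measurable _)
        (continuous_unitaryFourier (hfi n)).aestronglyMeasurable).sub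
      (aestronglyMeasurable_clm_apply (hR.measurable _)
        (continuous_unitaryFourier hf₀i).aestronglyMeasurable)
    obtain ⟨ns, -, hns⟩ := exists_subseq_tendsto_ae (fun n => (hpair n).sub hpair₀) hD
      (fun n => by simp only [map_sub]; exact (hm n).sub hm₀)
      (by simpa only [map_sub] using hmlim) (fun n => (hdiff n).1) hseq.limit
    filter_upwards [hns, hW.sq] with x hx hsq
    rw [hsq]
    have h1 : Tendsto (fun i => φ (ns i) x) atTop
        (𝓝 (thresholdState (limitKernel G lK) W lamc μ₀ x)) := tendsto_sub_nhds_zero_iff.1 hx.1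
    have h2 : Tendsto (fun i => W x (φ (ns i) x)) atTop (𝓝 (μ₀ x)) :=
      tendsto_sub_nhds_zero_iff.1 hx.2
    have h3 := tendsto_nhds_unique h2 (((W x).continuous.tendsto _).comp h1)
    simp only [g, h3]
  refine ⟨fun x hx => by rw [hlim x hx]; exact hG x hx, hKlim.kernel.ae_integrable_convolution hgi,
    ⟨_, _, fun n => (hpair n).isFourierTransform, hpair₀.isFourierTransform,
      fun w hmem => hWT w (hw w hmem)⟩, hR.solvesInTempered hgi hWstate hpair₀⟩

end Abstract

/-! ### Integrals over the heat time -/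

section HeatTime

lemma integrableOn_rpow_mul_exp_neg {s a : ℝ} (hs : 0 < s) (ha : 0 < a) :
    IntegrableOn (fun t : ℝ => t ^ (s - 1) * Real.exp (-(a * t))) (Set.Ioi 0) := by
  have := integrableOn_rpow_mul_exp_neg_mul_rpow (p := 1) (s := s - 1) (b := a) (by linarith)
    one_pos ha
  simpa only [Real.rpow_one, neg_mul] using this

lemma integrableOn_rpow_mul_exp_neg_inv {s a : ℝ} (hs : 0 < s) (ha : 0 < a) :
    IntegrableOn (fun t : ℝ => t ^ (-s - 1) * Real.exp (-(a / t))) (Set.Ioi 0) := by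
  refine ((integrableOn_Ioi_comp_rpow_iff' _ (p := -1) (by norm_num)).2
    (integrableOn_rpow_mul_exp_neg hs ha)).congr_fun (fun t ht => ?_) measurableSet_Ioi
  have ht' : 0 < t := ht
  simp only [smul_eq_mul]
  rw [← Real.rpow_mul ht'.le, ← mul_assoc, ← Real.rpow_add ht', Real.rpow_neg_one, div_eq_mul_inv]
  congr 2
  ring

/-- The Gamma integral after the substitution `t ↦ 1 / t`. -/
lemma integral_rpow_mul_exp_neg_inv {s a : ℝ} (hs : 0 < s) (ha : 0 < a) :
    ∫ t in Set.Ioi (0 : ℝ), t ^ (-s - 1) * Real.exp (-(a / t)) = (1 / a) ^ s * Real.Gamma s := by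
  rw [← Real.integral_rpow_mul_exp_neg_mul_Ioi hs ha,
    ← integral_comp_rpow_Ioi _ (p := -1) (by norm_num)]
  refine setIntegral_congr_fun measurableSet_Ioi fun t ht => ?_
  have ht' : 0 < t := ht
  simp only [smul_eq_mul, abs_neg, abs_one, one_mul]
  rw [← Real.rpow_mul ht'.le, ← mul_assoc, ← Real.rpow_add ht', Real.rpow_neg_one, div_inv_eq_mul]
  congr 2
  ring

lemma rpow_three_halves {a : ℝ} (ha : 0 < a) : a ^ (3 / 2 : ℝ) = a * Real.sqrt a := by
  rw [Real.sqrt_eq_rpow, ← Real.rpow_one_add' ha.le (by norm_num)]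
  norm_num

lemma gamma_three_halves : Real.Gamma (3 / 2) = Real.sqrt Real.pi / 2 := by
  rw [show (3 / 2 : ℝ) = 1 / 2 + 1 by norm_num, Real.Gamma_add_one (by norm_num),
    Real.Gamma_one_half_eq]
  ring

end HeatTime

/-! ### The heat kernel -/

section HeatKernel

/-- The heat kernel of `R³`. -/
def heatKernel (t : ℝ) (x : R3) : ℝ :=
  (4 * Real.pi * t) ^ (-(3 / 2) : ℝ) * Real.exp (-(‖x‖ ^ 2 / (4 * t)))

lemma heatKernel_nonneg {t : ℝ} (ht : 0 < t) (x : R3) : 0 ≤ heatKernel t x := by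
  unfold heatKernel
  positivity

lemma measurable_heatKernel : Measurable fun z : R3 × ℝ => heatKernel z.2 z.1 := by
  unfold heatKernel
  fun_prop

lemma continuous_heatKernel (t : ℝ) : Continuous (heatKernel t) := by
  unfold heatKernel
  fun_prop

lemma integrable_heatKernel {t : ℝ} (ht : 0 < t) : Integrable (heatKernel t) := by
  unfold heatKernel
  refine Integrable.const_mul ?_ _
  have h := (GaussianFourier.integrable_cexp_neg_mul_sq_norm_add (V := R3)
    (b := ((1 / (4 * t) : ℝ) : ℂ)) (by rw [Complex.ofReal_re]; positivity) 0 0).norm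
  refine h.congr (.of_forall fun x => ?_)
  simp only [Complex.norm_exp]
  congr 1
  simp [← Complex.ofReal_pow]
  ring

open FourierTransform in
lemma unitaryFourier_heatKernel {t : ℝ} (ht : 0 < t) (p : R3) :
    unitaryFourier (fun x => (heatKernel t x : ℂ)) p =
      (((2 * Real.pi) ^ (-(3 / 2) : ℝ) : ℝ) : ℂ) * (Real.exp (-(t * ‖p‖ ^ 2)) : ℂ) := by
  have hpi := Real.pi_pos
  have h := fourier_gaussian_innerProductSpace (V := R3) (b := ((1 / (4 * t) : ℝ) : ℂ))
    (by rw [Complex.ofReal_re]; positivity) ((2 * Real.pi)⁻¹ • p)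
  have h1 : (fun x : R3 => (heatKernel t x : ℂ)) =
      fun x => (((4 * Real.pi * t) ^ (-(3 / 2) : ℝ) : ℝ) : ℂ) •
        Complex.exp (-((1 / (4 * t) : ℝ) : ℂ) * (‖x‖ : ℂ) ^ 2) := by
    funext x
    rw [heatKernel, Complex.ofReal_mul, smul_eq_mul, Complex.ofReal_exp]
    congr 2
    push_cast
    ring
  have h2 : (Real.pi / ((1 / (4 * t) : ℝ) : ℂ)) ^ (Module.finrank ℝ R3 / 2 : ℂ) =
      (((4 * Real.pi * t) ^ (3 / 2 : ℝ) : ℝ) : ℂ) := by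
    rw [Complex.ofReal_cpow (by positivity)]
    congr 1
    · push_cast
      field_simp
    · simp
  rw [unitaryFourier_eq_fourier, h1]
  have h3 : 𝓕 (fun x : R3 => (((4 * Real.pi * t) ^ (-(3 / 2) : ℝ) : ℝ) : ℂ) •
        Complex.exp (-((1 / (4 * t) : ℝ) : ℂ) * (‖x‖ : ℂ) ^ 2)) ((2 * Real.pi)⁻¹ • p) =
      (((4 * Real.pi * t) ^ (-(3 / 2) : ℝ) : ℝ) : ℂ) •
      𝓕 (fun x : R3 => Complex.exp (-((1 / (4 * t) : ℝ) : ℂ) * (‖x‖ : ℂ) ^ 2))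
        ((2 * Real.pi)⁻¹ • p) := by
    simp only [Real.fourier_eq', smul_comm (Complex.exp _)]
    rw [integral_smul]
  rw [h3, h, h2, smul_eq_mul, smul_eq_mul]
  congr 1
  rw [← mul_assoc, ← Complex.ofReal_mul, ← Real.rpow_add (by positivity)]
  rw [neg_add_cancel, Real.rpow_zero, Complex.ofReal_one, one_mul, Complex.ofReal_exp]
  congr 1
  rw [norm_smul, Real.norm_of_nonneg (by positivity)]
  have : (Real.pi : ℂ) ≠ 0 := by exact_mod_cast hpi.ne'
  have : (t : ℂ) ≠ 0 := by exact_mod_cast ht.ne'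
  push_cast
  field_simp
  ring

/-- Differentiation becomes multiplication by `i p`. -/
lemma unitaryFourier_fderiv {f : R3 → ℂ} (hf : Integrable f) (hd : Differentiable ℝ f)
    (hf' : Integrable (fderiv ℝ f)) (e p : R3) :
    unitaryFourier (fun x => fderiv ℝ f x e) p =
      Complex.I * ((inner ℝ p e : ℝ) : ℂ) * unitaryFourier f p := by
  rw [unitaryFourier_eq_fourier, unitaryFourier_eq_fourier,
    ← Real.fourier_continuousLinearMap_apply hf', Real.fourier_fderiv hf hd hf']
  have : (Real.pi : ℂ) ≠ 0 := by exact_mod_cast Real.pi_ne_zero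
  have h1 : (-innerSL ℝ) ((2 * Real.pi)⁻¹ • p) e = -((2 * Real.pi)⁻¹ * inner ℝ p e) := by
    simp only [neg_apply, innerSL_apply_apply, real_inner_smul_left]
  rw [VectorFourier.fourierSMulRight_apply, h1, ← Complex.coe_smul]
  simp only [smul_eq_mul]
  push_cast
  field_simp

lemma hasFDerivAt_heatKernel (t : ℝ) (x : R3) :
    HasFDerivAt (fun x => (heatKernel t x : ℂ))
      ((-(heatKernel t x / (2 * t)) : ℝ) • Complex.ofRealCLM.comp (innerSL ℝ x)) x := by
  have h1 : HasFDerivAt (fun x : R3 => ‖x‖ ^ 2) ((2 : ℝ) • innerSL ℝ x) x := by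
    simpa only [two_smul] using (hasStrictFDerivAt_norm_sq x).hasFDerivAt
  have h2 : HasFDerivAt (heatKernel t) _ x := ((h1.mul_const ((4 * t)⁻¹)).fun_neg.exp.const_mul
    ((4 * Real.pi * t) ^ (-(3 / 2) : ℝ)))
  have h3 := Complex.ofRealCLM.hasFDerivAt.comp x h2
  refine h3.congr_fderiv ?_
  ext v
  simp only [heatKernel, ContinuousLinearMap.comp_apply, smul_apply, neg_apply,
    innerSL_apply_apply, smul_eq_mul, Complex.ofRealCLM_apply, Complex.real_smul, div_eq_mul_inv,
    mul_inv]
  push_cast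
  ring

/-- The factor `‖x‖` is absorbed by doubling the time. -/
lemma norm_mul_heatKernel_le {t : ℝ} (ht : 0 < t) (x : R3) :
    ‖x‖ * heatKernel t x ≤ 8 * (1 + 8 * t) * heatKernel (2 * t) x := by
  have h1 : heatKernel t x = 2 ^ (3 / 2 : ℝ) * heatKernel (2 * t) x *
      Real.exp (-(‖x‖ ^ 2 / (8 * t))) := by
    have e1 : (4 * Real.pi * t) ^ (-(3 / 2) : ℝ) =
        2 ^ (3 / 2 : ℝ) * (4 * Real.pi * (2 * t)) ^ (-(3 / 2) : ℝ) := by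
      rw [show 4 * Real.pi * (2 * t) = 2 * (4 * Real.pi * t) by ring,
        Real.mul_rpow zero_le_two (by positivity), ← mul_assoc, ← Real.rpow_add two_pos]
      simp
    have e2 : Real.exp (-(‖x‖ ^ 2 / (4 * t))) =
        Real.exp (-(‖x‖ ^ 2 / (4 * (2 * t)))) * Real.exp (-(‖x‖ ^ 2 / (8 * t))) := by
      rw [← Real.exp_add]
      congr 1
      field_simp
      ring
    rw [heatKernel, heatKernel, e1, e2]
    ring
  have h2 : ‖x‖ * Real.exp (-(‖x‖ ^ 2 / (8 * t))) ≤ 1 + 8 * t := by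
    have h3 := Real.add_one_le_exp (‖x‖ ^ 2 / (8 * t))
    rw [Real.exp_neg, ← div_eq_mul_inv, div_le_iff₀ (Real.exp_pos _)]
    refine le_trans ?_ (mul_le_mul_of_nonneg_left h3 (by positivity))
    have h4 : (1 + 8 * t) * (‖x‖ ^ 2 / (8 * t) + 1) =
        ‖x‖ ^ 2 + 1 + ‖x‖ ^ 2 / (8 * t) + 8 * t := by
      field_simp
      ring
    rw [h4]
    have h5 : 0 ≤ ‖x‖ ^ 2 / (8 * t) := by positivity
    nlinarith [sq_nonneg (‖x‖ - 1)]
  have h6 : (2 : ℝ) ^ (3 / 2 : ℝ) ≤ 8 := by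
    calc (2 : ℝ) ^ (3 / 2 : ℝ) ≤ 2 ^ (3 : ℝ) :=
          Real.rpow_le_rpow_of_exponent_le one_le_two (by norm_num)
      _ = 8 := by norm_num
  have h7 := heatKernel_nonneg (t := 2 * t) (by positivity) x
  calc ‖x‖ * heatKernel t x = 2 ^ (3 / 2 : ℝ) * (‖x‖ * Real.exp (-(‖x‖ ^ 2 / (8 * t)))) *
        heatKernel (2 * t) x := by rw [h1]; ring
    _ ≤ _ := by gcongr

lemma fderiv_heatKernel_apply (t : ℝ) (x e : R3) :
    fderiv ℝ (fun x => (heatKernel t x : ℂ)) x e =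
      ((-(inner ℝ x e / (2 * t) * heatKernel t x) : ℝ) : ℂ) := by
  rw [(hasFDerivAt_heatKernel t x).fderiv]
  simp only [smul_apply, ContinuousLinearMap.comp_apply, innerSL_apply_apply,
    Complex.ofRealCLM_apply, Complex.real_smul]
  push_cast
  ring

lemma integrable_fderiv_heatKernel {t : ℝ} (ht : 0 < t) :
    Integrable (fderiv ℝ fun x => (heatKernel t x : ℂ)) := by
  have hh := heatKernel_nonneg ht
  refine ((integrable_heatKernel (t := 2 * t) (by positivity)).const_mul
    (8 * (1 + 8 * t) / (2 * t))).mono' ?_ (.of_forall fun x => ?_)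
  · have : fderiv ℝ (fun x => (heatKernel t x : ℂ)) = fun x =>
        (-(heatKernel t x / (2 * t)) : ℝ) • Complex.ofRealCLM.comp (innerSL ℝ x) :=
      funext fun x => (hasFDerivAt_heatKernel t x).fderiv
    rw [this]
    have := continuous_heatKernel t
    exact Continuous.aestronglyMeasurable (by fun_prop)
  · refine ContinuousLinearMap.opNorm_le_bound _ ?_ fun e => ?_
    · have := heatKernel_nonneg (t := 2 * t) (by positivity) x
      positivity
    · rw [fderiv_heatKernel_apply, Complex.norm_real, norm_neg, norm_mul, norm_div,
        Real.norm_of_nonneg (hh x), Real.norm_of_nonneg (by positivity : 0 ≤ 2 * t)]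
      calc ‖(inner ℝ x e : ℝ)‖ / (2 * t) * heatKernel t x
          ≤ ‖x‖ * ‖e‖ / (2 * t) * heatKernel t x := by
            have := hh x
            gcongr
            exact norm_inner_le_norm x e
        _ = (‖x‖ * heatKernel t x) / (2 * t) * ‖e‖ := by ring
        _ ≤ (8 * (1 + 8 * t) * heatKernel (2 * t) x) / (2 * t) * ‖e‖ := by
            have := norm_mul_heatKernel_le ht x
            gcongr
        _ = _ := by ring

end HeatKernel

/-! ### The Coulomb kernel and its gradient -/

section Coulomb

lemma heatKernel_eq_rpow {t : ℝ} (ht : 0 < t) (x : R3) :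
    heatKernel t x = (8 * Real.pi * Real.sqrt Real.pi)⁻¹ *
      (t ^ (-(1 / 2) - 1 : ℝ) * Real.exp (-((‖x‖ ^ 2 / 4) / t))) := by
  have h1 : (4 * Real.pi) ^ (-(3 / 2) : ℝ) = (8 * Real.pi * Real.sqrt Real.pi)⁻¹ := by
    rw [Real.rpow_neg (by positivity), rpow_three_halves (by positivity),
      Real.sqrt_mul (by norm_num), show (4 : ℝ) = 2 ^ 2 by norm_num, Real.sqrt_sq (by norm_num)]
    congr 1
    ring
  rw [heatKernel, Real.mul_rpow (by positivity) ht.le, h1, mul_assoc, div_div]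
  norm_num

lemma rpow_half_inv {r : ℝ} (hr : 0 < r) : (1 / (r ^ 2 / 4)) ^ (1 / 2 : ℝ) = 2 / r := by
  rw [show 1 / (r ^ 2 / 4) = (2 / r) ^ 2 by field_simp; norm_num, ← Real.sqrt_eq_rpow,
    Real.sqrt_sq (by positivity)]

lemma integrableOn_heatKernel {x : R3} (hx : x ≠ 0) :
    IntegrableOn (fun t => heatKernel t x) (Set.Ioi 0) := by
  have hr : 0 < ‖x‖ := norm_pos_iff.2 hx
  refine IntegrableOn.congr_fun ((integrableOn_rpow_mul_exp_neg_inv (s := 1 / 2) (a := ‖x‖ ^ 2 / 4)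
    (by norm_num) (by positivity)).const_mul ((8 * Real.pi * Real.sqrt Real.pi)⁻¹))
    (fun t ht => (heatKernel_eq_rpow ht x).symm) measurableSet_Ioi

/-- The Coulomb kernel is the time integral of the heat kernel. -/
lemma integral_heatKernel {x : R3} (hx : x ≠ 0) :
    ∫ t in Set.Ioi 0, heatKernel t x = (4 * Real.pi * ‖x‖)⁻¹ := by
  have hr : 0 < ‖x‖ := norm_pos_iff.2 hx
  have hpi : 0 < Real.sqrt Real.pi := Real.sqrt_pos.2 Real.pi_pos
  rw [setIntegral_congr_fun measurableSet_Ioi fun t ht => heatKernel_eq_rpow ht x,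
    integral_const_mul, integral_rpow_mul_exp_neg_inv (by norm_num) (by positivity),
    Real.Gamma_one_half_eq, rpow_half_inv hr]
  field_simp
  norm_num

lemma div_mul_heatKernel_eq_rpow {t : ℝ} (ht : 0 < t) (x : R3) :
    (2 * t)⁻¹ * heatKernel t x = (16 * Real.pi * Real.sqrt Real.pi)⁻¹ *
      (t ^ (-(3 / 2) - 1 : ℝ) * Real.exp (-((‖x‖ ^ 2 / 4) / t))) := by
  have : t ^ (-(3 / 2) - 1 : ℝ) = t ^ (-(1 / 2) - 1 : ℝ) * t⁻¹ := by
    rw [← Real.rpow_neg_one t, ← Real.rpow_add ht]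
    norm_num
  rw [heatKernel_eq_rpow ht, this]
  field_simp
  norm_num

lemma integrableOn_div_mul_heatKernel {x : R3} (hx : x ≠ 0) :
    IntegrableOn (fun t => (2 * t)⁻¹ * heatKernel t x) (Set.Ioi 0) := by
  have hr : 0 < ‖x‖ := norm_pos_iff.2 hx
  refine IntegrableOn.congr_fun ((integrableOn_rpow_mul_exp_neg_inv (s := 3 / 2) (a := ‖x‖ ^ 2 / 4)
    (by norm_num) (by positivity)).const_mul ((16 * Real.pi * Real.sqrt Real.pi)⁻¹))
    (fun t ht => (div_mul_heatKernel_eq_rpow ht x).symm) measurableSet_Ioi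

lemma integral_div_mul_heatKernel {x : R3} (hx : x ≠ 0) :
    ∫ t in Set.Ioi 0, (2 * t)⁻¹ * heatKernel t x = (4 * Real.pi * ‖x‖ ^ 3)⁻¹ := by
  have hr : 0 < ‖x‖ := norm_pos_iff.2 hx
  have hpi : 0 < Real.sqrt Real.pi := Real.sqrt_pos.2 Real.pi_pos
  have h1 : (1 / (‖x‖ ^ 2 / 4)) ^ (3 / 2 : ℝ) = (2 / ‖x‖) ^ 3 := by
    rw [rpow_three_halves (by positivity), Real.sqrt_eq_rpow, rpow_half_inv hr]
    field_simp
    norm_num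
  rw [setIntegral_congr_fun measurableSet_Ioi fun t ht => div_mul_heatKernel_eq_rpow ht x,
    integral_const_mul, integral_rpow_mul_exp_neg_inv (by norm_num) (by positivity),
    gamma_three_halves, h1]
  field_simp
  norm_num

lemma integrableOn_exp_neg_mul {a : ℝ} (ha : 0 < a) :
    IntegrableOn (fun t : ℝ => Real.exp (-(t * a))) (Set.Ioi 0) := by
  simpa [mul_comm] using integrableOn_rpow_mul_exp_neg one_pos ha

lemma integral_exp_neg_mul {a : ℝ} (ha : 0 < a) :
    ∫ t in Set.Ioi (0 : ℝ), Real.exp (-(t * a)) = a⁻¹ := by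
  have := Real.integral_rpow_mul_exp_neg_mul_Ioi one_pos ha
  simpa [mul_comm a] using this

lemma inv_le_one_add_inv_sq (r : ℝ) : r⁻¹ ≤ 1 + (r ^ 2)⁻¹ := by
  rw [← inv_pow]
  nlinarith [sq_nonneg (r⁻¹ - 1)]

lemma hasSymbol_heatKernel {t : ℝ} (ht : 0 < t) :
    HasSymbol (fun x => (heatKernel t x : ℂ)) (fun p => (Real.exp (-(t * ‖p‖ ^ 2)) : ℂ)) := by
  refine .of_integrable (integrable_heatKernel ht).ofReal
    (isL1AddLinf_of_bound (C := 1) (Continuous.aestronglyMeasurable (by fun_prop)) fun p _ => ?_)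
    fun p => unitaryFourier_heatKernel ht p
  rw [Complex.norm_real, Real.norm_of_nonneg (Real.exp_nonneg _), one_mul]
  have h1 : Real.exp (-(t * ‖p‖ ^ 2)) ≤ 1 := Real.exp_le_one_iff.2 (by
    have : 0 ≤ t * ‖p‖ ^ 2 := by positivity
    linarith)
  have h2 : 0 ≤ (‖p‖ ^ 2)⁻¹ := by positivity
  linarith

lemma unitaryFourier_const_mul (c : ℂ) (f : R3 → ℂ) (p : R3) :
    unitaryFourier (fun x => c * f x) p = c * unitaryFourier f p := by
  simp only [unitaryFourier, ← smul_eq_mul c, smul_comm (Complex.exp _) c]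
  rw [integral_smul, smul_comm]

/-- `-i ∇` of the heat kernel has the symbol `p exp(-t p²)`. -/
lemma hasSymbol_gradHeatKernel {t : ℝ} (ht : 0 < t) (j : Fin 3) :
    HasSymbol (fun x => Complex.I * ((x j * ((2 * t)⁻¹ * heatKernel t x) : ℝ) : ℂ))
      (fun p => ((p j * Real.exp (-(t * ‖p‖ ^ 2)) : ℝ) : ℂ)) := by
  let e : R3 := EuclideanSpace.single j 1
  have he : ∀ x : R3, inner ℝ x e = x j := fun x => by
    simp [e, EuclideanSpace.inner_single_right]
  have hk : (fun x : R3 => Complex.I * ((x j * ((2 * t)⁻¹ * heatKernel t x) : ℝ) : ℂ)) =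
      fun x => -Complex.I * fderiv ℝ (fun x => (heatKernel t x : ℂ)) x e := by
    funext x
    rw [fderiv_heatKernel_apply, he]
    push_cast
    ring
  rw [hk]
  have hd : Differentiable ℝ fun x => (heatKernel t x : ℂ) := fun x =>
    (hasFDerivAt_heatKernel t x).differentiableAt
  refine .of_integrable
    (((integrable_fderiv_heatKernel ht).apply_continuousLinearMap e).const_mul _)
    (isL1AddLinf_of_bound (C := 1 + t⁻¹) (Continuous.aestronglyMeasurable (by fun_prop))
      fun p _ => ?_) fun p => ?_
  · rw [Complex.norm_real, norm_mul, Real.norm_of_nonneg (Real.exp_nonneg _), Real.norm_eq_abs]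
    have h1 : |p j| * Real.exp (-(t * ‖p‖ ^ 2)) ≤ 1 + t⁻¹ := by
      have h3 := Real.add_one_le_exp (t * ‖p‖ ^ 2)
      rw [Real.exp_neg, ← div_eq_mul_inv, div_le_iff₀ (Real.exp_pos _)]
      refine le_trans ?_ (mul_le_mul_of_nonneg_left h3 (by positivity))
      have h4 : (1 + t⁻¹) * (t * ‖p‖ ^ 2 + 1) = t * ‖p‖ ^ 2 + 1 + ‖p‖ ^ 2 + t⁻¹ := by
        field_simp
        ring
      rw [h4]
      have h5 : 0 ≤ t * ‖p‖ ^ 2 := by positivity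
      have h6 : 0 ≤ t⁻¹ := by positivity
      have h7 : |p j| ≤ ‖p‖ := PiLp.norm_apply_le p j
      nlinarith [sq_nonneg (‖p‖ - 1)]
    have h2 : 0 ≤ (‖p‖ ^ 2)⁻¹ := by positivity
    have h3 : 0 ≤ t⁻¹ := by positivity
    nlinarith
  · have h1 := unitaryFourier_fderiv (f := fun x => (heatKernel t x : ℂ))
      (integrable_heatKernel ht).ofReal hd
      (integrable_fderiv_heatKernel ht) e p
    rw [unitaryFourier_const_mul]
    refine (congrArg (-Complex.I * ·) h1).trans ?_
    simp only [unitaryFourier_heatKernel ht, he, smul_eq_mul]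
    push_cast
    linear_combination (-(((2 * Real.pi) ^ (-(3 / 2) : ℝ) : ℝ) : ℂ) * (p j : ℂ) *
      Complex.exp (-(t * (‖p‖ : ℂ) ^ 2))) * Complex.I_sq

/-- The symbol of the Coulomb kernel `1 / (4 π |x|)` is `1 / p²`. -/
lemma hasSymbol_coulomb :
    HasSymbol (fun x => (yukawa 0 x : ℂ)) (fun p => (((‖p‖ ^ 2)⁻¹ : ℝ) : ℂ)) := by
  have hm : Measurable fun z : R3 × ℝ => (heatKernel z.2 z.1 : ℂ) :=
    Complex.measurable_ofReal.comp measurable_heatKernel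
  have hnorm : ∀ x : R3, ∫ t in Set.Ioi (0 : ℝ), ‖(heatKernel t x : ℂ)‖ =
      ∫ t in Set.Ioi (0 : ℝ), heatKernel t x := fun x =>
    setIntegral_congr_fun measurableSet_Ioi fun t ht => by
      simp only [Complex.norm_real, Real.norm_of_nonneg (heatKernel_nonneg ht x)]
  have key := HasSymbol.superposition (h := fun t x => (heatKernel t x : ℂ))
    (σ := fun t p => (Real.exp (-(t * ‖p‖ ^ 2)) : ℂ)) (C := 1) hm.aestronglyMeasurable
    (Continuous.aestronglyMeasurable (by fun_prop))
    (fun x hx => (integrableOn_heatKernel hx).ofReal)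
    (fun p hp => (integrableOn_exp_neg_mul (by positivity)).ofReal) (fun x hx => ?_)
    (fun p hp => ?_) (fun t ht => hasSymbol_heatKernel ht)
  · refine (key.congr_kernel ?_).congr_symbol ?_
    · filter_upwards [ae_ne_zero] with x hx
      rw [integral_complex_ofReal, integral_heatKernel hx]
      simp [yukawa]
    · filter_upwards [ae_ne_zero] with p hp
      rw [integral_complex_ofReal, integral_exp_neg_mul (by positivity)]
  · rw [hnorm, integral_heatKernel hx, one_mul, mul_inv]
    have hr : 0 < ‖x‖ := norm_pos_iff.2 hx
    have h1 : (4 * Real.pi)⁻¹ ≤ 1 := inv_le_one_of_one_le₀ (by linarith [Real.pi_gt_three])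
    refine le_trans ?_ (inv_le_one_add_inv_sq _)
    exact mul_le_of_le_one_left (by positivity) h1
  · simp only [Complex.norm_real, Real.norm_of_nonneg (Real.exp_nonneg _)]
    have hr : 0 < ‖p‖ := norm_pos_iff.2 hp
    rw [integral_exp_neg_mul (by positivity)]
    linarith

/-- The symbol of `i x_j / (4 π |x|³)` is `p_j / p²`. -/
lemma hasSymbol_gradCoulomb (j : Fin 3) :
    HasSymbol (fun x => Complex.I * ((x j * (4 * Real.pi * ‖x‖ ^ 3)⁻¹ : ℝ) : ℂ))
      (fun p => ((p j * (‖p‖ ^ 2)⁻¹ : ℝ) : ℂ)) := by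
  have hm : Measurable fun z : R3 × ℝ =>
      Complex.I * ((z.1 j * ((2 * z.2)⁻¹ * heatKernel z.2 z.1) : ℝ) : ℂ) := by
    have := measurable_heatKernel
    fun_prop
  have hnorm : ∀ x : R3, ∫ t in Set.Ioi (0 : ℝ),
      ‖Complex.I * ((x j * ((2 * t)⁻¹ * heatKernel t x) : ℝ) : ℂ)‖ =
      |x j| * ∫ t in Set.Ioi (0 : ℝ), (2 * t)⁻¹ * heatKernel t x := fun x => by
    rw [← integral_const_mul]
    refine setIntegral_congr_fun measurableSet_Ioi fun t ht => ?_
    have h0 : 0 ≤ (2 * t)⁻¹ * heatKernel t x :=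
      mul_nonneg (inv_nonneg.2 (mul_nonneg zero_le_two (le_of_lt ht))) (heatKernel_nonneg ht x)
    simp only [norm_mul (Complex.I), Complex.norm_I, one_mul, Complex.norm_real]
    rw [norm_mul, Real.norm_of_nonneg h0, Real.norm_eq_abs]
  have key := HasSymbol.superposition
    (h := fun t x => Complex.I * ((x j * ((2 * t)⁻¹ * heatKernel t x) : ℝ) : ℂ))
    (σ := fun t p => ((p j * Real.exp (-(t * ‖p‖ ^ 2)) : ℝ) : ℂ)) (C := 1) hm.aestronglyMeasurable
    (Continuous.aestronglyMeasurable (by fun_prop))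
    (fun x hx => (((integrableOn_div_mul_heatKernel hx).const_mul _).ofReal).const_mul _)
    (fun p hp => ((integrableOn_exp_neg_mul (by positivity)).const_mul _).ofReal) (fun x hx => ?_)
    (fun p hp => ?_) (fun t ht => hasSymbol_gradHeatKernel ht j)
  · refine (key.congr_kernel ?_).congr_symbol ?_
    · filter_upwards [ae_ne_zero] with x hx
      rw [integral_const_mul, integral_complex_ofReal, integral_const_mul,
        integral_div_mul_heatKernel hx]
    · filter_upwards [ae_ne_zero] with p hp
      rw [integral_complex_ofReal, integral_const_mul, integral_exp_neg_mul (by positivity)]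
  · rw [hnorm, integral_div_mul_heatKernel hx, one_mul]
    have hr : 0 < ‖x‖ := norm_pos_iff.2 hx
    have h1 : (4 * Real.pi)⁻¹ ≤ 1 := inv_le_one_of_one_le₀ (by linarith [Real.pi_gt_three])
    calc |x j| * (4 * Real.pi * ‖x‖ ^ 3)⁻¹ ≤ ‖x‖ * (4 * Real.pi * ‖x‖ ^ 3)⁻¹ := by
          gcongr
          exact PiLp.norm_apply_le x j
      _ = (4 * Real.pi)⁻¹ * (‖x‖ ^ 2)⁻¹ := by
          field_simp
      _ ≤ 1 * (‖x‖ ^ 2)⁻¹ := by gcongr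
      _ ≤ _ := by linarith
  · have hr : 0 < ‖p‖ := norm_pos_iff.2 hp
    simp only [Complex.norm_real, norm_mul, Real.norm_of_nonneg (Real.exp_nonneg _)]
    rw [integral_const_mul, integral_exp_neg_mul (by positivity), one_mul]
    refine le_trans ?_ (inv_le_one_add_inv_sq _)
    calc ‖p j‖ * (‖p‖ ^ 2)⁻¹ ≤ ‖p‖ * (‖p‖ ^ 2)⁻¹ := by
          gcongr
          exact PiLp.norm_apply_le p j
      _ = ‖p‖⁻¹ := by field_simp

end Coulomb

/-! ### The Bessel kernel of the inverse relativistic energy -/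

section Bessel

/-- The density in `(-Δ + m²)^(-1/2) = ∫₀^∞ (π s)^(-1/2) exp(-m² s) exp(sΔ) ds`. -/
def besselDensity (m s : ℝ) : ℝ :=
  (Real.sqrt Real.pi)⁻¹ * (s ^ (1 / 2 - 1 : ℝ) * Real.exp (-(m ^ 2 * s)))

lemma besselDensity_nonneg (m : ℝ) {s : ℝ} (hs : 0 < s) : 0 ≤ besselDensity m s := by
  unfold besselDensity
  positivity

lemma integrableOn_besselDensity {m : ℝ} (hm : 0 < m) :
    IntegrableOn (besselDensity m) (Set.Ioi 0) :=
  (integrableOn_rpow_mul_exp_neg (by norm_num) (by positivity)).const_mul _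

lemma besselDensity_mul_heatKernel (m : ℝ) {s : ℝ} (hs : 0 < s) (x : R3) :
    besselDensity m s * heatKernel s x =
      (8 * Real.pi ^ 2)⁻¹ * (Real.exp (-(m ^ 2 * s)) *
        (s ^ (-1 - 1 : ℝ) * Real.exp (-((‖x‖ ^ 2 / 4) / s)))) := by
  have h1 : s ^ (-1 - 1 : ℝ) = s ^ (1 / 2 - 1 : ℝ) * s ^ (-(1 / 2) - 1 : ℝ) := by
    rw [← Real.rpow_add hs]
    norm_num
  have h2 : (8 * Real.pi ^ 2)⁻¹ =
      (Real.sqrt Real.pi)⁻¹ * (8 * Real.pi * Real.sqrt Real.pi)⁻¹ := by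
    rw [← mul_inv]
    congr 1
    linear_combination (-8 * Real.pi) * Real.sq_sqrt Real.pi_pos.le
  rw [besselDensity, heatKernel_eq_rpow hs, h1, h2]
  ring

lemma rpow_neg_one_sub_one {s : ℝ} (hs : 0 < s) : s ^ (-1 - 1 : ℝ) = (s ^ 2)⁻¹ := by
  rw [show (-1 - 1 : ℝ) = -(2 : ℝ) by norm_num, Real.rpow_neg hs.le, Real.rpow_two]

/-- The kernel of `(-Δ + m²)^(-1/2)` is a superposition of heat kernels. -/
lemma besselKernel_eq {m : ℝ} (hm : 0 < m) {x : R3} (hx : x ≠ 0) :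
    besselKernel m x = ∫ s in Set.Ioi 0, besselDensity m s * heatKernel s x := by
  have hr : 0 < ‖x‖ := norm_pos_iff.2 hx
  have h1 : ∫ t in Set.Ioi (0 : ℝ), Real.exp (-t - (m * ‖x‖) ^ 2 / (4 * t)) / t ^ 2 =
      (m ^ 2)⁻¹ * ∫ s in Set.Ioi (0 : ℝ), Real.exp (-(m ^ 2 * s)) *
        (s ^ (-1 - 1 : ℝ) * Real.exp (-((‖x‖ ^ 2 / 4) / s))) := by
    -- the substitution `t = m² s`
    have h2 := integral_comp_mul_left_Ioi
      (fun t => Real.exp (-t - (m * ‖x‖) ^ 2 / (4 * t)) / t ^ 2) 0 (pow_pos hm 2)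
    rw [mul_zero, smul_eq_mul] at h2
    have h3 : (∫ t in Set.Ioi (0 : ℝ), Real.exp (-t - (m * ‖x‖) ^ 2 / (4 * t)) / t ^ 2) =
        m ^ 2 * ∫ s in Set.Ioi (0 : ℝ),
          Real.exp (-(m ^ 2 * s) - (m * ‖x‖) ^ 2 / (4 * (m ^ 2 * s))) / (m ^ 2 * s) ^ 2 := by
      rw [h2, ← mul_assoc, mul_inv_cancel₀ (by positivity), one_mul]
    rw [h3, ← integral_const_mul, ← integral_const_mul]
    refine setIntegral_congr_fun measurableSet_Ioi fun s hs => ?_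
    have hs' : 0 < s := hs
    rw [rpow_neg_one_sub_one hs', mul_left_comm (Real.exp _), ← Real.exp_add,
      show -(m ^ 2 * s) - (m * ‖x‖) ^ 2 / (4 * (m ^ 2 * s)) =
        -(m ^ 2 * s) + -((‖x‖ ^ 2 / 4) / s) by field_simp; ring_nf]
    field_simp
  rw [setIntegral_congr_fun measurableSet_Ioi fun s hs => besselDensity_mul_heatKernel m hs x,
    integral_const_mul, besselKernel, besselK1, h1]
  field_simp
  ring_nf

/-- The heat kernel has mass one: its Fourier transform at `p = 0`. -/
lemma integral_heatKernel_space {t : ℝ} (ht : 0 < t) : ∫ x, heatKernel t x = 1 := by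
  have h := unitaryFourier_heatKernel ht 0
  have hc : (((2 * Real.pi) ^ (-(3 / 2) : ℝ) : ℝ) : ℂ) ≠ 0 := by
    exact_mod_cast (Real.rpow_pos_of_pos (by positivity) _).ne'
  simp only [unitaryFourier, inner_zero_left, norm_zero, Complex.ofReal_zero, mul_zero, neg_zero,
    Complex.exp_zero, one_mul, ne_eq, OfNat.ofNat_ne_zero, not_false_eq_true, zero_pow,
    Real.exp_zero, Complex.ofReal_one, smul_eq_mul] at h
  have h' := mul_left_cancel₀ hc h
  rw [integral_complex_ofReal] at h'
  exact_mod_cast h'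

lemma integrable_besselDensity_mul_heatKernel {m : ℝ} (hm : 0 < m) :
    Integrable (fun z : R3 × ℝ => besselDensity m z.2 * heatKernel z.2 z.1)
      ((volume : Measure R3).prod (volume.restrict (Set.Ioi 0))) := by
  have hmeas : Measurable fun z : R3 × ℝ => besselDensity m z.2 * heatKernel z.2 z.1 := by
    have := measurable_heatKernel
    unfold besselDensity
    fun_prop
  rw [integrable_prod_iff' hmeas.aestronglyMeasurable]
  constructor
  · filter_upwards [ae_restrict_mem measurableSet_Ioi] with s hs
    exact (integrable_heatKernel hs).const_mul _
  · refine (integrableOn_besselDensity hm).congr_fun (fun s hs => ?_) measurableSet_Ioi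
    have h1 : ∀ x : R3, ‖besselDensity m s * heatKernel s x‖ =
        besselDensity m s * heatKernel s x := fun x =>
      Real.norm_of_nonneg (mul_nonneg (besselDensity_nonneg m hs) (heatKernel_nonneg hs x))
    simp only [h1]
    rw [integral_const_mul, integral_heatKernel_space hs, mul_one]

lemma besselKernel_ae_eq {m : ℝ} (hm : 0 < m) :
    besselKernel m =ᵐ[volume] fun x => ∫ s in Set.Ioi 0, besselDensity m s * heatKernel s x := by
  filter_upwards [ae_ne_zero] with x hx using besselKernel_eq hm hx

lemma integrable_besselKernel {m : ℝ} (hm : 0 < m) : Integrable (besselKernel m) :=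
  (integrable_besselDensity_mul_heatKernel hm).integral_prod_left.congr (besselKernel_ae_eq hm).symm

lemma besselKernel_nonneg {m : ℝ} (hm : 0 < m) {x : R3} (hx : x ≠ 0) : 0 ≤ besselKernel m x := by
  rw [besselKernel_eq hm hx]
  exact setIntegral_nonneg measurableSet_Ioi fun s hs =>
    mul_nonneg (besselDensity_nonneg m hs) (heatKernel_nonneg hs x)

/-- The bound comes from dropping the factor `exp(-m² s)`. -/
lemma besselKernel_le {m : ℝ} (hm : 0 < m) {x : R3} (hx : x ≠ 0) :
    besselKernel m x ≤ (‖x‖ ^ 2)⁻¹ := by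
  have hr : 0 < ‖x‖ := norm_pos_iff.2 hx
  have hint := integrableOn_rpow_mul_exp_neg_inv (s := 1) (a := ‖x‖ ^ 2 / 4) one_pos (by positivity)
  calc besselKernel m x ≤ ∫ s in Set.Ioi (0 : ℝ), (8 * Real.pi ^ 2)⁻¹ *
        (s ^ (-1 - 1 : ℝ) * Real.exp (-((‖x‖ ^ 2 / 4) / s))) := by
        rw [besselKernel_eq hm hx]
        refine integral_mono_of_nonneg ?_ (hint.const_mul _) ?_
        · filter_upwards [ae_restrict_mem measurableSet_Ioi] with s hs
          exact mul_nonneg (besselDensity_nonneg m hs) (heatKernel_nonneg hs x)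
        · filter_upwards [ae_restrict_mem measurableSet_Ioi] with s hs
          have hs' : 0 < s := hs
          rw [besselDensity_mul_heatKernel m hs]
          refine mul_le_mul_of_nonneg_left (mul_le_of_le_one_left (by positivity) ?_)
            (by positivity)
          exact Real.exp_le_one_iff.2 (neg_nonpos.2 (by positivity))
    _ = (2 * Real.pi ^ 2)⁻¹ * (‖x‖ ^ 2)⁻¹ := by
        rw [integral_const_mul, integral_rpow_mul_exp_neg_inv one_pos (by positivity),
          Real.Gamma_one, Real.rpow_one]
        field_simp
        norm_num
    _ ≤ _ := by
        refine mul_le_of_le_one_left (by positivity) (inv_le_one_of_one_le₀ ?_)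
        nlinarith [Real.pi_gt_three]

/-- The Fourier transform of the Bessel kernel is `(p² + m²)^(-1/2)`. -/
lemma unitaryFourier_besselKernel {m : ℝ} (hm : 0 < m) (p : R3) :
    unitaryFourier (fun x => (besselKernel m x : ℂ)) p =
      (((2 * Real.pi) ^ (-(3 / 2) : ℝ) : ℝ) : ℂ) *
        (((Real.sqrt (‖p‖ ^ 2 + m ^ 2))⁻¹ : ℝ) : ℂ) := by
  have hpos : 0 < ‖p‖ ^ 2 + m ^ 2 := by positivity
  have hint : Integrable (fun z : R3 × ℝ =>
      Complex.exp (-(Complex.I * ((inner ℝ p z.1 : ℝ) : ℂ))) •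
        ((besselDensity m z.2 * heatKernel z.2 z.1 : ℝ) : ℂ))
      ((volume : Measure R3).prod (volume.restrict (Set.Ioi 0))) := by
    have h0 := (integrable_besselDensity_mul_heatKernel hm).ofReal (𝕜 := ℂ)
    refine h0.bdd_smul 1
      (φ := fun z : R3 × ℝ => Complex.exp (-(Complex.I * ((inner ℝ p z.1 : ℝ) : ℂ))))
      (Continuous.aestronglyMeasurable (by fun_prop)) (.of_forall fun z => ?_)
    rw [norm_exp_I_inner]
  have h1 : ∫ x : R3, Complex.exp (-(Complex.I * ((inner ℝ p x : ℝ) : ℂ))) •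
        (besselKernel m x : ℂ) =
      ∫ x : R3, ∫ s in Set.Ioi (0 : ℝ), Complex.exp (-(Complex.I * ((inner ℝ p x : ℝ) : ℂ))) •
        ((besselDensity m s * heatKernel s x : ℝ) : ℂ) := by
    refine integral_congr_ae ?_
    filter_upwards [besselKernel_ae_eq hm] with x hx
    rw [hx, integral_smul, integral_complex_ofReal]
  have h2 : ∀ s ∈ Set.Ioi (0 : ℝ), (((2 * Real.pi) ^ (-(3 / 2) : ℝ) : ℝ) : ℂ) •
      ∫ x : R3, Complex.exp (-(Complex.I * ((inner ℝ p x : ℝ) : ℂ))) •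
        ((besselDensity m s * heatKernel s x : ℝ) : ℂ) =
      (((2 * Real.pi) ^ (-(3 / 2) : ℝ) : ℝ) : ℂ) *
        ((besselDensity m s * Real.exp (-(s * ‖p‖ ^ 2)) : ℝ) : ℂ) := fun s hs => by
    have := unitaryFourier_const_mul (besselDensity m s) (fun x => (heatKernel s x : ℂ)) p
    rw [unitaryFourier_heatKernel hs] at this
    simp only [Complex.ofReal_mul]
    refine this.trans ?_
    ring
  have h3 : ∀ s : ℝ, besselDensity m s * Real.exp (-(s * ‖p‖ ^ 2)) = (Real.sqrt Real.pi)⁻¹ *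
      (s ^ (1 / 2 - 1 : ℝ) * Real.exp (-((‖p‖ ^ 2 + m ^ 2) * s))) := fun s => by
    rw [show -((‖p‖ ^ 2 + m ^ 2) * s) = -(m ^ 2 * s) + -(s * ‖p‖ ^ 2) by ring, Real.exp_add,
      besselDensity]
    ring
  rw [unitaryFourier, h1, integral_integral_swap hint, ← integral_smul,
    setIntegral_congr_fun measurableSet_Ioi h2, integral_const_mul, integral_complex_ofReal]
  simp only [h3]
  rw [integral_const_mul, Real.integral_rpow_mul_exp_neg_mul_Ioi (by norm_num) hpos,
    Real.Gamma_one_half_eq, ← Real.sqrt_eq_rpow, one_div, Real.sqrt_inv]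
  congr 2
  field_simp

end Bessel

/-! ### Yukawa kernels -/

section Yukawa

lemma yukawa_nonneg (ν : ℝ) (x : R3) : 0 ≤ yukawa ν x := by
  unfold yukawa
  positivity

lemma yukawa_zero_apply (x : R3) : yukawa 0 x = (4 * Real.pi * ‖x‖)⁻¹ := by
  simp [yukawa]

lemma yukawa_le {ν : ℝ} (hν : 0 ≤ ν) (x : R3) : yukawa ν x ≤ yukawa 0 x := by
  unfold yukawa
  gcongr

lemma yukawa_zero_le (x : R3) : yukawa 0 x ≤ ‖x‖⁻¹ := by
  rw [yukawa_zero_apply, mul_inv]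
  exact mul_le_of_le_one_left (by positivity)
    (inv_le_one_of_one_le₀ (by linarith [Real.pi_gt_three]))

lemma measurable_yukawa (ν : ℝ) : Measurable (yukawa ν) := by
  unfold yukawa
  fun_prop

lemma continuous_yukawa_left (x : R3) : Continuous fun ν => yukawa ν x := by
  unfold yukawa
  fun_prop

lemma integrableOn_ball_yukawa : IntegrableOn (yukawa 0) (Metric.ball 0 1) := by
  refine (integrableOn_ball_inv_norm_sq 1).mono' (measurable_yukawa 0).aestronglyMeasurable ?_
  filter_upwards [ae_restrict_mem Metric.isOpen_ball.measurableSet] with x hx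
  rw [Real.norm_of_nonneg (yukawa_nonneg 0 x)]
  refine (yukawa_zero_le x).trans ?_
  have hx1 : ‖x‖ < 1 := by simpa using hx
  rcases eq_or_ne x 0 with rfl | h0
  · simp
  · have hr : 0 < ‖x‖ := norm_pos_iff.2 h0
    refine inv_anti₀ (by positivity) ?_
    nlinarith

/-- The convolution of the Bessel and the Coulomb kernels converges away from the origin: the two
singularities are at different points, and the Coulomb kernel is bounded at infinity. -/
lemma integrable_besselKernel_mul_yukawa {m : ℝ} (hm : 0 < m) {x : R3} (hx : x ≠ 0) :
    Integrable fun z => besselKernel m z * yukawa 0 (x - z) := by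
  have hr : 0 < ‖x‖ := norm_pos_iff.2 hx
  have hB := integrable_besselKernel hm
  have hY : Integrable fun z => (Metric.ball 0 1).indicator (yukawa 0) (x - z) :=
    ((integrable_indicator_iff Metric.isOpen_ball.measurableSet).2
      integrableOn_ball_yukawa).comp_sub_left x
  refine ((hY.const_mul ((‖x‖ / 2) ^ 2)⁻¹).add (hB.const_mul (1 + (‖x‖ / 2)⁻¹))).mono'
    (hB.1.mul ((measurable_yukawa 0).comp (by fun_prop)).aestronglyMeasurable) ?_
  filter_upwards [ae_ne_zero] with z hz
  have hBz := besselKernel_nonneg hm hz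
  have hYz := yukawa_nonneg 0 (x - z)
  have hYi : 0 ≤ (Metric.ball 0 1).indicator (yukawa 0) (x - z) :=
    Set.indicator_nonneg (fun y _ => yukawa_nonneg 0 y) _
  rw [Real.norm_of_nonneg (mul_nonneg hBz hYz)]
  simp only [Pi.add_apply]
  have h0 : 0 ≤ (‖x‖ / 2)⁻¹ * besselKernel m z := by positivity
  have h1 : 0 ≤ ((‖x‖ / 2) ^ 2)⁻¹ * (Metric.ball 0 1).indicator (yukawa 0) (x - z) := by positivity
  rcases lt_or_ge ‖z‖ (‖x‖ / 2) with h | h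
  · have h2 : ‖x‖ / 2 ≤ ‖x - z‖ := by
      have := norm_sub_norm_le x z
      linarith
    have h3 : yukawa 0 (x - z) ≤ (‖x‖ / 2)⁻¹ :=
      (yukawa_zero_le _).trans (inv_anti₀ (by positivity) h2)
    nlinarith
  · rcases lt_or_ge ‖x - z‖ 1 with h' | h'
    · have h2 : besselKernel m z ≤ ((‖x‖ / 2) ^ 2)⁻¹ :=
        (besselKernel_le hm hz).trans (inv_anti₀ (by positivity) (by gcongr))
      rw [Set.indicator_of_mem (by simpa using h')]
      nlinarith
    · have h2 : yukawa 0 (x - z) ≤ 1 := (yukawa_zero_le _).trans (inv_le_one_of_one_le₀ h')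
      nlinarith

end Yukawa

/-! ### Scalar operators -/

section Scalar

lemma HasSymbol.smul_const {A : Type*} [NormedAddCommGroup A] [NormedSpace ℂ A] [CompleteSpace A]
    {k s : R3 → ℂ} (h : HasSymbol k s) (a : A) :
    HasSymbol (fun x => k x • a) (fun p => s p • a) :=
  h.clm_comp (ContinuousLinearMap.toSpanSingleton ℂ a)

lemma HasSymbol.mulOp {k s : R3 → ℂ} (h : HasSymbol k s) :
    HasSymbol (fun x => mulOp (k x)) (fun p => mulOp (s p)) :=
  h.smul_const _

lemma mulOp_apply (c z : ℂ) : mulOp c z = c * z := rfl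

lemma norm_mulOp (c : ℂ) : ‖mulOp c‖ = ‖c‖ := by
  simp [mulOp, norm_smul]

lemma continuous_mulOp : Continuous mulOp := by
  unfold mulOp
  fun_prop

/-- If `W² = V` and `‖W‖² ≤ ‖v‖` with `v ∈ L¹ ∩ L^∞`, then `W ∈ L² ∩ L^∞`. -/
lemma IsPotentialRoot.of_norm_sq_le {F G : Type*} [NormedAddCommGroup F] [NormedSpace ℂ F]
    [NormedAddCommGroup G] {V W : R3 → F →L[ℂ] F} {v : R3 → G} (hW : AEStronglyMeasurable W)
    (h1 : MemLp v 1) (htop : MemLp v ⊤) (hle : ∀ᵐ x, ‖W x‖ ^ 2 ≤ ‖v x‖)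
    (hsq : ∀ᵐ x, ∀ u, V x u = W x (W x u)) : IsPotentialRoot V W := by
  refine ⟨?_, ?_, hsq⟩
  · rw [← memLp_norm_iff hW, memLp_two_iff_integrable_sq hW.norm]
    refine (memLp_one_iff_integrable.1 h1).norm.mono' (hW.norm.pow 2) ?_
    filter_upwards [hle] with x hx
    rwa [Real.norm_of_nonneg (by positivity)]
  · refine ((memLp_top_const (1 : ℝ)).add htop.norm).mono' hW ?_
    filter_upwards [hle] with x hx
    simp only [Pi.add_apply]
    nlinarith [sq_nonneg (‖W x‖ - 1)]

lemma isPotentialRoot_mulOp {V : R3 → ℝ} (h0 : ∀ᵐ x, 0 ≤ V x) (h1 : MemLp V 1)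
    (htop : MemLp V ⊤) :
    IsPotentialRoot (fun x => mulOp (V x : ℂ)) (fun x => mulOp (Real.sqrt (V x) : ℂ)) := by
  refine .of_norm_sq_le ((continuous_mulOp.comp (Complex.continuous_ofReal.comp
    Real.continuous_sqrt)).comp_aestronglyMeasurable h1.1) h1 htop ?_ ?_
  · filter_upwards [h0] with x hx
    rw [norm_mulOp, Complex.norm_real, Real.norm_of_nonneg (Real.sqrt_nonneg _), Real.sq_sqrt hx]
    exact le_abs_self _
  · filter_upwards [h0] with x hx v
    rw [mulOp_apply, mulOp_apply, mulOp_apply, ← mul_assoc, ← Complex.ofReal_mul,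
      Real.mul_self_sqrt hx]

lemma hasTemperateGrowth_mulOp {f : R3 → ℝ} (hf : f.HasTemperateGrowth) :
    Function.HasTemperateGrowth fun p => mulOp (f p : ℂ) := by
  have h := (ContinuousLinearMap.hasTemperateGrowth
    ((ContinuousLinearMap.toSpanSingleton ℂ (ContinuousLinearMap.id ℂ ℂ)).restrictScalars ℝ ∘L
      Complex.ofRealCLM)).comp hf
  exact h

lemma le_inv_sq_of_one_le {a b r : ℝ} (hr : 1 ≤ r) (hb : 0 ≤ b) :
    (a * r + b) * (r ^ 2)⁻¹ ≤ (a + b) * (r ^ 1)⁻¹ := by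
  have h0 : 0 < r := by linarith
  rw [← div_eq_mul_inv, ← div_eq_mul_inv, div_le_div_iff₀ (by positivity) (by positivity)]
  nlinarith [mul_nonneg hb (mul_nonneg h0.le (sub_nonneg.2 hr))]

end Scalar

/-! ### The Schrödinger operator -/

section Schroedinger

/-- The symbol of the resolvent of `-Δ`. -/
def resolventS (E : ℝ) (p : R3) : ℂ →L[ℂ] ℂ := mulOp (((‖p‖ ^ 2 - E)⁻¹ : ℝ) : ℂ)

lemma isResolventSymbol_symbolS : IsResolventSymbol symbolS resolventS (Set.Iio 0) 0 2 := by
  have hE : ∀ E ∈ insert (0 : ℝ) (Set.Iio 0), E ≤ 0 := fun E hE => by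
    rcases hE with rfl | h
    · exact le_rfl
    · exact le_of_lt h
  have hpos : ∀ E ∈ insert (0 : ℝ) (Set.Iio 0), ∀ p : R3, p ≠ 0 → 0 < ‖p‖ ^ 2 - E :=
    fun E h p hp => by
      have := hE E h
      have : 0 < ‖p‖ := norm_pos_iff.2 hp
      nlinarith
  have hle : ∀ E ∈ insert (0 : ℝ) (Set.Iio 0), ∀ p : R3, p ≠ 0 →
      ‖resolventS E p‖ ≤ 1 * (‖p‖ ^ 2)⁻¹ := fun E h p hp => by
    have : 0 < ‖p‖ := norm_pos_iff.2 hp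
    rw [resolventS, norm_mulOp, Complex.norm_real,
      Real.norm_of_nonneg (inv_nonneg.2 (hpos E h p hp).le), one_mul]
    exact inv_anti₀ (by positivity) (by linarith [hE E h])
  refine ⟨hasTemperateGrowth_mulOp (by fun_prop), fun E => ?_, fun E h p hp v => ?_,
    fun E h p hp v => ?_, ⟨1, fun E h p hp => ⟨fun _ => hle E h p hp, fun _ => hle E h p hp⟩⟩,
    fun p hp => ?_⟩
  · exact (continuous_mulOp.measurable.comp (by fun_prop)).aestronglyMeasurable
  · have h1 : (((‖p‖ ^ 2 - E : ℝ)) : ℂ) ≠ 0 := by exact_mod_cast (hpos E h p hp).ne'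
    simp only [resolventS, symbolS, mulOp_apply, smul_eq_mul, ← sub_mul, ← Complex.ofReal_sub]
    rw [Complex.ofReal_inv, inv_mul_cancel_left₀ h1]
  · have h1 : (((‖p‖ ^ 2 - E : ℝ)) : ℂ) ≠ 0 := by exact_mod_cast (hpos E h p hp).ne'
    simp only [resolventS, symbolS, mulOp_apply, smul_eq_mul, ← sub_mul, ← Complex.ofReal_sub]
    rw [Complex.ofReal_inv, mul_inv_cancel_left₀ h1]
  · have h1 : ‖p‖ ^ 2 - 0 ≠ 0 := (hpos 0 (Set.mem_insert _ _) p hp).ne'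
    exact continuous_mulOp.continuousAt.comp (Complex.continuous_ofReal.continuousAt.comp
      (ContinuousAt.inv₀ (by fun_prop) h1))

/-- The Schrödinger case, with the weight exponent `k = 2`. -/
theorem thresholdConclusion_schroedinger {V : R3 → ℝ} (h0 : ∀ᵐ x, 0 ≤ V x) (h1 : MemLp V 1)
    (htop : MemLp V ⊤) {lamc : ℝ} {E : ℝ → ℝ} {lam : ℕ → ℝ} {φ : ℕ → R3 → ℂ} {μ₀ : R3 → ℂ}
    (h : IsThresholdSequence symbolS (fun x => mulOp (V x : ℂ))
      (fun x => mulOp (Real.sqrt (V x) : ℂ)) (Set.Iio 0) 0 (𝓝[>] lamc) E lam φ μ₀) :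
    ThresholdConclusion symbolS (fun x => mulOp (V x : ℂ))
      (fun x => mulOp (Real.sqrt (V x) : ℂ)) kernelS (𝓝[<] 0) 0 lamc φ μ₀
      {ω | ∃ w : R3 → ℂ, (ω = fun p => mulOp (w p)) ∧ IsWeight 2 ω} := by
  refine thresholdConclusion_of_symbol (K := fun x => mulOp (yukawa 0 x))
    isResolventSymbol_symbolS (isPotentialRoot_mulOp h0 h1 htop) nhdsWithin_le_nhds
    (fun x _ => ?_) ?_ h fun w ⟨_, _, hw⟩ => hw
  · have hc : Continuous fun E => kernelS E x :=
      continuous_mulOp.comp (Complex.continuous_ofReal.comp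
        ((continuous_yukawa_left x).comp (Real.continuous_sqrt.comp continuous_abs)))
    have := hc.tendsto 0
    simp only [kernelS, abs_zero, Real.sqrt_zero] at this
    exact this.mono_left nhdsWithin_le_nhds
  · have hR : resolventS 0 = fun p => mulOp (((‖p‖ ^ 2)⁻¹ : ℝ) : ℂ) := by
      funext p
      rw [resolventS, sub_zero]
    rw [hR]
    exact hasSymbol_coulomb.mulOp

end Schroedinger

/-! ### The pseudorelativistic operator -/

section Relativistic

lemma nu_zero (m : ℝ) : nu m 0 = 0 := by simp [nu]

lemma continuous_nu (m : ℝ) : Continuous (nu m) := by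
  unfold nu
  fun_prop

/-- The symbol of the resolvent of `√(-Δ + m²) - m`. -/
def resolventRel (m E : ℝ) (p : R3) : ℂ →L[ℂ] ℂ :=
  mulOp (((Real.sqrt (‖p‖ ^ 2 + m ^ 2) - m - E)⁻¹ : ℝ) : ℂ)

/-- `√(p² + m²) = m √(1 + |p/m|²)`. -/
lemma hasTemperateGrowth_sqrt {m : ℝ} (hm : 0 < m) :
    Function.HasTemperateGrowth fun p : R3 => Real.sqrt (‖p‖ ^ 2 + m ^ 2) := by
  have h1 := (Function.hasTemperateGrowth_one_add_norm_sq_rpow R3 (1 / 2)).comp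
    (ContinuousLinearMap.hasTemperateGrowth (m⁻¹ • ContinuousLinearMap.id ℝ R3))
  have h2 : (fun p : R3 => Real.sqrt (‖p‖ ^ 2 + m ^ 2)) =
      fun p => m * ((fun x : R3 => (1 + ‖x‖ ^ 2) ^ (1 / 2 : ℝ)) ∘
        (m⁻¹ • ContinuousLinearMap.id ℝ R3)) p := by
    funext p
    simp only [Function.comp_apply, smul_apply, ContinuousLinearMap.id_apply, norm_smul]
    rw [← Real.sqrt_eq_rpow, Real.norm_of_nonneg (by positivity)]
    nth_rewrite 2 [← Real.sqrt_sq hm.le]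
    rw [← Real.sqrt_mul (by positivity)]
    congr 1
    field_simp
    ring_nf
  rw [h2]
  exact (Function.HasTemperateGrowth.const m).mul h1

lemma lt_sqrt_norm_sq_add {m : ℝ} {p : R3} (hp : p ≠ 0) :
    m < Real.sqrt (‖p‖ ^ 2 + m ^ 2) := by
  have : 0 < ‖p‖ := norm_pos_iff.2 hp
  exact Real.lt_sqrt_of_sq_lt (by nlinarith)

lemma inv_sqrt_sub {m : ℝ} {p : R3} (hp : p ≠ 0) :
    (Real.sqrt (‖p‖ ^ 2 + m ^ 2) - m)⁻¹ =
      (Real.sqrt (‖p‖ ^ 2 + m ^ 2) + m) * (‖p‖ ^ 2)⁻¹ := by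
  have h1 := lt_sqrt_norm_sq_add (m := m) hp
  have h2 := Real.sq_sqrt (show 0 ≤ ‖p‖ ^ 2 + m ^ 2 by positivity)
  have h3 : 0 < ‖p‖ := norm_pos_iff.2 hp
  refine inv_eq_of_mul_eq_one_right ?_
  field_simp
  linear_combination h2

lemma isResolventSymbol_symbolRel {m : ℝ} (hm : 0 < m) :
    IsResolventSymbol (symbolRel m) (resolventRel m) (Set.Iio 0) 0 1 := by
  have hE : ∀ E ∈ insert (0 : ℝ) (Set.Iio 0), E ≤ 0 := fun E hE => by
    rcases hE with rfl | h
    · exact le_rfl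
    · exact le_of_lt h
  have hpos : ∀ E ∈ insert (0 : ℝ) (Set.Iio 0), ∀ p : R3, p ≠ 0 →
      0 < Real.sqrt (‖p‖ ^ 2 + m ^ 2) - m - E := fun E h p hp => by
    have := lt_sqrt_norm_sq_add (m := m) hp
    linarith [hE E h]
  have hle : ∀ E ∈ insert (0 : ℝ) (Set.Iio 0), ∀ p : R3, p ≠ 0 →
      ‖resolventRel m E p‖ ≤ (‖p‖ + 2 * m) * (‖p‖ ^ 2)⁻¹ := fun E h p hp => by
    have h1 := lt_sqrt_norm_sq_add (m := m) hp
    have h2 : Real.sqrt (‖p‖ ^ 2 + m ^ 2) ≤ ‖p‖ + m :=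
      Real.sqrt_le_iff.2 ⟨by positivity, by nlinarith [norm_nonneg p]⟩
    rw [resolventRel, norm_mulOp, Complex.norm_real,
      Real.norm_of_nonneg (inv_nonneg.2 (hpos E h p hp).le)]
    calc (Real.sqrt (‖p‖ ^ 2 + m ^ 2) - m - E)⁻¹ ≤ (Real.sqrt (‖p‖ ^ 2 + m ^ 2) - m)⁻¹ :=
          inv_anti₀ (by linarith) (by linarith [hE E h])
      _ = (Real.sqrt (‖p‖ ^ 2 + m ^ 2) + m) * (‖p‖ ^ 2)⁻¹ := inv_sqrt_sub hp
      _ ≤ _ := by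
          refine mul_le_mul_of_nonneg_right ?_ (by positivity)
          linarith
  refine ⟨hasTemperateGrowth_mulOp ((hasTemperateGrowth_sqrt hm).sub (.const m)), fun E => ?_,
    fun E h p hp v => ?_, fun E h p hp v => ?_,
    ⟨1 + 2 * m, fun E h p hp => ⟨fun h1 => ?_, fun h1 => ?_⟩⟩, fun p hp => ?_⟩
  · exact (continuous_mulOp.measurable.comp (by fun_prop)).aestronglyMeasurable
  · have h1 : ((Real.sqrt (‖p‖ ^ 2 + m ^ 2) - m - E : ℝ) : ℂ) ≠ 0 := by
      exact_mod_cast (hpos E h p hp).ne'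
    simp only [resolventRel, symbolRel, mulOp_apply, smul_eq_mul, ← sub_mul, ← Complex.ofReal_sub]
    rw [Complex.ofReal_inv, inv_mul_cancel_left₀ h1]
  · have h1 : ((Real.sqrt (‖p‖ ^ 2 + m ^ 2) - m - E : ℝ) : ℂ) ≠ 0 := by
      exact_mod_cast (hpos E h p hp).ne'
    simp only [resolventRel, symbolRel, mulOp_apply, smul_eq_mul, ← sub_mul, ← Complex.ofReal_sub]
    rw [Complex.ofReal_inv, mul_inv_cancel_left₀ h1]
  · refine (hle E h p hp).trans ?_
    gcongr
  · refine (hle E h p hp).trans (by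
      simpa only [one_mul] using le_inv_sq_of_one_le (a := 1) (b := 2 * m) h1 (by positivity))
  · have h1 : Real.sqrt (‖p‖ ^ 2 + m ^ 2) - m - 0 ≠ 0 := (hpos 0 (Set.mem_insert _ _) p hp).ne'
    exact continuous_mulOp.continuousAt.comp (Complex.continuous_ofReal.continuousAt.comp
      (ContinuousAt.inv₀ (by fun_prop) h1))

/-- Dominated convergence, since `Y_ν ≤ Y_0` for `ν ≥ 0`. -/
lemma tendsto_integral_besselKernel_mul_yukawa {m : ℝ} (hm : 0 < m) {x : R3} (hx : x ≠ 0)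
    {l : Filter ℝ} [l.IsCountablyGenerated] (hl : l ≤ 𝓝 0) :
    Tendsto (fun E => ∫ z, besselKernel m z * yukawa (nu m E) (x - z)) l
      (𝓝 (∫ z, besselKernel m z * yukawa (nu m 0) (x - z))) := by
  refine tendsto_integral_filter_of_dominated_convergence
    (fun z => besselKernel m z * yukawa 0 (x - z)) (.of_forall fun E => ?_)
    (.of_forall fun E => ?_) (integrable_besselKernel_mul_yukawa hm hx)
    (.of_forall fun z => ?_)
  · exact (integrable_besselKernel hm).1.mul
      ((measurable_yukawa _).comp (by fun_prop)).aestronglyMeasurable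
  · filter_upwards [ae_ne_zero] with z hz
    have h1 := besselKernel_nonneg hm hz
    rw [Real.norm_of_nonneg (mul_nonneg h1 (yukawa_nonneg _ _))]
    exact mul_le_mul_of_nonneg_left (yukawa_le (Real.sqrt_nonneg _) _) h1
  · have : Continuous fun E => besselKernel m z * yukawa (nu m E) (x - z) :=
      continuous_const.mul ((continuous_yukawa_left _).comp (continuous_nu m))
    exact (this.tendsto 0).mono_left hl

/-- The zero energy kernel has the three terms `m / p²`, `(p² + m²)^(-1/2)` and
`m² (p² + m²)^(-1/2) / p²` as symbols, with sum `1 / (√(p² + m²) - m)`. -/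
lemma hasSymbol_kernelRel_zero {m : ℝ} (hm : 0 < m) :
    HasSymbol (kernelRel m 0) (resolventRel m 0) := by
  have hq : ∀ p : R3, 0 < Real.sqrt (‖p‖ ^ 2 + m ^ 2) := fun p => Real.sqrt_pos.2 (by positivity)
  have hqm : ∀ p : R3, (Real.sqrt (‖p‖ ^ 2 + m ^ 2))⁻¹ ≤ m⁻¹ := fun p =>
    inv_anti₀ hm (Real.le_sqrt_of_sq_le (by nlinarith [sq_nonneg ‖p‖]))
  have hm' : 0 < m⁻¹ := inv_pos.2 hm
  have h1 := hasSymbol_coulomb.clm_comp ((m : ℂ) • ContinuousLinearMap.id ℂ ℂ)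
  have h2 : HasSymbol (fun x => (besselKernel m x : ℂ))
      fun p => (((Real.sqrt (‖p‖ ^ 2 + m ^ 2))⁻¹ : ℝ) : ℂ) := by
    refine .of_integrable (integrable_besselKernel hm).ofReal
      (isL1AddLinf_of_bound (C := m⁻¹) (Measurable.aestronglyMeasurable (by fun_prop))
        fun p _ => ?_) fun p => unitaryFourier_besselKernel hm p
    rw [Complex.norm_real, Real.norm_of_nonneg (inv_nonneg.2 (hq p).le)]
    have : 0 ≤ m⁻¹ * (‖p‖ ^ 2)⁻¹ := by positivity
    linarith [hqm p]
  have h3 := (hasSymbol_coulomb.convolution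
    (B := fun z => (besselKernel m z : ℂ)) (integrable_besselKernel hm).ofReal
    (fun p => unitaryFourier_besselKernel hm p) (by
      refine isL1AddLinf_of_bound (C := m⁻¹) (Measurable.aestronglyMeasurable (by fun_prop))
        fun p _ => ?_
      rw [norm_smul, Complex.norm_real, Complex.norm_real,
        Real.norm_of_nonneg (inv_nonneg.2 (hq p).le), Real.norm_of_nonneg (by positivity)]
      have : 0 ≤ (‖p‖ ^ 2)⁻¹ := by positivity
      nlinarith [hqm p])).clm_comp (((m ^ 2 : ℝ) : ℂ) • ContinuousLinearMap.id ℂ ℂ)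
  refine (((h1.add h2).add h3).mulOp.congr_symbol ?_).congr_kernel (.of_forall fun x => ?_)
  · filter_upwards [ae_ne_zero] with p hp
    have hp' : 0 < ‖p‖ := norm_pos_iff.2 hp
    have h4 := Real.sq_sqrt (show 0 ≤ ‖p‖ ^ 2 + m ^ 2 by positivity)
    have h5 := hq p
    simp only [resolventRel, smul_apply, ContinuousLinearMap.id_apply, smul_eq_mul]
    rw [sub_zero, inv_sqrt_sub hp]
    norm_cast
    congr 2
    field_simp
    linear_combination (-1 : ℝ) * h4
  · simp only [kernelRel, nu_zero, smul_apply, ContinuousLinearMap.id_apply, smul_eq_mul, zero_add]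
    congr 1
    push_cast
    rw [← integral_complex_ofReal]
    push_cast
    ring

/-- The pseudorelativistic case, with the weight exponent `k = 1`. -/
theorem thresholdConclusion_relativistic {m : ℝ} (hm : 0 < m) {V : R3 → ℝ}
    (h0 : ∀ᵐ x, 0 ≤ V x) (h1 : MemLp V 1) (htop : MemLp V ⊤) {lamc : ℝ} {E : ℝ → ℝ}
    {lam : ℕ → ℝ} {φ : ℕ → R3 → ℂ} {μ₀ : R3 → ℂ}
    (h : IsThresholdSequence (symbolRel m) (fun x => mulOp (V x : ℂ))
      (fun x => mulOp (Real.sqrt (V x) : ℂ)) (Set.Iio 0) 0 (𝓝[>] lamc) E lam φ μ₀) :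
    ThresholdConclusion (symbolRel m) (fun x => mulOp (V x : ℂ))
      (fun x => mulOp (Real.sqrt (V x) : ℂ)) (kernelRel m) (𝓝[<] 0) 0 lamc φ μ₀
      {ω | ∃ w : R3 → ℂ, (ω = fun p => mulOp (w p)) ∧ IsWeight 1 ω} := by
  refine thresholdConclusion_of_symbol (isResolventSymbol_symbolRel hm)
    (isPotentialRoot_mulOp h0 h1 htop) nhdsWithin_le_nhds (fun x hx => ?_)
    (hasSymbol_kernelRel_zero hm) h fun w ⟨_, _, hw⟩ => hw
  have hν : Tendsto (nu m) (𝓝[<] 0) (𝓝 (nu m 0)) :=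
    ((continuous_nu m).tendsto 0).mono_left nhdsWithin_le_nhds
  have hE : Tendsto (fun E : ℝ => E) (𝓝[<] 0) (𝓝 0) := tendsto_id.mono_left nhdsWithin_le_nhds
  refine (continuous_mulOp.tendsto _).comp ((Complex.continuous_ofReal.tendsto _).comp ?_)
  exact (((hE.add_const m).mul (((continuous_yukawa_left x).tendsto _).comp hν)).add_const _).add
    ((tendsto_const_nhds.sub (hν.pow 2)).mul
      (tendsto_integral_besselKernel_mul_yukawa hm hx nhdsWithin_le_nhds))

end Relativistic

/-! ### The Dirac operator -/

section Dirac

lemma matOp_add (A B : Matrix (Fin 4) (Fin 4) ℂ) : matOp (A + B) = matOp A + matOp B :=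
  map_add _ A B

lemma matOp_smul (c : ℂ) (A : Matrix (Fin 4) (Fin 4) ℂ) : matOp (c • A) = c • matOp A :=
  map_smul _ c A

lemma matOp_sub (A B : Matrix (Fin 4) (Fin 4) ℂ) : matOp (A - B) = matOp A - matOp B :=
  map_sub _ A B

lemma matOp_mul_apply (A B : Matrix (Fin 4) (Fin 4) ℂ) (v : C4) :
    matOp (A * B) v = matOp A (matOp B v) := by
  simp only [matOp, map_mul]
  rfl

lemma matOp_one : matOp 1 = ContinuousLinearMap.id ℂ C4 :=
  map_one _

lemma continuous_matOp : Continuous matOp := by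
  have : matOp = ((Matrix.toEuclideanCLM (n := Fin 4) (𝕜 := ℂ)).toAlgEquiv.toLinearMap :
    Matrix (Fin 4) (Fin 4) ℂ → C4 →L[ℂ] C4) := rfl
  rw [this]
  exact LinearMap.continuous_of_finiteDimensional _

lemma diagOp_apply (d : Fin 4 → ℝ) (v : C4) (i : Fin 4) : diagOp d v i = d i * v i := by
  simp [diagOp, matOp, Matrix.mulVec_diagonal]

lemma norm_diagOp_sq_le (d : Fin 4 → ℝ) {C : ℝ} (hC : ∀ i, d i ^ 2 ≤ C) : ‖diagOp d‖ ^ 2 ≤ C := by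
  have hC0 : 0 ≤ C := (sq_nonneg _).trans (hC 0)
  refine (Real.le_sqrt (norm_nonneg _) hC0).1 ?_
  refine ContinuousLinearMap.opNorm_le_bound _ (Real.sqrt_nonneg _) fun v => ?_
  rw [← Real.sqrt_sq (norm_nonneg v), ← Real.sqrt_mul hC0]
  refine Real.le_sqrt_of_sq_le ?_
  rw [EuclideanSpace.norm_sq_eq, EuclideanSpace.norm_sq_eq, Finset.mul_sum]
  refine Finset.sum_le_sum fun i _ => ?_
  rw [diagOp_apply, norm_mul, mul_pow, Complex.norm_real, Real.norm_eq_abs, sq_abs]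
  exact mul_le_mul_of_nonneg_right (hC i) (by positivity)

lemma isPotentialRoot_diagOp {V : R3 → EuclideanSpace ℝ (Fin 4)} (h0 : ∀ᵐ x, ∀ i, 0 ≤ V x i)
    (h1 : MemLp V 1) (htop : MemLp V ⊤) :
    IsPotentialRoot (fun x => diagOp fun i => V x i)
      (fun x => diagOp fun i => Real.sqrt (V x i)) := by
  have hc : Continuous fun v : EuclideanSpace ℝ (Fin 4) => diagOp fun i => Real.sqrt (v i) :=
    continuous_matOp.comp (Continuous.matrix_diagonal (by fun_prop))
  refine .of_norm_sq_le (hc.comp_aestronglyMeasurable h1.1) h1 htop ?_ ?_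
  · filter_upwards [h0] with x hx
    refine norm_diagOp_sq_le _ fun i => ?_
    rw [Real.sq_sqrt (hx i)]
    exact (le_abs_self _).trans (PiLp.norm_apply_le (V x) i)
  · filter_upwards [h0] with x hx v
    ext i
    rw [diagOp_apply, diagOp_apply, diagOp_apply, ← mul_assoc, ← Complex.ofReal_mul,
      Real.mul_self_sqrt (hx i)]

/-- `(α·p + mβ)² = p² + m²`. -/
lemma alphaDot_add_beta_sq (m : ℝ) (p : R3) :
    (alphaDot p + (m : ℂ) • diracBeta) * (alphaDot p + (m : ℂ) • diracBeta) =
      ((‖p‖ ^ 2 + m ^ 2 : ℝ) : ℂ) • (1 : Matrix (Fin 4) (Fin 4) ℂ) := by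
  have hp : ‖p‖ ^ 2 = p 0 ^ 2 + p 1 ^ 2 + p 2 ^ 2 := by
    rw [EuclideanSpace.norm_sq_eq, Fin.sum_univ_three]
    simp
  have hD : alphaDot p + (m : ℂ) • diracBeta =
      !![(m : ℂ), 0, (p 2 : ℂ), p 0 - Complex.I * p 1;
         0, (m : ℂ), p 0 + Complex.I * p 1, -(p 2 : ℂ);
         (p 2 : ℂ), p 0 - Complex.I * p 1, -(m : ℂ), 0;
         p 0 + Complex.I * p 1, -(p 2 : ℂ), 0, -(m : ℂ)] := by
    ext i j
    fin_cases i <;> fin_cases j <;>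
      simp [alphaDot, diracBeta, diracAlpha, Fin.sum_univ_three] <;> ring
  have hI := Complex.I_sq
  rw [hD, hp]
  ext i j
  fin_cases i <;> fin_cases j <;> simp [Matrix.mul_apply, Fin.sum_univ_four] <;>
    first
      | linear_combination (-(p 1 : ℂ) ^ 2) * hI
      | ring

/-- The symbol of the resolvent of `α·(-i∇) + mβ - m`, namely
`(α·p + mβ + m + E) / (p² + m² - (m + E)²)`. -/
def resolventD (m E : ℝ) (p : R3) : C4 →L[ℂ] C4 :=
  (((‖p‖ ^ 2 + m ^ 2 - (m + E) ^ 2)⁻¹ : ℝ) : ℂ) •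
    matOp (alphaDot p + (m : ℂ) • diracBeta + ((m + E : ℝ) : ℂ) • 1)

lemma alphaDot_eq (p : R3) : alphaDot p = ((p 0 : ℝ) : ℂ) • diracAlpha 0 +
    ((p 1 : ℝ) : ℂ) • diracAlpha 1 + ((p 2 : ℝ) : ℂ) • diracAlpha 2 := by
  rw [alphaDot, Fin.sum_univ_three]

lemma norm_matOp_alphaDot_le (p : R3) : ‖matOp (alphaDot p)‖ ≤
    (‖matOp (diracAlpha 0)‖ + ‖matOp (diracAlpha 1)‖ + ‖matOp (diracAlpha 2)‖) * ‖p‖ := by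
  have h : ∀ j : Fin 3, ‖matOp (((p j : ℝ) : ℂ) • diracAlpha j)‖ ≤
      ‖matOp (diracAlpha j)‖ * ‖p‖ := fun j => by
    rw [matOp_smul, norm_smul, Complex.norm_real, mul_comm]
    exact mul_le_mul_of_nonneg_left (PiLp.norm_apply_le p j) (norm_nonneg _)
  rw [alphaDot_eq, matOp_add, matOp_add]
  refine (norm_add₃_le).trans ?_
  linarith [h 0, h 1, h 2]

lemma hasTemperateGrowth_symbolD (m : ℝ) : (symbolD m).HasTemperateGrowth := by
  let L : Fin 3 → R3 →L[ℝ] C4 →L[ℂ] C4 := fun j =>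
    (ContinuousLinearMap.toSpanSingleton ℂ (matOp (diracAlpha j))).restrictScalars ℝ ∘L
      Complex.ofRealCLM ∘L EuclideanSpace.proj j
  have h : symbolD m = fun p =>
      (L 0 + L 1 + L 2) p + matOp ((m : ℂ) • diracBeta - (m : ℂ) • 1) := by
    funext p
    rw [symbolD, add_sub_assoc, matOp_add, alphaDot_eq, matOp_add, matOp_add, matOp_smul,
      matOp_smul, matOp_smul]
    rfl
  rw [h]
  exact (ContinuousLinearMap.hasTemperateGrowth _).add (.const _)

lemma measurable_alphaDot : Measurable fun p => matOp (alphaDot p) := by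
  have h : Continuous alphaDot := by
    rw [funext alphaDot_eq]
    fun_prop
  exact (continuous_matOp.comp h).measurable

/-- Both ends of the gap are admitted as the threshold `E₀`. -/
lemma isResolventSymbol_symbolD {m : ℝ} (hm : 0 < m) {E₀ : ℝ} (hE₀ : E₀ ∈ Set.Icc (-(2 * m)) 0) :
    IsResolventSymbol (symbolD m) (resolventD m) (Set.Ioo (-(2 * m)) 0) E₀ 1 := by
  -- On the closed gap `|m + E| ≤ m`, so the denominator of the resolvent is at least `p²`.
  have hE : ∀ E ∈ insert E₀ (Set.Ioo (-(2 * m)) 0), (m + E) ^ 2 ≤ m ^ 2 := fun E h => by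
    have h' : E ∈ Set.Icc (-(2 * m)) 0 := by
      rcases h with rfl | h
      · exact hE₀
      · exact Set.Ioo_subset_Icc_self h
    nlinarith [h'.1, h'.2]
  have hpos : ∀ E ∈ insert E₀ (Set.Ioo (-(2 * m)) 0), ∀ p : R3, p ≠ 0 →
      0 < ‖p‖ ^ 2 + m ^ 2 - (m + E) ^ 2 := fun E h p hp => by
    have : 0 < ‖p‖ := norm_pos_iff.2 hp
    nlinarith [hE E h]
  set a := ‖matOp (diracAlpha 0)‖ + ‖matOp (diracAlpha 1)‖ + ‖matOp (diracAlpha 2)‖ with ha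
  set b := m * ‖matOp diracBeta‖ + m * ‖matOp 1‖ with hb
  have ha0 : 0 ≤ a := by positivity
  have hb0 : 0 ≤ b := by positivity
  have hle : ∀ E ∈ insert E₀ (Set.Ioo (-(2 * m)) 0), ∀ p : R3, p ≠ 0 →
      ‖resolventD m E p‖ ≤ (a * ‖p‖ + b) * (‖p‖ ^ 2)⁻¹ := fun E h p hp => by
    have h0 : 0 < ‖p‖ := norm_pos_iff.2 hp
    rw [resolventD, norm_smul, Complex.norm_real,
      Real.norm_of_nonneg (inv_nonneg.2 (hpos E h p hp).le), mul_comm]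
    have h1 : ‖matOp (alphaDot p + (m : ℂ) • diracBeta + ((m + E : ℝ) : ℂ) • 1)‖ ≤
        a * ‖p‖ + b := by
      rw [matOp_add, matOp_add, matOp_smul, matOp_smul, hb, ← add_assoc]
      refine norm_add₃_le.trans (add_le_add (add_le_add (norm_matOp_alphaDot_le p) ?_) ?_)
      · rw [norm_smul, Complex.norm_real, Real.norm_of_nonneg hm.le]
      · rw [norm_smul, Complex.norm_real]
        exact mul_le_mul_of_nonneg_right (abs_le_of_sq_le_sq (hE E h) hm.le)
          (norm_nonneg _)
    exact mul_le_mul h1 (inv_anti₀ (by positivity) (by linarith [hE E h]))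
      (inv_nonneg.2 (hpos E h p hp).le) (by positivity)
  -- `(D + e) (D - e) = D² - e² = p² + m² - e²` for `D = α·p + mβ` and `e = m + E`.
  have hfac : ∀ (E : ℝ) (p : R3),
      (alphaDot p + (m : ℂ) • diracBeta + ((m + E : ℝ) : ℂ) • 1) *
        (alphaDot p + (m : ℂ) • diracBeta - ((m + E : ℝ) : ℂ) • 1) =
      ((‖p‖ ^ 2 + m ^ 2 - (m + E) ^ 2 : ℝ) : ℂ) • 1 ∧
      (alphaDot p + (m : ℂ) • diracBeta - ((m + E : ℝ) : ℂ) • 1) *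
        (alphaDot p + (m : ℂ) • diracBeta + ((m + E : ℝ) : ℂ) • 1) =
      ((‖p‖ ^ 2 + m ^ 2 - (m + E) ^ 2 : ℝ) : ℂ) • 1 := fun E p => by
    have hsq := alphaDot_add_beta_sq m p
    generalize alphaDot p + (m : ℂ) • diracBeta = D at hsq
    rw [Complex.ofReal_sub, sub_smul, ← hsq, Complex.ofReal_pow, sq, mul_smul]
    constructor <;>
      simp only [add_mul, mul_add, sub_mul, mul_sub, smul_mul_assoc, mul_smul_comm, mul_one,
        one_mul, smul_add, smul_sub] <;>
      abel
  have hsym : ∀ (E : ℝ) (p : R3) (v : C4), symbolD m p v - (E : ℂ) • v =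
      matOp (alphaDot p + (m : ℂ) • diracBeta - ((m + E : ℝ) : ℂ) • 1) v := fun E p v => by
    rw [symbolD, matOp_sub, matOp_sub, matOp_smul _ 1, matOp_smul _ 1, matOp_one]
    simp only [sub_apply, smul_apply, ContinuousLinearMap.id_apply, Complex.ofReal_add, add_smul]
    abel
  have hone : ∀ (c : ℂ) (v : C4), matOp (c • 1) v = c • v := fun c v => by
    rw [matOp_smul, matOp_one]
    rfl
  refine ⟨hasTemperateGrowth_symbolD m, fun E => ?_, fun E h p hp v => ?_, fun E h p hp v => ?_,
    ⟨a + b, fun E h p hp => ⟨fun h1 => ?_, fun h1 => ?_⟩⟩, fun p hp => ?_⟩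
  · refine Measurable.aestronglyMeasurable ?_
    have := measurable_alphaDot
    unfold resolventD
    simp only [add_assoc, matOp_add (alphaDot _)]
    fun_prop
  · have h1 : ((‖p‖ ^ 2 + m ^ 2 - (m + E) ^ 2 : ℝ) : ℂ) ≠ 0 := by
      exact_mod_cast (hpos E h p hp).ne'
    rw [hsym, resolventD, smul_apply, ← matOp_mul_apply, (hfac E p).1, hone, smul_smul,
      Complex.ofReal_inv, inv_mul_cancel₀ h1, one_smul]
  · have h1 : ((‖p‖ ^ 2 + m ^ 2 - (m + E) ^ 2 : ℝ) : ℂ) ≠ 0 := by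
      exact_mod_cast (hpos E h p hp).ne'
    rw [hsym, resolventD, smul_apply, map_smul, ← matOp_mul_apply, (hfac E p).2, hone, smul_smul,
      Complex.ofReal_inv, inv_mul_cancel₀ h1, one_smul]
  · refine (hle E h p hp).trans ?_
    refine mul_le_mul_of_nonneg_right ?_ (by positivity)
    nlinarith
  · exact (hle E h p hp).trans (le_inv_sq_of_one_le h1 hb0)
  · have h1 : ‖p‖ ^ 2 + m ^ 2 - (m + E₀) ^ 2 ≠ 0 := (hpos E₀ (Set.mem_insert _ _) p hp).ne'
    have h2 : ContinuousAt (fun E => (((‖p‖ ^ 2 + m ^ 2 - (m + E) ^ 2)⁻¹ : ℝ) : ℂ)) E₀ :=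
      Complex.continuous_ofReal.continuousAt.comp (ContinuousAt.inv₀ (by fun_prop) h1)
    have h3 : Continuous fun E : ℝ => alphaDot p + (m : ℂ) • diracBeta +
        ((m + E : ℝ) : ℂ) • (1 : Matrix (Fin 4) (Fin 4) ℂ) := by fun_prop
    exact h2.smul (continuous_matOp.comp h3).continuousAt

lemma continuous_kernelD (m : ℝ) (x : R3) : Continuous fun E => kernelD m E x := by
  have := continuous_nu m
  exact continuous_matOp.comp (by fun_prop)

/-- At both thresholds `ν_E = 0`, and the kernel is `(mβ + m + E₀) / (4π|x|) + iα·x / (4π|x|³)`. -/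
lemma hasSymbol_kernelD {m E₀ : ℝ} (hE₀ : (m + E₀) ^ 2 = m ^ 2) :
    HasSymbol (kernelD m E₀) (resolventD m E₀) := by
  have hν : nu m E₀ = 0 := by simp [nu, add_comm E₀, hE₀]
  have h := ((((hasSymbol_gradCoulomb 0).smul_const (matOp (diracAlpha 0))).add
    ((hasSymbol_gradCoulomb 1).smul_const (matOp (diracAlpha 1)))).add
    ((hasSymbol_gradCoulomb 2).smul_const (matOp (diracAlpha 2)))).add
    (hasSymbol_coulomb.smul_const (matOp ((m : ℂ) • diracBeta + ((m + E₀ : ℝ) : ℂ) • 1)))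
  refine (h.congr_symbol (.of_forall fun p => ?_)).congr_kernel (.of_forall fun x => ?_)
  · simp only [resolventD]
    rw [hE₀, add_sub_cancel_right, ← matOp_smul, ← matOp_smul, ← matOp_smul, ← matOp_smul,
      ← matOp_smul, ← matOp_add, ← matOp_add, ← matOp_add]
    congr 1
    rw [alphaDot_eq]
    push_cast
    module
  · simp only [kernelD]
    rw [hν, ← matOp_smul, ← matOp_smul, ← matOp_smul, ← matOp_smul, ← matOp_add, ← matOp_add,
      ← matOp_add]
    congr 1
    rw [alphaDot_eq, yukawa_zero_apply]
    simp only [zero_mul, neg_zero, Real.exp_zero, zero_div, Complex.ofReal_zero, mul_zero,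
      zero_smul, add_zero, one_div, mul_inv]
    push_cast
    module

/-- The Dirac case at either threshold, with the weight exponent `k = 1`. -/
theorem thresholdConclusion_dirac {m : ℝ} (hm : 0 < m) {E₀ : ℝ}
    (hE₀ : E₀ = 0 ∨ E₀ = -(2 * m)) {V : R3 → EuclideanSpace ℝ (Fin 4)}
    (h0 : ∀ᵐ x, ∀ i, 0 ≤ V x i) (h1 : MemLp V 1) (htop : MemLp V ⊤) {lamc : ℝ} {l lK : Filter ℝ}
    [lK.NeBot] (hl : l ≤ 𝓝 lamc) (hlK : lK ≤ 𝓝 E₀) {E : ℝ → ℝ} {lam : ℕ → ℝ}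
    {φ : ℕ → R3 → C4} {μ₀ : R3 → C4}
    (h : IsThresholdSequence (symbolD m) (fun x => diagOp fun i => V x i)
      (fun x => diagOp fun i => Real.sqrt (V x i)) (Set.Ioo (-(2 * m)) 0) E₀ l E lam φ μ₀) :
    ThresholdConclusion (symbolD m) (fun x => diagOp fun i => V x i)
      (fun x => diagOp fun i => Real.sqrt (V x i)) (kernelD m) lK E₀ lamc φ μ₀
      {ω | ∃ w : R3 → Matrix (Fin 4) (Fin 4) ℂ, (ω = fun p => matOp (w p)) ∧ IsWeight 1 ω} := by
  have hmem : E₀ ∈ Set.Icc (-(2 * m)) 0 := by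
    rcases hE₀ with rfl | rfl
    · exact ⟨by linarith, le_rfl⟩
    · exact ⟨le_rfl, by linarith⟩
  have hsq : (m + E₀) ^ 2 = m ^ 2 := by
    rcases hE₀ with rfl | rfl <;> ring
  exact thresholdConclusion_of_symbol (isResolventSymbol_symbolD hm hmem)
    (isPotentialRoot_diagOp h0 h1 htop) hl
    (fun x _ => ((continuous_kernelD m x).tendsto E₀).mono_left hlK) (hasSymbol_kernelD hsq) h
    fun w ⟨_, _, hw⟩ => hw

end Dirac

end Threshold

end

open Threshold in
theorem theorem1p1 :
    -- Schroedinger case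
    (∀ (V : R3 → ℝ), (∀ᵐ x, 0 ≤ V x) → MemLp V 1 volume → MemLp V ⊤ volume →
      ∀ (lamc : ℝ) (E : ℝ → ℝ) (lam : ℕ → ℝ) (φ : ℕ → R3 → ℂ) (μ₀ : R3 → ℂ),
      IsThresholdSequence symbolS (fun x => mulOp (V x : ℂ))
        (fun x => mulOp (Real.sqrt (V x) : ℂ)) (Set.Iio 0) 0 (𝓝[>] lamc) E lam φ μ₀ →
      ThresholdConclusion symbolS (fun x => mulOp (V x : ℂ))
        (fun x => mulOp (Real.sqrt (V x) : ℂ)) kernelS (𝓝[<] 0) 0 lamc φ μ₀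
        {ω | ∃ w : R3 → ℂ, (ω = fun p => mulOp (w p)) ∧ IsWeight 2 ω}) ∧
    -- pseudorelativistic case
    (∀ (m : ℝ), 0 < m →
      ∀ (V : R3 → ℝ), (∀ᵐ x, 0 ≤ V x) → MemLp V 1 volume → MemLp V ⊤ volume →
      ∀ (lamc : ℝ) (E : ℝ → ℝ) (lam : ℕ → ℝ) (φ : ℕ → R3 → ℂ) (μ₀ : R3 → ℂ),
      IsThresholdSequence (symbolRel m) (fun x => mulOp (V x : ℂ))
        (fun x => mulOp (Real.sqrt (V x) : ℂ)) (Set.Iio 0) 0 (𝓝[>] lamc) E lam φ μ₀ →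
      ThresholdConclusion (symbolRel m) (fun x => mulOp (V x : ℂ))
        (fun x => mulOp (Real.sqrt (V x) : ℂ)) (kernelRel m) (𝓝[<] 0) 0 lamc φ μ₀
        {ω | ∃ w : R3 → ℂ, (ω = fun p => mulOp (w p)) ∧ IsWeight 1 ω}) ∧
    -- Dirac case, energy tending to `0` from below as the coupling decreases
    (∀ (m : ℝ), 0 < m →
      ∀ (V : R3 → EuclideanSpace ℝ (Fin 4)), (∀ᵐ x, ∀ i, 0 ≤ V x i) →
      MemLp V 1 volume → MemLp V ⊤ volume →
      ∀ (lamc : ℝ) (E : ℝ → ℝ) (lam : ℕ → ℝ) (φ : ℕ → R3 → C4) (μ₀ : R3 → C4),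
      IsThresholdSequence (symbolD m) (fun x => diagOp fun i => V x i)
        (fun x => diagOp fun i => Real.sqrt (V x i)) (Set.Ioo (-(2 * m)) 0) 0
        (𝓝[>] lamc) E lam φ μ₀ →
      ThresholdConclusion (symbolD m) (fun x => diagOp fun i => V x i)
        (fun x => diagOp fun i => Real.sqrt (V x i)) (kernelD m) (𝓝[<] 0) 0 lamc φ μ₀
        {ω | ∃ w : R3 → Matrix (Fin 4) (Fin 4) ℂ, (ω = fun p => matOp (w p)) ∧ IsWeight 1 ω}) ∧
    -- Dirac case, energy tending to `-2m` from above as the coupling increases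
    (∀ (m : ℝ), 0 < m →
      ∀ (V : R3 → EuclideanSpace ℝ (Fin 4)), (∀ᵐ x, ∀ i, 0 ≤ V x i) →
      MemLp V 1 volume → MemLp V ⊤ volume →
      ∀ (lamc : ℝ) (E : ℝ → ℝ) (lam : ℕ → ℝ) (φ : ℕ → R3 → C4) (μ₀ : R3 → C4),
      IsThresholdSequence (symbolD m) (fun x => diagOp fun i => V x i)
        (fun x => diagOp fun i => Real.sqrt (V x i)) (Set.Ioo (-(2 * m)) 0) (-(2 * m))
        (𝓝[<] lamc) E lam φ μ₀ →
      ThresholdConclusion (symbolD m) (fun x => diagOp fun i => V x i)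
        (fun x => diagOp fun i => Real.sqrt (V x i)) (kernelD m) (𝓝[>] (-(2 * m)))
        (-(2 * m)) lamc φ μ₀
        {ω | ∃ w : R3 → Matrix (Fin 4) (Fin 4) ℂ, (ω = fun p => matOp (w p)) ∧ IsWeight 1 ω}) := by
  refine ⟨fun V h0 h1 htop lamc E lam φ μ₀ h => thresholdConclusion_schroedinger h0 h1 htop h,
    fun m hm V h0 h1 htop lamc E lam φ μ₀ h => thresholdConclusion_relativistic hm h0 h1 htop h,
    fun m hm V h0 h1 htop lamc E lam φ μ₀ h => thresholdConclusion_dirac hm (.inl rfl) h0 h1 htop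
      nhdsWithin_le_nhds nhdsWithin_le_nhds h,
    fun m hm V h0 h1 htop lamc E lam φ μ₀ h => thresholdConclusion_dirac hm (.inr rfl) h0 h1 htop
      nhdsWithin_le_nhds nhdsWithin_le_nhds h⟩
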